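/- Let $\mathcal F=\{R_1,\dots,R_n\}$, $n\ge 1$, be a family of (closed) axis-parallel rectangles, where $R_i$ has width $w_i>0$ and height $h_i>0$. A set $P\subset\mathbb R^2$ is \emph{$\mathcal F$-piercing} if every translate of every $R_i$ contains a point of $P$. The density of a lattice $\Lambda\subset\mathbb R^2$ is the reciprocal of the area of its fundamental parallelogram, and an \emph{optimal $\mathcal F$-piercing lattice} is an $\mathcal F$-piercing lattice whose density is minimum among all $\mathcal F$-piercing lattices. Let $$k=\max\left\{\frac{\max_i w_i}{\min_i w_i},\ \frac{\max_i h_i}{\min_i h_i}\right\},$$ that is, $k$ is the largest side length after the two axes have been scaled so that the minimum width and the minimum height are both $1$ (so $k=\max_i\max\{w_i,h_i\}$ if $\min_i w_i=\min_i h_i=1$). There is a real RAM algorithm which, given $n$ and $w_1,h_1,\dots,w_n,h_n$, computes a vector basis $[u,v]$ of an optimal $\mathcal F$-piercing lattice in $$O\bigl(k^8\,n^4\,(n+k)\,\log k\bigr)$$ time, where $\log k$ is to be read as $\log\max\{k,2\}$ and the implied constant is absolute. Here a real RAM is a random access machine with natural-number registers (constants, addition, truncated subtraction, halving, comparison, indirect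 addressing) and real registers (integer constants, the four arithmetic operations, comparison), without rounding of reals or root extraction, in which every instruction takes unit time. -/

import Mathlib

namespace LatticePiercing

/-! ### Rectangles, lattices, piercing -/

/-- A family of `n` axis-parallel rectangles `width i × height i` (given up to translation). -/
structure RectFamily (n : ℕ) where
  width : Fin n → ℝ
  height : Fin n → ℝ
  width_pos : ∀ i, 0 < width i
  height_pos : ∀ i, 0 < height i

/-- The maximum dimension `k` of the family after the two axes have been scaled so that the minimum
width and the minimum height are both `1`. For a family with minimum width and minimum height `1`
it is the largest width or height. -/
noncomputable def RectFamily.maxDim {n : ℕ} (F : RectFamily n) : ℝ :=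
  max ((⨆ i, F.width i) / (⨅ i, F.width i)) ((⨆ i, F.height i) / (⨅ i, F.height i))

/-- `Λ` is a (full rank) lattice in the plane. -/
def IsPlaneLattice (Λ : Submodule ℤ (Fin 2 → ℝ)) : Prop :=
  ∃ _ : DiscreteTopology Λ, IsZLattice ℝ Λ

/-- The density of a lattice: the reciprocal of the area of a fundamental parallelogram. -/
noncomputable def density (Λ : Submodule ℤ (Fin 2 → ℝ)) : ℝ :=
  (ZLattice.covolume Λ)⁻¹

/-- `P` is `F`-piercing: every translate of every (closed) rectangle of `F` contains a point
of `P`. -/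
def IsPiercing {n : ℕ} (F : RectFamily n) (P : Set (Fin 2 → ℝ)) : Prop :=
  ∀ (i : Fin n) (x : Fin 2 → ℝ), ∃ p ∈ P, p ∈ Set.Icc x (x + ![F.width i, F.height i])

/-- `Λ` is an optimal `F`-piercing lattice: an `F`-piercing lattice of minimum density among all
`F`-piercing lattices. -/
def IsOptimalPiercingLattice {n : ℕ} (F : RectFamily n) (Λ : Submodule ℤ (Fin 2 → ℝ)) : Prop :=
  IsPlaneLattice Λ ∧ IsPiercing F Λ ∧
    ∀ Λ' : Submodule ℤ (Fin 2 → ℝ), IsPlaneLattice Λ' → IsPiercing F Λ' → density Λ ≤ density Λ'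

/-! ### The real RAM

A program is a finite list of instructions. It works on natural-number registers and real registers
(a program names only finitely many of them) and on two unbounded memories, one holding natural
numbers and one holding reals, which are addressed through natural-number registers. Every
instruction costs one step. The only real constants are integers, and there is no rounding of reals
to integers and no root extraction. -/

/-- Instructions; `d`, `s`, `t` are register indices, `l` is a program location. -/
inductive Instr where
  /-- `I[d] := c` -/
  | iconst (d c : ℕ)
  /-- `I[d] := I[s] + I[t]` -/
  | iadd (d s t : ℕ)
  /-- `I[d] := I[s] - I[t]`, truncated at `0` -/
  | isub (d s t : ℕ)
  /-- `I[d] := ⌊I[s] / 2⌋` -/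
  | ihalf (d s : ℕ)
  /-- `I[d] := imem[I[s]]` -/
  | iload (d s : ℕ)
  /-- `imem[I[d]] := I[s]` -/
  | istore (d s : ℕ)
  /-- `R[d] := c` -/
  | rconst (d : ℕ) (c : ℤ)
  /-- `R[d] := R[s] + R[t]` -/
  | radd (d s t : ℕ)
  /-- `R[d] := R[s] - R[t]` -/
  | rsub (d s t : ℕ)
  /-- `R[d] := R[s] * R[t]` -/
  | rmul (d s t : ℕ)
  /-- `R[d] := R[s] / R[t]` (and `0` if `R[t] = 0`) -/
  | rdiv (d s t : ℕ)
  /-- `R[d] := rmem[I[s]]` -/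
  | rload (d s : ℕ)
  /-- `rmem[I[d]] := R[s]` -/
  | rstore (d s : ℕ)
  /-- `if I[s] ≤ I[t] then goto l` -/
  | ijump (s t l : ℕ)
  /-- `if R[s] ≤ R[t] then goto l` -/
  | rjump (s t l : ℕ)

abbrev Program := List Instr

/-- Machine configurations. -/
structure Config where
  pc : ℕ
  ireg : ℕ → ℕ
  rreg : ℕ → ℝ
  imem : ℕ → ℕ
  rmem : ℕ → ℝ

open Function in
open Classical in
/-- The effect of one instruction. -/
noncomputable def Instr.exec (c : Config) : Instr → Config
  | iconst d m => { c with pc := c.pc + 1, ireg := update c.ireg d m }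
  | iadd d s t => { c with pc := c.pc + 1, ireg := update c.ireg d (c.ireg s + c.ireg t) }
  | isub d s t => { c with pc := c.pc + 1, ireg := update c.ireg d (c.ireg s - c.ireg t) }
  | ihalf d s => { c with pc := c.pc + 1, ireg := update c.ireg d (c.ireg s / 2) }
  | iload d s => { c with pc := c.pc + 1, ireg := update c.ireg d (c.imem (c.ireg s)) }
  | istore d s => { c with pc := c.pc + 1, imem := update c.imem (c.ireg d) (c.ireg s) }
  | rconst d m => { c with pc := c.pc + 1, rreg := update c.rreg d (m : ℝ) }
  | radd d s t => { c with pc := c.pc + 1, rreg := update c.rreg d (c.rreg s + c.rreg t) }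
  | rsub d s t => { c with pc := c.pc + 1, rreg := update c.rreg d (c.rreg s - c.rreg t) }
  | rmul d s t => { c with pc := c.pc + 1, rreg := update c.rreg d (c.rreg s * c.rreg t) }
  | rdiv d s t => { c with pc := c.pc + 1, rreg := update c.rreg d (c.rreg s / c.rreg t) }
  | rload d s => { c with pc := c.pc + 1, rreg := update c.rreg d (c.rmem (c.ireg s)) }
  | rstore d s => { c with pc := c.pc + 1, rmem := update c.rmem (c.ireg d) (c.rreg s) }
  | ijump s t l => { c with pc := if c.ireg s ≤ c.ireg t then l else c.pc + 1 }
  | rjump s t l => { c with pc := if c.rreg s ≤ c.rreg t then l else c.pc + 1 }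

/-- One step of the machine; it stops when the program counter leaves the program. -/
noncomputable def Program.step (p : Program) (c : Config) : Config :=
  match p[c.pc]? with
  | none => c
  | some a => a.exec c

/-- `c` is a halting configuration of `p`. -/
def Program.Halted (p : Program) (c : Config) : Prop := p.length ≤ c.pc

/-- The configuration after `t` steps. -/
noncomputable def Program.run (p : Program) (t : ℕ) (c : Config) : Config := (p.step)^[t] c

/-- The input: register `I[0]` holds `n`, and the real memory holds
`w₀, h₀, w₁, h₁, …, wₙ₋₁, hₙ₋₁`; everything else is `0`. -/
noncomputable def RectFamily.input {n : ℕ} (F : RectFamily n) : Config where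
  pc := 0
  ireg := fun r => if r = 0 then n else 0
  rreg := fun _ => 0
  imem := fun _ => 0
  rmem := fun m =>
    if hm : m / 2 < n then
      if m % 2 = 0 then F.width ⟨m / 2, hm⟩ else F.height ⟨m / 2, hm⟩
    else 0

/-- First output vector `(R[0], R[1])`. -/
def Config.outU (c : Config) : Fin 2 → ℝ := ![c.rreg 0, c.rreg 1]

/-- Second output vector `(R[2], R[3])`. -/
def Config.outV (c : Config) : Fin 2 → ℝ := ![c.rreg 2, c.rreg 3]

end LatticePiercing

namespace LatticePiercing

/-! ### Structured programs and their compilation -/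

/-- Structured programs: straight-line blocks, composition, branching and `while` loops. -/
inductive Cmd where
  /-- A sequence of instructions without jumps. -/
  | block (l : List Instr)
  | seq (c d : Cmd)
  /-- `if I[s] ≤ I[t] then c else d` -/
  | ile (s t : ℕ) (c d : Cmd)
  /-- `if R[s] ≤ R[t] then c else d` -/
  | rle (s t : ℕ) (c d : Cmd)
  /-- `while ¬ I[s] ≤ I[t] do c` -/
  | iwhile (s t : ℕ) (c : Cmd)
  /-- `while ¬ R[s] ≤ R[t] do c` -/
  | rwhile (s t : ℕ) (c : Cmd)

/-- Straight-line instructions. -/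
def Instr.IsOp : Instr → Prop
  | ijump _ _ _ => False
  | rjump _ _ _ => False
  | _ => True

namespace Cmd

/-- The number of instructions of the compiled program. -/
def size : Cmd → ℕ
  | block l => l.length
  | seq c d => c.size + d.size
  | ile _ _ c d => d.size + c.size + 2
  | rle _ _ c d => d.size + c.size + 2
  | iwhile _ _ c => c.size + 2
  | rwhile _ _ c => c.size + 2

/-- The compiled program, to be placed at address `o`. -/
def compile : Cmd → ℕ → List Instr
  | block l, _ => l
  | seq c d, o => c.compile o ++ d.compile (o + c.size)
  | ile s t c d, o =>   .ijump s t (o + 1 + d.size + 1) :: (d.compile (o + 1) ++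
      (.ijump 0 0 (o + 1 + d.size + 1 + c.size) :: c.compile (o + 1 + d.size + 1)))
  | rle s t c d, o =>   .rjump s t (o + 1 + d.size + 1) :: (d.compile (o + 1) ++
      (.ijump 0 0 (o + 1 + d.size + 1 + c.size) :: c.compile (o + 1 + d.size + 1)))
  | iwhile s t c, o => .ijump s t (o + 1 + c.size + 1) :: (c.compile (o + 1) ++ [.ijump 0 0 o])
  | rwhile s t c, o => .rjump s t (o + 1 + c.size + 1) :: (c.compile (o + 1) ++ [.ijump 0 0 o])

theorem length_compile (c : Cmd) (o : ℕ) : (c.compile o).length = c.size := by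
  induction c generalizing o with
  | block l => rfl
  | seq c d hc hd => simp [compile, size, hc, hd]
  | ile s t c d hc hd => simp [compile, size, hc, hd]; omega
  | rle s t c d hc hd => simp [compile, size, hc, hd]; omega
  | iwhile s t c hc => simp [compile, size, hc]
  | rwhile s t c hc => simp [compile, size, hc]

end Cmd

/-- The instructions `l` stand in `p` from address `o` on. -/
def CodeAt (p : Program) (o : ℕ) (l : List Instr) : Prop :=
  ∀ i (h : i < l.length), p[o + i]? = some l[i]

theorem CodeAt.append {p : Program} {o : ℕ} {l m : List Instr} (h : CodeAt p o (l ++ m)) :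
    CodeAt p o l ∧ CodeAt p (o + l.length) m := by
  constructor
  · intro i hi
    have := h i (by simp; omega)
    rwa [List.getElem_append_left hi] at this
  · intro i hi
    have := h (l.length + i) (by simp; omega)
    rw [List.getElem_append_right (by omega)] at this
    simpa [add_assoc] using this

theorem CodeAt.head {p : Program} {o : ℕ} {a : Instr} {m : List Instr} (h : CodeAt p o (a :: m)) :
    p[o]? = some a ∧ CodeAt p (o + 1) m := by
  refine ⟨h 0 (by simp), fun i hi => ?_⟩
  have := h (i + 1) (by simp; omega)
  simpa [add_assoc, add_comm, add_left_comm] using this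

theorem Program.run_add (p : Program) (s t : ℕ) (c : Config) :
    p.run (s + t) c = p.run t (p.run s c) := by
  unfold Program.run
  rw [add_comm, Function.iterate_add_apply]

theorem Program.run_one {p : Program} {c : Config} {a : Instr} (h : p[c.pc]? = some a) :
    p.run 1 c = a.exec c := by
  simp [Program.run, Program.step, h]

/-- The configuration `c` with the program counter set to `o`. -/
def Config.at (c : Config) (o : ℕ) : Config := { c with pc := o }

theorem Instr.exec_at {a : Instr} (ha : a.IsOp) (c : Config) (o : ℕ) :
    a.exec (c.at o) = (a.exec c).at (o + 1) := by
  cases a <;> first | rfl | exact ha.elim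

/-- Wherever it is placed, the compiled `c` turns `st` into `st'` within `T` steps. -/
def Cmd.Runs (c : Cmd) (st st' : Config) (T : ℕ) : Prop :=
  ∃ t ≤ T, ∀ (p : Program) (o : ℕ), CodeAt p o (c.compile o) →
    p.run t (st.at o) = st'.at (o + c.size)

/-- From `st`, the command `c` ends within `T` steps in a configuration with property `Q`. -/
def wp (c : Cmd) (st : Config) (T : ℕ) (Q : Config → Prop) : Prop :=
  ∃ st', c.Runs st st' T ∧ Q st'

theorem wp.mono {c : Cmd} {st : Config} {T T' : ℕ} {Q Q' : Config → Prop} (h : wp c st T Q)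
    (hT : T ≤ T') (hQ : ∀ st', Q st' → Q' st') : wp c st T' Q' := by
  obtain ⟨st', ⟨t, ht, hr⟩, hq⟩ := h
  exact ⟨st', ⟨t, ht.trans hT, hr⟩, hQ _ hq⟩

theorem wp_seq {c d : Cmd} {st : Config} {S T : ℕ} {Q : Config → Prop}
    (h : wp c st S fun st1 => wp d st1 T Q) : wp (c.seq d) st (S + T) Q := by
  obtain ⟨s1, ⟨t1, ht1, h1⟩, s2, ⟨t2, ht2, h2⟩, hq⟩ := h
  refine ⟨s2, ⟨t1 + t2, by omega, fun p o hp => ?_⟩, hq⟩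
  have hp' := CodeAt.append hp
  rw [Cmd.length_compile] at hp'
  rw [Program.run_add, h1 p o hp'.1, h2 p _ hp'.2]
  simp [Cmd.size, add_assoc]

theorem wp_seq_le {c d : Cmd} {st : Config} {U : ℕ} {Q : Config → Prop} (S T : ℕ)
    (hU : S + T ≤ U) (h : wp c st S fun st1 => wp d st1 T Q) : wp (c.seq d) st U Q :=
  (wp_seq h).mono hU fun _ h => h

theorem runs_block (l : List Instr) (hl : ∀ a ∈ l, a.IsOp) (st : Config) :
    (Cmd.block l).Runs st (l.foldl (fun c a => a.exec c) st) l.length := by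
  refine ⟨l.length, le_rfl, ?_⟩
  induction l generalizing st with
  | nil => intro p o _; simp [Program.run, Cmd.size]
  | cons a l ih =>
    intro p o hp
    obtain ⟨h0, h1⟩ := CodeAt.head hp
    have := ih (fun b hb => hl b (by simp [hb])) (a.exec st) p (o + 1) h1
    rw [List.length_cons, add_comm, Program.run_add, Program.run_one h0,
      Instr.exec_at (hl a (by simp)), this]
    simp only [Cmd.size, List.length_cons]
    congr 1; omega

theorem wp_block {l : List Instr} (hl : ∀ a ∈ l, a.IsOp) {st : Config} {Q : Config → Prop}
    (h : Q (l.foldl (fun c a => a.exec c) st)) : wp (.block l) st l.length Q :=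
  ⟨_, runs_block l hl st, h⟩

theorem wp_block_le {l : List Instr} (hl : ∀ a ∈ l, a.IsOp) {st : Config} {T : ℕ}
    {Q : Config → Prop} (hT : l.length ≤ T) (h : Q (l.foldl (fun c a => a.exec c) st)) :
    wp (.block l) st T Q :=
  (wp_block hl h).mono hT fun _ h => h

theorem run_ijump {p : Program} {o s t l : ℕ} (h : p[o]? = some (.ijump s t l)) (st : Config) :
    p.run 1 (st.at o) = st.at (if st.ireg s ≤ st.ireg t then l else o + 1) := by
  rw [Program.run_one (a := .ijump s t l) (by simpa [Config.at] using h)]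
  rfl

open Classical in
theorem run_rjump {p : Program} {o s t l : ℕ} (h : p[o]? = some (.rjump s t l)) (st : Config) :
    p.run 1 (st.at o) = st.at (if st.rreg s ≤ st.rreg t then l else o + 1) := by
  rw [Program.run_one (a := .rjump s t l) (by simpa [Config.at] using h)]
  rfl

theorem wp_ile {s t : ℕ} {c d : Cmd} {st : Config} {T : ℕ} {Q : Config → Prop}
    (hc : st.ireg s ≤ st.ireg t → wp c st T Q) (hd : ¬ st.ireg s ≤ st.ireg t → wp d st T Q) :
    wp (.ile s t c d) st (T + 2) Q := by
  by_cases h : st.ireg s ≤ st.ireg t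
  · obtain ⟨s1, ⟨t1, ht1, h1⟩, hq⟩ := hc h
    refine ⟨s1, ⟨1 + t1, by omega, fun p o hp => ?_⟩, hq⟩
    obtain ⟨h0, hp⟩ := CodeAt.head hp
    have hp := (CodeAt.head (CodeAt.append hp).2).2
    rw [Cmd.length_compile] at hp
    rw [Program.run_add, run_ijump h0, if_pos h, h1 p _ hp]
    simp only [Cmd.size]
    congr 1; omega
  · obtain ⟨s1, ⟨t1, ht1, h1⟩, hq⟩ := hd h
    refine ⟨s1, ⟨1 + (t1 + 1), by omega, fun p o hp => ?_⟩, hq⟩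
    obtain ⟨h0, hp⟩ := CodeAt.head hp
    have hp2 := CodeAt.append hp
    rw [Program.run_add, run_ijump h0, if_neg h, Program.run_add, h1 p _ hp2.1]
    have h3 := (CodeAt.head hp2.2).1
    rw [Cmd.length_compile] at h3
    rw [run_ijump h3, if_pos le_rfl]
    simp only [Cmd.size]
    congr 1; omega

theorem wp_rle {s t : ℕ} {c d : Cmd} {st : Config} {T : ℕ} {Q : Config → Prop}
    (hc : st.rreg s ≤ st.rreg t → wp c st T Q) (hd : ¬ st.rreg s ≤ st.rreg t → wp d st T Q) :
    wp (.rle s t c d) st (T + 2) Q := by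
  by_cases h : st.rreg s ≤ st.rreg t
  · obtain ⟨s1, ⟨t1, ht1, h1⟩, hq⟩ := hc h
    refine ⟨s1, ⟨1 + t1, by omega, fun p o hp => ?_⟩, hq⟩
    obtain ⟨h0, hp⟩ := CodeAt.head hp
    have hp := (CodeAt.head (CodeAt.append hp).2).2
    rw [Cmd.length_compile] at hp
    rw [Program.run_add, run_rjump h0, if_pos h, h1 p _ hp]
    simp only [Cmd.size]
    congr 1; omega
  · obtain ⟨s1, ⟨t1, ht1, h1⟩, hq⟩ := hd h
    refine ⟨s1, ⟨1 + (t1 + 1), by omega, fun p o hp => ?_⟩, hq⟩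
    obtain ⟨h0, hp⟩ := CodeAt.head hp
    have hp2 := CodeAt.append hp
    rw [Program.run_add, run_rjump h0, if_neg h, Program.run_add, h1 p _ hp2.1]
    have h3 := (CodeAt.head hp2.2).1
    rw [Cmd.length_compile] at h3
    rw [run_ijump h3, if_pos le_rfl]
    simp only [Cmd.size]
    congr 1; omega

theorem wp_iwhile {s t : ℕ} {c : Cmd} {st : Config} {T m : ℕ} {Q : Config → Prop}
    (Inv : ℕ → Config → Prop) (h0 : Inv 0 st)
    (hstep : ∀ j < m, ∀ st, Inv j st → ¬ st.ireg s ≤ st.ireg t ∧ wp c st T (Inv (j + 1)))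
    (hend : ∀ st, Inv m st → st.ireg s ≤ st.ireg t ∧ Q st) :
    wp (.iwhile s t c) st (m * (T + 2) + 1) Q := by
  suffices H : ∀ i ≤ m, ∀ st, Inv (m - i) st → wp (.iwhile s t c) st (i * (T + 2) + 1) Q from
    H m le_rfl st (by simpa using h0)
  intro i
  induction i with
  | zero =>
    intro _ st hI
    obtain ⟨hle, hQ⟩ := hend st (by simpa using hI)
    refine ⟨st, ⟨1, by omega, fun p o hp => ?_⟩, hQ⟩
    rw [run_ijump (CodeAt.head hp).1, if_pos hle]
    simp only [Cmd.size]
    congr 1; omega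
  | succ i ih =>
    intro hi st hI
    obtain ⟨hle, s1, ⟨t1, ht1, h1⟩, hI1⟩ := hstep (m - (i + 1)) (by omega) st hI
    obtain ⟨s2, ⟨t2, ht2, h2⟩, hq⟩ := ih (by omega) s1
      (by rwa [show m - (i + 1) + 1 = m - i by omega] at hI1)
    refine ⟨s2, ⟨1 + (t1 + (1 + t2)), ?_, fun p o hp => ?_⟩, hq⟩
    · rw [Nat.succ_mul]; omega
    · obtain ⟨hj, hp'⟩ := CodeAt.head hp
      have hp2 := CodeAt.append hp'
      have h3 := (CodeAt.head hp2.2).1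
      rw [Cmd.length_compile] at h3
      rw [Program.run_add, run_ijump hj, if_neg hle, Program.run_add, h1 p _ hp2.1,
        Program.run_add, run_ijump h3, if_pos le_rfl, h2 p o hp]

theorem wp_rwhile {s t : ℕ} {c : Cmd} {st : Config} {T m : ℕ} {Q : Config → Prop}
    (Inv : ℕ → Config → Prop) (h0 : Inv 0 st)
    (hstep : ∀ j < m, ∀ st, Inv j st → ¬ st.rreg s ≤ st.rreg t ∧ wp c st T (Inv (j + 1)))
    (hend : ∀ st, Inv m st → st.rreg s ≤ st.rreg t ∧ Q st) :
    wp (.rwhile s t c) st (m * (T + 2) + 1) Q := by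
  suffices H : ∀ i ≤ m, ∀ st, Inv (m - i) st → wp (.rwhile s t c) st (i * (T + 2) + 1) Q from
    H m le_rfl st (by simpa using h0)
  intro i
  induction i with
  | zero =>
    intro _ st hI
    obtain ⟨hle, hQ⟩ := hend st (by simpa using hI)
    refine ⟨st, ⟨1, by omega, fun p o hp => ?_⟩, hQ⟩
    rw [run_rjump (CodeAt.head hp).1, if_pos hle]
    simp only [Cmd.size]
    congr 1; omega
  | succ i ih =>
    intro hi st hI
    obtain ⟨hle, s1, ⟨t1, ht1, h1⟩, hI1⟩ := hstep (m - (i + 1)) (by omega) st hI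
    obtain ⟨s2, ⟨t2, ht2, h2⟩, hq⟩ := ih (by omega) s1
      (by rwa [show m - (i + 1) + 1 = m - i by omega] at hI1)
    refine ⟨s2, ⟨1 + (t1 + (1 + t2)), ?_, fun p o hp => ?_⟩, hq⟩
    · rw [Nat.succ_mul]; omega
    · obtain ⟨hj, hp'⟩ := CodeAt.head hp
      have hp2 := CodeAt.append hp'
      have h3 := (CodeAt.head hp2.2).1
      rw [Cmd.length_compile] at h3
      rw [Program.run_add, run_rjump hj, if_neg hle, Program.run_add, h1 p _ hp2.1,
        Program.run_add, run_ijump h3, if_pos le_rfl, h2 p o hp]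

theorem wp_ile_le {s t : ℕ} {c d : Cmd} {st : Config} {U : ℕ} {Q : Config → Prop} (T : ℕ)
    (hU : T + 2 ≤ U) (hc : st.ireg s ≤ st.ireg t → wp c st T Q)
    (hd : ¬ st.ireg s ≤ st.ireg t → wp d st T Q) : wp (.ile s t c d) st U Q :=
  (wp_ile hc hd).mono hU fun _ h => h

theorem wp_rle_le {s t : ℕ} {c d : Cmd} {st : Config} {U : ℕ} {Q : Config → Prop} (T : ℕ)
    (hU : T + 2 ≤ U) (hc : st.rreg s ≤ st.rreg t → wp c st T Q)
    (hd : ¬ st.rreg s ≤ st.rreg t → wp d st T Q) : wp (.rle s t c d) st U Q :=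
  (wp_rle hc hd).mono hU fun _ h => h

/-- `for I[d] := 0 to I[e] - 1 do c`; register `I[1]` is scratch. -/
def Cmd.for (d e : ℕ) (c : Cmd) : Cmd :=
  .seq (.block [.iconst d 0]) (.iwhile e d (.seq c (.block [.iconst 1 1, .iadd d d 1])))

open Function in
theorem wp_for {d e : ℕ} {c : Cmd} {st : Config} {T m : ℕ} {Q : Config → Prop}
    (hde : e ≠ d) (hd : d ≠ 1) (he : e ≠ 1) (hm : st.ireg e = m) (Inv : ℕ → Config → Prop)
    (h0 : ∀ pc, Inv 0 { st with pc := pc, ireg := update st.ireg d 0 })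
    (hstep : ∀ j < m, ∀ st, Inv j st → st.ireg d = j → st.ireg e = m →
      wp c st T fun st' => st'.ireg d = j ∧ st'.ireg e = m ∧
        ∀ pc, Inv (j + 1)
          { st' with pc := pc, ireg := update (update st'.ireg 1 1) d (j + 1) })
    (hend : ∀ st, Inv m st → st.ireg e = m → Q st) :
    wp (.for d e c) st (m * (T + 4) + 2) Q := by
  have key : wp (.iwhile e d (.seq c (.block [.iconst 1 1, .iadd d d 1])))
      ([Instr.iconst d 0].foldl (fun c a => a.exec c) st) (m * ((T + 2) + 2) + 1) Q := by
    refine wp_iwhile (fun j s => Inv j s ∧ s.ireg d = j ∧ s.ireg e = m) ?_ ?_ ?_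
    · refine ⟨h0 _, ?_, ?_⟩ <;> simp [Instr.exec, hde, hm]
    · rintro j hj s ⟨hI, h1, h2⟩
      refine ⟨by omega, wp_seq ((hstep j hj s hI h1 h2).mono le_rfl ?_)⟩
      rintro s' ⟨h3, h4, h5⟩
      refine wp_block (by simp [Instr.IsOp]) ⟨?_, ?_, ?_⟩
      · simpa [Instr.exec, hd, h3] using h5 _
      · simp [Instr.exec, hd, h3]
      · simp [Instr.exec, hde, he, h4]
    · rintro s ⟨hI, h1, h2⟩
      exact ⟨by omega, hend s hI h2⟩
  exact (wp_seq (wp_block (by simp [Instr.IsOp]) key)).mono (by simp; lia) fun _ h => h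

/-- A compiled command, started at address `0`, halts. -/
theorem wp.halts {c : Cmd} {st : Config} {T : ℕ} {Q : Config → Prop} (h : wp c st T Q)
    (h0 : st.pc = 0) : ∃ t ≤ T, Program.Halted (c.compile 0) (Program.run (c.compile 0) t st) ∧
      ∃ st' pc, Q st' ∧ Program.run (c.compile 0) t st = st'.at pc := by
  obtain ⟨st', ⟨t, ht, hr⟩, hq⟩ := h
  have := hr (c.compile 0) 0 (fun i hi => by simp [hi])
  rw [show st.at 0 = st by cases st; simp_all [Config.at]] at this
  refine ⟨t, ht, ?_, st', _, hq, this⟩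
  rw [this]
  simp [Program.Halted, Config.at, Cmd.length_compile]

end LatticePiercing

namespace LatticePiercing

/-! ### Adapted bases -/

/-- A pair of vectors `(p, -q)`, `(r, s)`, thought of as a basis of a lattice. -/
@[ext]
structure Quad where
  p : ℝ
  q : ℝ
  r : ℝ
  s : ℝ

namespace Quad

/-- The area of the fundamental parallelogram. -/
def det (T : Quad) : ℝ := T.p * T.s + T.q * T.r

/-- The first vector lies in the fourth quadrant, the second one in the first quadrant. -/
structure Adapted (T : Quad) : Prop where
  p_nonneg : 0 ≤ T.p
  q_nonneg : 0 ≤ T.q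
  r_nonneg : 0 ≤ T.r
  s_nonneg : 0 ≤ T.s
  det_pos : 0 < T.det

/-- The lattice meets every translate of the `w × h` rectangle. -/
def Pierces (T : Quad) (w h : ℝ) : Prop :=
  ∀ x y : ℝ, ∃ a b : ℤ, (x ≤ a * T.p + b * T.r ∧ a * T.p + b * T.r ≤ x + w) ∧
    (y ≤ b * T.s - a * T.q ∧ b * T.s - a * T.q ≤ y + h)

/-- The basis with coordinates `(a, b)` and `(c, d)` with respect to `T`. -/
def comb (a b c d : ℤ) (T : Quad) : Quad :=
  ⟨a * T.p + b * T.r, a * T.q - b * T.s, c * T.p + d * T.r, d * T.s - c * T.q⟩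

theorem det_comb (a b c d : ℤ) (T : Quad) : (comb a b c d T).det = (a * d - b * c) * T.det := by
  simp only [comb, det]; ring

theorem comb_comb (a b c d a' b' c' d' : ℤ) (T : Quad) :
    comb a' b' c' d' (comb a b c d T) =
      comb (a' * a + b' * c) (a' * b + b' * d) (c' * a + d' * c) (c' * b + d' * d) T := by
  ext <;> simp only [comb] <;> push_cast <;> ring

theorem comb_one (T : Quad) : comb 1 0 0 1 T = T := by
  ext <;> simp [comb]

theorem pierces_of_comb {a b c d : ℤ} {T : Quad} {w h : ℝ} (H : (comb a b c d T).Pierces w h) :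
    T.Pierces w h := by
  intro x y
  obtain ⟨m, n, h1, h2⟩ := H x y
  refine ⟨m * a + n * c, m * b + n * d, ?_, ?_⟩
  · have : ((m * a + n * c : ℤ) : ℝ) * T.p + ((m * b + n * d : ℤ) : ℝ) * T.r
        = m * (comb a b c d T).p + n * (comb a b c d T).r := by
      simp only [comb]; push_cast; ring
    rwa [this]
  · have : ((m * b + n * d : ℤ) : ℝ) * T.s - ((m * a + n * c : ℤ) : ℝ) * T.q
        = n * (comb a b c d T).s - m * (comb a b c d T).q := by
      simp only [comb]; push_cast; ring
    rwa [this]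

/-- `T'` is another basis, with the same orientation, of the lattice with basis `T`. -/
def Equivalent (T T' : Quad) : Prop := ∃ a b c d : ℤ, a * d - b * c = 1 ∧ T' = comb a b c d T

theorem Equivalent.refl (T : Quad) : T.Equivalent T := ⟨1, 0, 0, 1, by norm_num, (comb_one T).symm⟩

theorem Equivalent.symm {T T' : Quad} (h : T.Equivalent T') : T'.Equivalent T := by
  obtain ⟨a, b, c, d, h1, rfl⟩ := h
  refine ⟨d, -b, -c, a, by linarith, ?_⟩
  rw [comb_comb, show d * a + -b * c = 1 by linarith, show d * b + -b * d = 0 by ring,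
    show -c * a + a * c = 0 by ring, show -c * b + a * d = 1 by linarith, comb_one]

theorem Equivalent.trans {T T' T'' : Quad} (h : T.Equivalent T') (h' : T'.Equivalent T'') :
    T.Equivalent T'' := by
  obtain ⟨a, b, c, d, h1, rfl⟩ := h
  obtain ⟨a', b', c', d', h2, rfl⟩ := h'
  refine ⟨_, _, _, _, ?_, comb_comb _ _ _ _ _ _ _ _ _⟩
  linear_combination (a' * d' - b' * c') * h1 + h2

theorem Equivalent.det_eq {T T' : Quad} (h : T.Equivalent T') : T'.det = T.det := by
  obtain ⟨a, b, c, d, h1, rfl⟩ := h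
  rw [det_comb]
  have : (a * d - b * c : ℝ) = 1 := by exact_mod_cast h1
  rw [this, one_mul]

theorem Equivalent.pierces {T T' : Quad} {w h : ℝ} (H : T.Equivalent T') (hT : T.Pierces w h) :
    T'.Pierces w h := by
  obtain ⟨a, b, c, d, -, rfl⟩ := H.symm
  exact pierces_of_comb hT

theorem Adapted.width_pos {T : Quad} (hT : T.Adapted) : 0 < T.p + T.r := by
  obtain ⟨hp, hq, hr, hs, hd⟩ := hT
  rcases hp.eq_or_lt with h | h
  · rcases hr.eq_or_lt with h' | h'
    · simp [det, ← h, ← h'] at hd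
    · linarith
  · linarith

theorem Adapted.not_empty_rectangle {T : Quad} (hT : T.Adapted) {w h : ℝ} (H : T.Pierces w h) :
    T.p + T.r ≤ w ∨ T.q + T.s ≤ h := by
  obtain ⟨hp, hq, hr, hs, hd⟩ := hT
  by_contra! hc
  obtain ⟨a, b, ⟨h1, h2⟩, h3, h4⟩ := H ((T.p + T.r - w) / 2) (-T.q + (T.q + T.s - h) / 2)
  have e1 : 0 < a * T.p + b * T.r := by linarith
  have e2 : a * T.p + b * T.r < T.p + T.r := by linarith
  have e3 : -T.q < b * T.s - a * T.q := by linarith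
  have e4 : b * T.s - a * T.q < T.s := by linarith
  rcases le_or_gt a 0 with ha | ha <;> rcases le_or_gt b 0 with hb | hb
  · have ha' : (a : ℝ) ≤ 0 := by exact_mod_cast ha
    have hb' : (b : ℝ) ≤ 0 := by exact_mod_cast hb
    nlinarith
  · have ha' : (a : ℝ) ≤ 0 := by exact_mod_cast ha
    have hb' : (1 : ℝ) ≤ b := by exact_mod_cast hb
    nlinarith
  · have ha' : (1 : ℝ) ≤ a := by exact_mod_cast ha
    have hb' : (b : ℝ) ≤ 0 := by exact_mod_cast hb
    nlinarith
  · have ha' : (1 : ℝ) ≤ a := by exact_mod_cast ha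
    have hb' : (1 : ℝ) ≤ b := by exact_mod_cast hb
    nlinarith

theorem Adapted.pierces {T : Quad} (hT : T.Adapted) {w h : ℝ} (hw : T.p + T.r ≤ w) (hq : T.q ≤ h)
    (hs : T.s ≤ h) : T.Pierces w h := by
  have hσ := hT.width_pos
  obtain ⟨p0, q0, r0, s0, hd⟩ := hT
  intro x y
  set σ := T.p + T.r with hσdef
  -- the lattice point of index `N` in the vertical strip over `[x, x + σ)`
  let A : ℤ → ℤ := fun N => ⌈(x + N * T.r) / σ⌉
  have hA1 : ∀ N : ℤ, x + N * T.r ≤ A N * σ := fun N => by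
    have := Int.le_ceil ((x + N * T.r) / σ)
    rwa [div_le_iff₀ hσ] at this
  have hA2 : ∀ N : ℤ, A N * σ < x + N * T.r + σ := fun N => by
    have := Int.ceil_lt_add_one ((x + N * T.r) / σ)
    rw [div_add_one hσ.ne', lt_div_iff₀ hσ] at this
    exact this
  let X : ℤ → ℝ := fun N => A N * T.p + (A N - N) * T.r
  let Y : ℤ → ℝ := fun N => (A N - N) * T.s - A N * T.q
  have hX1 : ∀ N, x ≤ X N := fun N => by simp only [X]; linarith [hA1 N]
  have hX2 : ∀ N, X N ≤ x + σ := fun N => by simp only [X]; linarith [hA2 N]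
  have hY : ∀ N : ℤ, σ * Y N = -N * T.det + (T.s - T.q) * X N := fun N => by
    simp only [X, Y, det, hσdef]; ring
  have hXabs : ∀ N, |(T.s - T.q) * X N| ≤ |T.s - T.q| * (|x| + |x + σ|) := fun N => by
    rw [abs_mul]
    gcongr
    refine (abs_le_max_abs_abs (hX1 N) (hX2 N)).trans (max_le ?_ ?_) <;>
      linarith [abs_nonneg x, abs_nonneg (x + σ)]
  set C := |T.s - T.q| * (|x| + |x + σ|)
  have hbdd : ∃ B : ℤ, ∀ N : ℤ, y ≤ Y N → N ≤ B := by
    refine ⟨⌈(C - σ * y) / T.det⌉, fun N hN => ?_⟩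
    have h1 : (N : ℝ) ≤ (C - σ * y) / T.det := by
      rw [le_div_iff₀ hd]
      nlinarith [hY N, (abs_le.1 (hXabs N)).2]
    exact_mod_cast h1.trans (Int.le_ceil _)
  have hne : ∃ N : ℤ, y ≤ Y N := by
    refine ⟨⌊(-C - σ * y) / T.det⌋, ?_⟩
    have h1 := Int.floor_le ((-C - σ * y) / T.det)
    rw [le_div_iff₀ hd] at h1
    have := hY ⌊(-C - σ * y) / T.det⌋
    have h3 := (abs_le.1 (hXabs ⌊(-C - σ * y) / T.det⌋)).1
    by_contra! hc
    nlinarith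
  obtain ⟨N, hN, hmax⟩ := Int.exists_greatest_of_bdd hbdd hne
  have hN1 : Y (N + 1) < y := by
    by_contra! hc
    linarith [hmax _ hc]
  refine ⟨A N, A N - N, ⟨?_, ?_⟩, ?_, ?_⟩
  · push_cast; exact hX1 N
  · push_cast; exact (hX2 N).trans (by linarith)
  · push_cast; exact hN
  · push_cast
    have key : Y N - Y (N + 1) ≤ h := by
      have g1 := hA1 N
      have g2 := hA2 N
      have g3 := hA1 (N + 1)
      have g4 := hA2 (N + 1)
      push_cast at g3 g4
      have l1 : A N ≤ A (N + 1) := by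
        by_contra! hc
        have : (A (N + 1) : ℝ) + 1 ≤ A N := by exact_mod_cast hc
        nlinarith
      have l2 : A (N + 1) ≤ A N + 1 := by
        by_contra! hc
        have : (A N : ℝ) + 1 + 1 ≤ A (N + 1) := by exact_mod_cast hc
        nlinarith
      have : A (N + 1) = A N ∨ A (N + 1) = A N + 1 := by omega
      simp only [Y]
      rcases this with h' | h' <;> rw [h'] <;> push_cast <;> linarith
    simp only [Y] at key hN1 ⊢
    linarith

/-- The next basis, wider and lower. -/
noncomputable def fwd (T : Quad) : Quad :=
  if T.q ≤ T.s then ⟨T.p, T.q, T.r + T.p, T.s - T.q⟩ else ⟨T.p + T.r, T.q - T.s, T.r, T.s⟩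

/-- The previous basis, narrower and higher. -/
noncomputable def bwd (T : Quad) : Quad :=
  if T.r ≤ T.p then ⟨T.p - T.r, T.q + T.s, T.r, T.s⟩ else ⟨T.p, T.q, T.r - T.p, T.s + T.q⟩

theorem equivalent_fwd (T : Quad) : T.Equivalent T.fwd := by
  unfold fwd
  split_ifs
  · exact ⟨1, 0, 1, 1, by norm_num, by ext <;> simp [comb]; ring⟩
  · exact ⟨1, 1, 0, 1, by norm_num, by ext <;> simp [comb]⟩

theorem equivalent_bwd (T : Quad) : T.Equivalent T.bwd := by
  unfold bwd
  split_ifs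
  · exact ⟨1, -1, 0, 1, by norm_num, by ext <;> simp [comb]; ring⟩
  · exact ⟨1, 0, -1, 1, by norm_num, by ext <;> simp [comb]; ring⟩

theorem Adapted.fwd {T : Quad} (h : T.Adapted) : T.fwd.Adapted := by
  have hd := (equivalent_fwd T).det_eq
  obtain ⟨hp, hq, hr, hs, h0⟩ := h
  rw [← hd] at h0
  unfold Quad.fwd at *
  split_ifs at * with h1
  · exact ⟨hp, hq, by simp; linarith, by simpa, h0⟩
  · exact ⟨by simp; linarith, by simp; linarith, hr, hs, h0⟩

theorem Adapted.bwd {T : Quad} (h : T.Adapted) : T.bwd.Adapted := by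
  have hd := (equivalent_bwd T).det_eq
  obtain ⟨hp, hq, hr, hs, h0⟩ := h
  rw [← hd] at h0
  unfold Quad.bwd at *
  split_ifs at * with h1
  · exact ⟨by simpa, by simp; linarith, hr, hs, h0⟩
  · exact ⟨hp, hq, by simp; linarith, by simp; linarith, h0⟩

/-- The width of the maximal empty rectangle that belongs to the basis. -/
def width (T : Quad) : ℝ := T.p + T.r

/-- The height of the maximal empty rectangle that belongs to the basis. -/
def height (T : Quad) : ℝ := T.q + T.s

theorem width_fwd (T : Quad) : T.fwd.width = if T.q ≤ T.s then T.width + T.p else T.width + T.r := by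
  unfold fwd width; split_ifs <;> ring

theorem height_fwd (T : Quad) : T.fwd.height = max T.q T.s := by
  unfold fwd height
  split_ifs with h
  · rw [max_eq_right h]; simp
  · rw [max_eq_left (by linarith)]; simp

theorem width_bwd (T : Quad) : T.bwd.width = max T.p T.r := by
  unfold bwd width
  split_ifs with h
  · rw [max_eq_left h]; simp
  · rw [max_eq_right (by linarith)]; simp

theorem height_bwd (T : Quad) :
    T.bwd.height = if T.r ≤ T.p then T.height + T.s else T.height + T.q := by
  unfold bwd height; split_ifs <;> ring

/-- The basis vectors are not short: `p N + q M ≥ δ` and `r N + s M ≥ δ`. -/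
def LongVectors (M N δ : ℝ) (T : Quad) : Prop := δ ≤ T.p * N + T.q * M ∧ δ ≤ T.r * N + T.s * M

theorem LongVectors.fwd_le {M N δ : ℝ} {T : Quad} (h : T.LongVectors M N δ) :
    T.width * N - T.height * M + δ ≤ T.fwd.width * N - T.fwd.height * M := by
  rw [width_fwd, height_fwd]
  obtain ⟨h1, h2⟩ := h
  unfold width height
  split_ifs with h
  · rw [max_eq_right h]; linarith
  · rw [max_eq_left (by linarith)]; linarith

theorem LongVectors.le_bwd {M N δ : ℝ} {T : Quad} (h : T.LongVectors M N δ) :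
    T.bwd.width * N - T.bwd.height * M ≤ T.width * N - T.height * M - δ := by
  rw [width_bwd, height_bwd]
  obtain ⟨h1, h2⟩ := h
  unfold width height
  split_ifs with h
  · rw [max_eq_left h]; linarith
  · rw [max_eq_right (by linarith)]; linarith

theorem Adapted.exists_longVectors {T : Quad} (hT : T.Adapted) {M N : ℝ} (hM : 0 < M)
    (hN : 0 < N) : ∃ δ > 0, ∀ T', T.Equivalent T' → T'.Adapted → T'.LongVectors M N δ := by
  obtain ⟨p0, q0, r0, s0, hd⟩ := hT
  have hS : 0 < T.p + T.q + T.r + T.s := by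
    by_contra! hc
    have e1 : T.p = 0 := by linarith
    have e2 : T.q = 0 := by linarith
    simp [det, e1, e2] at hd
  -- a nonzero lattice vector `(x, y)` has `(|x| + |y|) (p + q + r + s) ≥ det`
  have key : ∀ (a b : ℤ) (x y : ℝ), (a ≠ 0 ∨ b ≠ 0) → |a * T.p + b * T.r| = x →
      |a * T.q - b * T.s| = y → T.det ≤ (x + y) * (T.p + T.q + T.r + T.s) := by
    intro a b x y hab hx hy
    have x0 : 0 ≤ x := hx ▸ abs_nonneg _
    have y0 : 0 ≤ y := hy ▸ abs_nonneg _
    have h1 := abs_le.1 hx.le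
    have h2 := abs_le.1 hy.le
    have one : ∀ z : ℤ, z ≠ 0 → ∀ B : ℝ, |z * T.det| ≤ B → T.det ≤ B := fun z hz B hB => by
      rw [abs_mul, abs_of_pos hd] at hB
      have : (1 : ℝ) ≤ |(z : ℝ)| := by exact_mod_cast Int.one_le_abs hz
      nlinarith
    rcases hab with ha | hb
    · refine one a ha _ ?_
      rw [show (a : ℝ) * T.det = (a * T.p + b * T.r) * T.s + (a * T.q - b * T.s) * T.r by
        simp only [det]; ring]
      refine (abs_add_le _ _).trans ?_
      rw [abs_mul, abs_mul, hx, hy, abs_of_nonneg r0, abs_of_nonneg s0]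
      nlinarith [mul_nonneg x0 p0, mul_nonneg x0 q0, mul_nonneg x0 r0, mul_nonneg y0 p0,
        mul_nonneg y0 q0, mul_nonneg y0 s0]
    · refine one b hb _ ?_
      rw [show (b : ℝ) * T.det = (a * T.p + b * T.r) * T.q - (a * T.q - b * T.s) * T.p by
        simp only [det]; ring]
      refine (abs_sub _ _).trans ?_
      rw [abs_mul, abs_mul, hx, hy, abs_of_nonneg p0, abs_of_nonneg q0]
      nlinarith [mul_nonneg x0 p0, mul_nonneg x0 s0, mul_nonneg x0 r0, mul_nonneg y0 r0,
        mul_nonneg y0 q0, mul_nonneg y0 s0]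
  have hmin : 0 < min M N := lt_min hM hN
  refine ⟨T.det / (T.p + T.q + T.r + T.s) * min M N, by positivity, ?_⟩
  rintro T' ⟨a, b, c, d, h1, rfl⟩ ⟨p1, q1, r1, s1, -⟩
  have fin : ∀ x y : ℝ, 0 ≤ x → 0 ≤ y → T.det ≤ (x + y) * (T.p + T.q + T.r + T.s) →
      T.det / (T.p + T.q + T.r + T.s) * min M N ≤ x * N + y * M := fun x y hx hy h => by
    rw [← div_le_iff₀ hS] at h
    calc _ ≤ (x + y) * min M N := by gcongr
      _ ≤ x * N + y * M := by nlinarith [min_le_left M N, min_le_right M N]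
  constructor
  · refine fin _ _ p1 q1 (key a b _ _ ?_ (abs_of_nonneg p1) (abs_of_nonneg q1))
    by_contra! h
    simp [h.1, h.2] at h1
  · refine fin _ _ r1 s1 (key c d _ _ ?_ (abs_of_nonneg r1) ?_)
    · by_contra! h
      simp [h.1, h.2] at h1
    · rw [abs_sub_comm]; exact abs_of_nonneg s1

/-- An iteration that decreases `φ` by a definite amount as long as `P` fails reaches `P` if `φ`
is bounded below. -/
theorem exists_of_descent {α : Type*} {Inv P : α → Prop} {f : α → α} {φ : α → ℝ} {B δ : ℝ}
    (hδ : 0 < δ) (lower : ∀ T, Inv T → ¬ P T → B ≤ φ T)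
    (step : ∀ T, Inv T → ¬ P T → Inv (f T) ∧ φ (f T) ≤ φ T - δ) {T : α} (hT : Inv T) :
    ∃ T', Inv T' ∧ P T' := by
  obtain ⟨m, hm⟩ := exists_nat_gt ((φ T - B) / δ)
  rw [div_lt_iff₀ hδ] at hm
  induction m generalizing T with
  | zero =>
    refine ⟨T, hT, ?_⟩
    by_contra hP
    have := lower T hT hP
    simp at hm
    linarith
  | succ m ih =>
    by_cases hP : P T
    · exact ⟨T, hT, hP⟩
    · obtain ⟨h1, h2⟩ := step T hT hP
      refine ih h1 ?_
      push_cast at hm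
      linarith

theorem Adapted.exists_equivalent_le {T : Quad} (hT : T.Adapted) {w h : ℝ}
    (H : T.Pierces w h) :
    ∃ T', T.Equivalent T' ∧ T'.Adapted ∧ T'.p + T'.r ≤ w ∧ T'.q ≤ h ∧ T'.s ≤ h := by
  obtain ⟨δ, hδ, hlong⟩ := hT.exists_longVectors one_pos one_pos
  obtain ⟨T1, ⟨h1, h2⟩, h3⟩ := exists_of_descent (Inv := fun T' => T.Equivalent T' ∧ T'.Adapted)
    (P := fun T' => T'.width ≤ w) (f := Quad.bwd) (φ := fun T' => T'.width * 1 - T'.height * 1)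
    (B := -h) hδ (by
      rintro T' ⟨e, a⟩ hP
      rcases a.not_empty_rectangle (e.pierces H) with h1 | h1
      · exact absurd h1 hP
      · have := a.width_pos
        simp only [width, height]
        linarith)
    (by
      rintro T' ⟨e, a⟩ hP
      exact ⟨⟨e.trans (equivalent_bwd T'), a.bwd⟩, (hlong T' e a).le_bwd⟩)
    ⟨Equivalent.refl T, hT⟩
  obtain ⟨T2, ⟨h4, h5, h6⟩, h7⟩ := exists_of_descent
    (Inv := fun T' => T.Equivalent T' ∧ T'.Adapted ∧ T'.width ≤ w)
    (P := fun T' => w < T'.fwd.width) (f := Quad.fwd)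
    (φ := fun T' => -(T'.width * 1 - T'.height * 1)) (B := -w) hδ (by
      rintro T' ⟨e, a, hle⟩ -
      have : 0 ≤ T'.height := add_nonneg a.q_nonneg a.s_nonneg
      linarith)
    (by
      rintro T' ⟨e, a, hle⟩ hP
      refine ⟨⟨e.trans (equivalent_fwd T'), a.fwd, not_lt.1 hP⟩, ?_⟩
      have := (hlong T' e a).fwd_le
      linarith)
    ⟨h1, h2, h3⟩
  refine ⟨T2, h4, h5, h6, ?_⟩
  rcases h5.fwd.not_empty_rectangle ((h4.trans (equivalent_fwd T2)).pierces H) with h8 | h8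
  · exact absurd h8 (not_le.2 h7)
  · have : T2.fwd.height ≤ h := h8
    rw [height_fwd] at this
    exact max_le_iff.1 this

theorem Adapted.det_le {T : Quad} (hT : T.Adapted) {w h : ℝ}
    (H : T.Pierces w h) : T.det ≤ w * h := by
  obtain ⟨T', e, ⟨p0, q0, r0, s0, -⟩, h1, h2, h3⟩ := hT.exists_equivalent_le H
  rw [← e.det_eq, det]
  nlinarith

/-- There is a basis at which the width of the empty rectangle, measured in units of `M`, overtakes
its height, measured in units of `N`. -/
theorem Adapted.exists_crossing {T : Quad} (hT : T.Adapted) {M N : ℝ} (hM : 0 < M)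
    (hN : 0 < N) : ∃ T', T.Equivalent T' ∧ T'.Adapted ∧ T'.width * N ≤ T'.height * M ∧
      T'.fwd.height * M ≤ T'.fwd.width * N := by
  obtain ⟨δ, hδ, hlong⟩ := hT.exists_longVectors hM hN
  obtain ⟨T1, ⟨h1, h2⟩, h3⟩ := exists_of_descent (Inv := fun T' => T.Equivalent T' ∧ T'.Adapted)
    (P := fun T' => T'.width * N - T'.height * M ≤ 0) (f := Quad.bwd)
    (φ := fun T' => T'.width * N - T'.height * M) (B := 0) hδ
    (fun T' _ hP => (not_le.1 hP).le)
    (by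
      rintro T' ⟨e, a⟩ hP
      exact ⟨⟨e.trans (equivalent_bwd T'), a.bwd⟩, (hlong T' e a).le_bwd⟩)
    ⟨Equivalent.refl T, hT⟩
  obtain ⟨T2, ⟨h4, h5, h6⟩, h7⟩ := exists_of_descent
    (Inv := fun T' => T.Equivalent T' ∧ T'.Adapted ∧ T'.width * N - T'.height * M ≤ 0)
    (P := fun T' => 0 ≤ T'.fwd.width * N - T'.fwd.height * M) (f := Quad.fwd)
    (φ := fun T' => -(T'.width * N - T'.height * M)) (B := 0) hδ (by
      rintro T' ⟨e, a, hle⟩ -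
      linarith)
    (by
      rintro T' ⟨e, a, hle⟩ hP
      refine ⟨⟨e.trans (equivalent_fwd T'), a.fwd, (not_le.1 hP).le⟩, ?_⟩
      have := (hlong T' e a).fwd_le
      linarith)
    ⟨h1, h2, h3⟩
  exact ⟨T2, h4, h5, by linarith, by linarith⟩

end Quad

end LatticePiercing

namespace LatticePiercing

namespace Quad

/-! ### Nearly optimal lattices and the vertices of the polygon of admissible bases -/

/-- The lattice meets every translate of the rectangles `w i × h i`, `i < n`. -/
def PiercesAll (n : ℕ) (w h : ℕ → ℝ) (T : Quad) : Prop := ∀ i < n, T.Pierces (w i) (h i)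

/-- The lattice is piercing, and no piercing lattice has an area that is `3/2` times larger. -/
structure NearOpt (n : ℕ) (w h : ℕ → ℝ) (T : Quad) : Prop where
  adapted : T.Adapted
  pierces : T.PiercesAll n w h
  near : ∀ T' : Quad, T'.Adapted → T'.PiercesAll n w h → T'.det < 3 / 2 * T.det

theorem NearOpt.of_equivalent {n : ℕ} {w h : ℕ → ℝ} {T T' : Quad} (H : T.NearOpt n w h)
    (e : T.Equivalent T') (hT' : T'.Adapted) : T'.NearOpt n w h :=
  ⟨hT', fun i hi => e.pierces (H.pierces i hi), by rw [e.det_eq]; exact H.near⟩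

theorem Pierces.triple_half {T : Quad} {w h : ℝ} (H : T.Pierces w h) (p0 : 0 ≤ T.p) (q0 : 0 ≤ T.q)
    (hp : 6 * T.p ≤ w) (hq : 6 * T.q ≤ h) :
    (⟨3 * T.p, 3 * T.q, T.r / 2, T.s / 2⟩ : Quad).Pierces w h := by
  intro x y
  obtain ⟨a, b, ⟨h1, h2⟩, h3, h4⟩ := H (2 * x + w / 2) (2 * y + h / 2)
  have hc := abs_le.1 (abs_sub_round ((a : ℝ) / 6))
  refine ⟨round ((a : ℝ) / 6), b, ⟨?_, ?_⟩, ?_, ?_⟩ <;> dsimp only <;> nlinarith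

theorem Pierces.half_triple {T : Quad} {w h : ℝ} (H : T.Pierces w h) (r0 : 0 ≤ T.r) (s0 : 0 ≤ T.s)
    (hr : 6 * T.r ≤ w) (hs : 6 * T.s ≤ h) :
    (⟨T.p / 2, T.q / 2, 3 * T.r, 3 * T.s⟩ : Quad).Pierces w h := by
  intro x y
  obtain ⟨a, b, ⟨h1, h2⟩, h3, h4⟩ := H (2 * x + w / 2) (2 * y + h / 2)
  have hc := abs_le.1 (abs_sub_round ((b : ℝ) / 6))
  refine ⟨a, round ((b : ℝ) / 6), ⟨?_, ?_⟩, ?_, ?_⟩ <;> dsimp only <;> nlinarith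

theorem NearOpt.longVectors {n : ℕ} {w h : ℕ → ℝ} {T : Quad} (H : T.NearOpt n w h) {W K M N κ : ℝ}
    (hW : ∀ i < n, W ≤ w i) (hK : ∀ i < n, K ≤ h i) (hκ : 0 < κ) (hM : 0 < M) (hN : 0 < N)
    (hMW : M ≤ κ * W) (hNK : N ≤ κ * K) : T.LongVectors M N (M * N / (6 * κ)) := by
  have hd := H.adapted.det_pos
  obtain ⟨p0, q0, r0, s0, -⟩ := H.adapted
  have fin : ∀ x y : ℝ, 0 ≤ x → 0 ≤ y → (W < 6 * x ∨ K < 6 * y) →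
      M * N / (6 * κ) ≤ x * N + y * M := fun x y hx hy hxy => by
    rw [div_le_iff₀ (by positivity)]
    have e1 : 0 ≤ x * N * κ := by positivity
    have e2 : 0 ≤ y * M * κ := by positivity
    rcases hxy with h1 | h1
    · have : M ≤ κ * (6 * x) := hMW.trans (by gcongr)
      nlinarith
    · have : N ≤ κ * (6 * y) := hNK.trans (by gcongr)
      nlinarith
  constructor
  · refine fin _ _ p0 q0 ?_
    by_contra! hc
    have hdet : (⟨3 * T.p, 3 * T.q, T.r / 2, T.s / 2⟩ : Quad).det = 3 / 2 * T.det := by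
      simp only [det]; ring
    refine (H.near _ ⟨?_, ?_, ?_, ?_, ?_⟩ fun i hi => (H.pierces i hi).triple_half p0 q0
      (hc.1.trans (hW i hi)) (hc.2.trans (hK i hi))).ne hdet
    all_goals first | (rw [hdet]; positivity) | (dsimp only; positivity)
  · refine fin _ _ r0 s0 ?_
    by_contra! hc
    have hdet : (⟨T.p / 2, T.q / 2, 3 * T.r, 3 * T.s⟩ : Quad).det = 3 / 2 * T.det := by
      simp only [det]; ring
    refine (H.near _ ⟨?_, ?_, ?_, ?_, ?_⟩ fun i hi => (H.pierces i hi).half_triple r0 s0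
      (hc.1.trans (hW i hi)) (hc.2.trans (hK i hi))).ne hdet
    all_goals first | (rw [hdet]; positivity) | (dsimp only; positivity)

/-- At a crossing, the lengths of the two basis vectors are not much larger than the area. -/
theorem Adapted.mul_le_of_crossing {T : Quad} (hT : T.Adapted) {M N : ℝ} (hM : 0 < M) (hN : 0 < N)
    (h1 : T.width * N ≤ T.height * M) (h2 : T.fwd.height * M ≤ T.fwd.width * N) :
    (T.p * N + T.q * M) * (T.r * N + T.s * M) ≤ 5 * (T.det * (M * N)) := by
  rw [width_fwd, height_fwd] at h2
  unfold width height det at *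
  obtain ⟨p0, q0, r0, s0, -⟩ := hT
  have P0 : 0 ≤ T.p * N := by positivity
  have Q0 : 0 ≤ T.q * M := by positivity
  have R0 : 0 ≤ T.r * N := by positivity
  have S0 : 0 ≤ T.s * M := by positivity
  have e : (T.p * T.s + T.q * T.r) * (M * N) =
    (T.p * N) * (T.s * M) + (T.q * M) * (T.r * N) := by ring
  rw [e]
  split_ifs at h2 with h
  · have hQS : T.q * M ≤ T.s * M := by gcongr
    rw [max_eq_right h] at h2
    have h2' : T.s * M ≤ 2 * (T.p * N) + T.r * N := by linarith
    have h1' : T.p * N + T.r * N ≤ T.q * M + T.s * M := by linarith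
    generalize T.p * N = P at *
    generalize T.q * M = Q at *
    generalize T.r * N = R at *
    generalize T.s * M = S at *
    nlinarith [mul_nonneg P0 S0, mul_nonneg Q0 R0, mul_nonneg P0 (sub_nonneg.2 hQS)]
  · have hQS : T.s * M ≤ T.q * M := by nlinarith
    rw [max_eq_left (by linarith)] at h2
    have h2' : T.q * M ≤ T.p * N + 2 * (T.r * N) := by linarith
    have h1' : T.p * N + T.r * N ≤ T.q * M + T.s * M := by linarith
    generalize T.p * N = P at *
    generalize T.q * M = Q at *
    generalize T.r * N = R at *
    generalize T.s * M = S at *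
    nlinarith [mul_nonneg P0 S0, mul_nonneg Q0 R0, mul_nonneg R0 (sub_nonneg.2 hQS)]

/-- The coordinates of a basis that lies in the box `M × N` with respect to a crossing basis. -/
theorem Adapted.abs_coord_le {T : Quad} (hT : T.Adapted) {M N κ : ℝ} (hM : 0 < M) (hN : 0 < N)
    (hκ : 0 < κ) (h1 : T.width * N ≤ T.height * M) (h2 : T.fwd.height * M ≤ T.fwd.width * N)
    (hl : T.LongVectors M N (M * N / (6 * κ))) {a b c d : ℤ} (hT' : (comb a b c d T).Adapted)
    (hw : (comb a b c d T).p + (comb a b c d T).r ≤ M) (hq : (comb a b c d T).q ≤ N)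
    (hs : (comb a b c d T).s ≤ N) :
    |(a : ℝ)| ≤ 30 * κ ∧ |(b : ℝ)| ≤ 30 * κ ∧ |(c : ℝ)| ≤ 30 * κ ∧ |(d : ℝ)| ≤ 30 * κ := by
  have hprod := hT.mul_le_of_crossing hM hN h1 h2
  obtain ⟨hl1, hl2⟩ := hl
  have hd := hT.det_pos
  obtain ⟨p0, q0, r0, s0, -⟩ := hT
  obtain ⟨p1, q1, r1, s1, -⟩ := hT'
  have hMN : 0 < M * N := by positivity
  have hδ : M * N / (6 * κ) * (6 * κ) = M * N := by field_simp
  have gen : ∀ z L L' : ℝ, M * N / (6 * κ) ≤ L → L * L' ≤ 5 * (T.det * (M * N)) →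
      |z * T.det| ≤ L' → |z| ≤ 30 * κ := by
    intro z L L' hL hLL hz
    rw [abs_mul, abs_of_pos hd] at hz
    have hL0 : 0 < L := lt_of_lt_of_le (by positivity) hL
    have e1 : |z| * L ≤ 5 * (M * N) := by
      have : |z| * T.det * L ≤ L' * L := by gcongr
      by_contra! hc
      nlinarith
    have e2 : |z| * (M * N / (6 * κ)) ≤ 5 * (M * N) :=
      (mul_le_mul_of_nonneg_left hL (abs_nonneg z)).trans e1
    have e3 : |z| * (M * N) ≤ 30 * κ * (M * N) := by
      rw [← hδ]
      nlinarith
    exact le_of_mul_le_mul_right e3 hMN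
  have box : ∀ x y x' y' : ℝ, 0 ≤ x → 0 ≤ y → x ≤ M → y ≤ N → 0 ≤ x' → 0 ≤ y' →
      |x * y' + y * x'| ≤ x' * N + y' * M ∧ |x * y' - y * x'| ≤ x' * N + y' * M := by
    intro x y x' y' hx hy hxM hyN hx' hy'
    have e1 : x * y' ≤ y' * M := by nlinarith
    have e2 : y * x' ≤ x' * N := by nlinarith
    have e3 : 0 ≤ x * y' := by positivity
    have e4 : 0 ≤ y * x' := by positivity
    constructor <;> rw [abs_le] <;> constructor <;> linarith
  have hprod' : (T.r * N + T.s * M) * (T.p * N + T.q * M) ≤ 5 * (T.det * (M * N)) := by linarith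
  have hp : (comb a b c d T).p ≤ M := by linarith
  have hr : (comb a b c d T).r ≤ M := by linarith
  refine ⟨gen _ _ _ hl1 hprod ?_, gen _ _ _ hl2 hprod' ?_, gen _ _ _ hl1 hprod ?_,
    gen _ _ _ hl2 hprod' ?_⟩
  · rw [show (a : ℝ) * T.det = (comb a b c d T).p * T.s + (comb a b c d T).q * T.r by
      simp only [comb, det]; ring]
    exact (box _ _ _ _ p1 q1 hp hq r0 s0).1
  · rw [show (b : ℝ) * T.det = (comb a b c d T).p * T.q - (comb a b c d T).q * T.p by
      simp only [comb, det]; ring]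
    exact (box _ _ _ _ p1 q1 hp hq p0 q0).2
  · rw [show (c : ℝ) * T.det = (comb a b c d T).r * T.s - (comb a b c d T).s * T.r by
      simp only [comb, det]; ring]
    exact (box _ _ _ _ r1 s1 hr hs r0 s0).2
  · rw [show (d : ℝ) * T.det = (comb a b c d T).r * T.q + (comb a b c d T).s * T.p by
      simp only [comb, det]; ring]
    exact (box _ _ _ _ r1 s1 hr hs p0 q0).1

end Quad

/-- A linear functional on a bounded polygon attains its maximum at a point where two independent
constraints are tight. -/
theorem exists_vertex (S : Finset (ℤ × ℤ × ℕ)) (w : ℕ → ℝ) (e g x₀ y₀ B : ℝ)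
    (h₀ : ∀ t ∈ S, t.1 * x₀ + t.2.1 * y₀ ≤ w t.2.2)
    (hB : ∀ x y : ℝ, (∀ t ∈ S, t.1 * x + t.2.1 * y ≤ w t.2.2) → |x| ≤ B ∧ |y| ≤ B) :
    ∃ x y : ℝ, (∀ t ∈ S, t.1 * x + t.2.1 * y ≤ w t.2.2) ∧ e * x₀ + g * y₀ ≤ e * x + g * y ∧
      ∃ t ∈ S, ∃ t' ∈ S, (t.1 * t'.2.1 - t'.1 * t.2.1 : ℝ) ≠ 0 ∧
        t.1 * x + t.2.1 * y = w t.2.2 ∧ t'.1 * x + t'.2.1 * y = w t'.2.2 := by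
  let K : Set (ℝ × ℝ) := {z | ∀ t ∈ S, t.1 * z.1 + t.2.1 * z.2 ≤ w t.2.2}
  have hKc : IsCompact K := by
    refine Metric.isCompact_of_isClosed_isBounded ?_ ?_
    · have : K = ⋂ t ∈ S, {z : ℝ × ℝ | t.1 * z.1 + t.2.1 * z.2 ≤ w t.2.2} := by
        ext z; simp [K]
      rw [this]
      exact isClosed_biInter fun t _ => isClosed_le (by fun_prop) (by fun_prop)
    · refine (isCompact_Icc (a := ((-B, -B) : ℝ × ℝ)) (b := (B, B))).isBounded.subset ?_
      intro z hz
      obtain ⟨h1, h2⟩ := hB z.1 z.2 hz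
      rw [abs_le] at h1 h2
      exact ⟨⟨h1.1, h2.1⟩, h1.2, h2.2⟩
  obtain ⟨z₀, hz₀, hmax⟩ := hKc.exists_isMaxOn ⟨(x₀, y₀), h₀⟩
    (f := fun z : ℝ × ℝ => e * z.1 + g * z.2) (by fun_prop)
  let E : Set (ℝ × ℝ) := {z ∈ K | e * z.1 + g * z.2 = e * z₀.1 + g * z₀.2}
  have hEc : IsCompact E := hKc.inter_right (isClosed_eq (by fun_prop) (by fun_prop))
  obtain ⟨z, hz⟩ := hEc.extremePoints_nonempty ⟨z₀, hz₀, rfl⟩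
  obtain ⟨⟨hzK, hzE⟩, hext⟩ := mem_extremePoints.1 hz
  refine ⟨z.1, z.2, hzK, (hmax (show (x₀, y₀) ∈ K from h₀)).trans hzE.ge, ?_⟩
  by_contra! hc
  -- all tight constraints are orthogonal to a common direction
  obtain ⟨d, hd0, hd⟩ : ∃ d : ℝ × ℝ, d ≠ 0 ∧ ∀ t ∈ S, t.1 * z.1 + t.2.1 * z.2 = w t.2.2 →
      t.1 * d.1 + t.2.1 * d.2 = 0 := by
    by_cases h : ∃ t ∈ S, t.1 * z.1 + t.2.1 * z.2 = w t.2.2 ∧ ((t.1 : ℝ), (t.2.1 : ℝ)) ≠ 0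
    · obtain ⟨t, ht, htt, hne⟩ := h
      refine ⟨(t.2.1, -t.1), ?_, fun t' ht' htt' => ?_⟩
      · intro h0
        simp only [Prod.mk_eq_zero, neg_eq_zero] at h0
        exact hne (by simp only [Prod.mk_eq_zero]; exact ⟨h0.2, h0.1⟩)
      · by_contra h0
        refine hc t ht t' ht' ?_ htt htt'
        intro h1
        apply h0
        simp only
        linarith
    · push Not at h
      refine ⟨(1, 0), by simp, fun t ht htt => ?_⟩
      have := h t ht htt
      simp only [Prod.mk_eq_zero] at this
      simp [this.1]
  -- a small step in this direction does not leave the polygon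
  obtain ⟨ε, hε, hstep⟩ : ∃ ε > 0, ∀ t ∈ S, |ε * (t.1 * d.1 + t.2.1 * d.2)| ≤
      w t.2.2 - (t.1 * z.1 + t.2.1 * z.2) := by
    have hev : ∀ t ∈ S, ∀ᶠ ε in nhdsWithin (0 : ℝ) (Set.Ioi 0),
        |ε * (t.1 * d.1 + t.2.1 * d.2)| ≤ w t.2.2 - (t.1 * z.1 + t.2.1 * z.2) := by
      intro t ht
      rcases (hzK t ht).eq_or_lt with h | h
      · refine Filter.Eventually.of_forall fun ε => ?_
        rw [hd t ht h, h]; simp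
      · refine Filter.Eventually.filter_mono nhdsWithin_le_nhds ?_
        have hcont : Continuous fun ε : ℝ => |ε * (t.1 * d.1 + t.2.1 * d.2)| := by fun_prop
        have := hcont.tendsto 0
        simp only [zero_mul, abs_zero] at this
        exact (this.eventually_lt_const (sub_pos.2 h)).mono fun _ => le_of_lt
    obtain ⟨ε, h1, h2⟩ := (((Finset.eventually_all S).2 hev).and self_mem_nhdsWithin).exists
    exact ⟨ε, h2, h1⟩
  have hmem : ∀ σ : ℝ, |σ| = 1 → (z.1 + σ * ε * d.1, z.2 + σ * ε * d.2) ∈ K := by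
    intro σ hσ t ht
    have := (le_abs_self (σ * (ε * (t.1 * d.1 + t.2.1 * d.2)))).trans_eq (abs_mul _ _)
    rw [hσ, one_mul] at this
    have := this.trans (hstep t ht)
    simp only
    linarith
  have hp := hmem 1 (by simp)
  have hm := hmem (-1) (by simp)
  have hp' := hmax hp
  have hm' := hmax hm
  simp only [Set.mem_ofPred_eq] at hp' hm'
  have hz1 : e * z.1 + g * z.2 = e * z₀.1 + g * z₀.2 := hzE
  have := hext _ ⟨hp, by simp only; linarith⟩ _ ⟨hm, by simp only; linarith⟩
    ⟨1 / 2, 1 / 2, by norm_num, by norm_num, by norm_num, by ext <;> simp <;> ring⟩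
  apply hd0
  have e1 := congrArg Prod.fst this.1
  have e2 := congrArg Prod.snd this.1
  simp only [one_mul, add_eq_left, mul_eq_zero, hε.ne', false_or] at e1 e2
  exact Prod.ext e1 e2

end LatticePiercing

namespace LatticePiercing

namespace Quad

/-! ### Candidates -/

/-- First coordinate of the solution of `A x + B y = w c`, `A' x + B' y = w c'`. -/
noncomputable def cramerFst (w : ℕ → ℝ) (t t' : ℤ × ℤ × ℕ) : ℝ :=
  (w t.2.2 * t'.2.1 - w t'.2.2 * t.2.1) / (t.1 * t'.2.1 - t'.1 * t.2.1)

/-- Second coordinate of the solution of `A x + B y = w c`, `A' x + B' y = w c'`. -/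
noncomputable def cramerSnd (w : ℕ → ℝ) (t t' : ℤ × ℤ × ℕ) : ℝ :=
  (t.1 * w t'.2.2 - t'.1 * w t.2.2) / (t.1 * t'.2.1 - t'.1 * t.2.1)

/-- The basis determined by two linear equations for the horizontal and two linear equations for
the vertical coordinates. -/
noncomputable def cand (w h : ℕ → ℝ) (t₁ t₂ t₃ t₄ : ℤ × ℤ × ℕ) : Quad :=
  ⟨cramerFst w t₁ t₂, cramerFst h t₃ t₄, cramerSnd w t₁ t₂, cramerSnd h t₃ t₄⟩

theorem eq_cramer {w : ℕ → ℝ} {t t' : ℤ × ℤ × ℕ} {x y : ℝ}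
    (hd : (t.1 * t'.2.1 - t'.1 * t.2.1 : ℝ) ≠ 0) (h : t.1 * x + t.2.1 * y = w t.2.2)
    (h' : t'.1 * x + t'.2.1 * y = w t'.2.2) : x = cramerFst w t t' ∧ y = cramerSnd w t t' := by
  constructor
  · rw [cramerFst, eq_div_iff hd, ← h, ← h']; ring
  · rw [cramerSnd, eq_div_iff hd, ← h, ← h']; ring

/-- The equations that are used: coefficients of absolute value at most `K`, right-hand side with
index at most `n`. -/
def InBox (K n : ℕ) (t : ℤ × ℤ × ℕ) : Prop := |t.1| ≤ K ∧ |t.2.1| ≤ K ∧ t.2.2 ≤ n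

open Classical in
/-- The vertex theorem for the polygon of all admissible inequalities which hold at `(x₀, y₀)`. -/
theorem exists_vertex_box {K n : ℕ} {w : ℕ → ℝ} (e g : ℝ) {x₀ y₀ B : ℝ}
    (hB : ∀ x y : ℝ, (∀ t, InBox K n t → t.1 * x₀ + t.2.1 * y₀ ≤ w t.2.2 →
      t.1 * x + t.2.1 * y ≤ w t.2.2) → |x| ≤ B ∧ |y| ≤ B) :
    ∃ t t', InBox K n t ∧ InBox K n t' ∧ (∀ u, InBox K n u →
        u.1 * x₀ + u.2.1 * y₀ ≤ w u.2.2 →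
        u.1 * cramerFst w t t' + u.2.1 * cramerSnd w t t' ≤ w u.2.2) ∧
      e * x₀ + g * y₀ ≤ e * cramerFst w t t' + g * cramerSnd w t t' := by
  let S : Finset (ℤ × ℤ × ℕ) := ((Finset.Icc (-K : ℤ) K) ×ˢ (Finset.Icc (-K : ℤ) K) ×ˢ
    (Finset.range (n + 1))).filter fun t => t.1 * x₀ + t.2.1 * y₀ ≤ w t.2.2
  have hS : ∀ t, t ∈ S ↔ InBox K n t ∧ t.1 * x₀ + t.2.1 * y₀ ≤ w t.2.2 := fun t => by
    simp only [S, InBox, Finset.mem_filter, Finset.mem_product, Finset.mem_Icc, Finset.mem_range,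
      abs_le, Nat.lt_succ_iff]
  obtain ⟨x, y, h1, h2, t, ht, t', ht', hd, e1, e2⟩ := exists_vertex S w e g x₀ y₀ B
    (fun t ht => ((hS t).1 ht).2)
    (fun x y H => hB x y fun t h1 h2 => H t ((hS t).2 ⟨h1, h2⟩))
  obtain ⟨rfl, rfl⟩ := eq_cramer hd e1 e2
  exact ⟨t, t', ((hS t).1 ht).1, ((hS t').1 ht').1, fun u hu hu' => h1 u ((hS u).2 ⟨hu, hu'⟩), h2⟩

/-- The data of a family of rectangles: `M`, `N` are the largest and `W`, `H` the smallest width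
and height, `κ` bounds the ratios. -/
structure Data (n : ℕ) (w h : ℕ → ℝ) (M N W H : ℝ) (κ : ℕ) : Prop where
  n_pos : 0 < n
  w_zero : w n = 0
  h_zero : h n = 0
  W_pos : 0 < W
  H_pos : 0 < H
  W_le : ∀ i < n, W ≤ w i
  H_le : ∀ i < n, H ≤ h i
  le_M : ∀ i < n, w i ≤ M
  le_N : ∀ i < n, h i ≤ N
  M_mem : ∃ i < n, w i = M
  N_mem : ∃ i < n, h i = N
  M_le : M ≤ κ * W
  N_le : N ≤ κ * H

section

variable {n : ℕ} {w h : ℕ → ℝ} {M N W H : ℝ} {κ : ℕ}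

theorem Data.M_pos (D : Data n w h M N W H κ) : 0 < M := by
  obtain ⟨i, hi, rfl⟩ := D.M_mem
  exact D.W_pos.trans_le (D.W_le i hi)

theorem Data.N_pos (D : Data n w h M N W H κ) : 0 < N := by
  obtain ⟨i, hi, rfl⟩ := D.N_mem
  exact D.H_pos.trans_le (D.H_le i hi)

theorem Data.one_le (D : Data n w h M N W H κ) : 1 ≤ κ := by
  by_contra! hc
  have h0 : κ = 0 := by omega
  have h1 := D.M_le
  rw [h0] at h1
  have := D.M_pos
  simp at h1
  linarith

theorem Data.longVectors (D : Data n w h M N W H κ) {T : Quad} (hT : T.NearOpt n w h) :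
    T.LongVectors M N (M * N / (6 * κ)) :=
  hT.longVectors D.W_le D.H_le (by exact_mod_cast D.one_le) D.M_pos D.N_pos D.M_le D.N_le

theorem Data.not_large (D : Data n w h M N W H κ) {T : Quad} (hT : T.NearOpt n w h) :
    T.width ≤ M ∨ T.height ≤ N := by
  rcases hT.adapted.not_empty_rectangle (hT.pierces 0 D.n_pos) with h1 | h1
  · exact .inl (h1.trans (D.le_M 0 D.n_pos))
  · exact .inr (h1.trans (D.le_N 0 D.n_pos))

theorem exists_cand (D : Data n w h M N W H κ) {T : Quad} (hT : T.NearOpt n w h) :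
    ∃ t₁ t₂ t₃ t₄, InBox (60 * κ) n t₁ ∧ InBox (60 * κ) n t₂ ∧ InBox (60 * κ) n t₃ ∧
      InBox (60 * κ) n t₄ ∧ (cand w h t₁ t₂ t₃ t₄).NearOpt n w h ∧
      T.det ≤ (cand w h t₁ t₂ t₃ t₄).det ∧ (cand w h t₁ t₂ t₃ t₄).width ≤ M ∧
      (cand w h t₁ t₂ t₃ t₄).height ≤ 2 * N := by
  obtain ⟨T₀, e₀, a₀, hc1, hc2⟩ := hT.adapted.exists_crossing D.M_pos D.N_pos
  have H₀ := hT.of_equivalent e₀ a₀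
  have hκ := D.one_le
  have hM := D.M_pos
  have hN := D.N_pos
  have hwM : T₀.p + T₀.r ≤ M := by
    rcases D.not_large H₀ with h1 | h1
    · exact h1
    · change T₀.width ≤ M
      have : T₀.width * N ≤ M * N := by nlinarith
      exact le_of_mul_le_mul_right this hN
  have hqs : max T₀.q T₀.s ≤ N := by
    rw [← height_fwd]
    rcases D.not_large (H₀.of_equivalent (equivalent_fwd T₀) a₀.fwd) with h1 | h1
    · have : T₀.fwd.height * M ≤ N * M := by nlinarith
      exact le_of_mul_le_mul_right this hM
    · exact h1
  obtain ⟨hq, hs⟩ := max_le_iff.1 hqs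
  -- bases that witness that the rectangles are pierced
  have hwit : ∀ i < n, ∃ a b c d : ℤ, a * d - b * c = 1 ∧ (comb a b c d T₀).Adapted ∧
      (comb a b c d T₀).p + (comb a b c d T₀).r ≤ w i ∧ (comb a b c d T₀).q ≤ h i ∧
      (comb a b c d T₀).s ≤ h i ∧ |a| ≤ 30 * κ ∧ |b| ≤ 30 * κ ∧ |c| ≤ 30 * κ ∧ |d| ≤ 30 * κ := by
    intro i hi
    obtain ⟨_, ⟨a, b, c, d, h1, rfl⟩, h2, h3, h4, h5⟩ := a₀.exists_equivalent_le (H₀.pierces i hi)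
    obtain ⟨k1, k2, k3, k4⟩ := a₀.abs_coord_le hM hN (by exact_mod_cast hκ) hc1 hc2
      (D.longVectors H₀) h2 (h3.trans (D.le_M i hi)) (h4.trans (D.le_N i hi))
      (h5.trans (D.le_N i hi))
    exact ⟨a, b, c, d, h1, h2, h3, h4, h5, by exact_mod_cast k1, by exact_mod_cast k2,
      by exact_mod_cast k3, by exact_mod_cast k4⟩
  obtain ⟨iM, hiM, hiM'⟩ := D.M_mem
  obtain ⟨iN, hiN, hiN'⟩ := D.N_mem
  have hκ' : (1 : ℤ) ≤ κ := by exact_mod_cast hκ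
  have box : ∀ (A B : ℤ) (c : ℕ), |A| ≤ 60 * κ → |B| ≤ 60 * κ → c ≤ n →
      InBox (60 * κ) n (A, B, c) := fun A B c h1 h2 h3 =>
    ⟨by push_cast; exact h1, by push_cast; exact h2, h3⟩
  have w0 := D.w_zero
  have h0 := D.h_zero
  obtain ⟨p0, q0, r0, s0, det0⟩ := a₀
  obtain ⟨t₁, t₂, ht₁, ht₂, hX, hXle⟩ := exists_vertex_box (K := 60 * κ) (n := n) (w := w)
    T₀.s T₀.q (x₀ := T₀.p) (y₀ := T₀.r) (B := M) (by
      intro x y Hxy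
      have e1 := Hxy (-1, 0, n) (box _ _ _ (by simp; omega) (by simp) le_rfl) (by simp [w0, p0])
      have e2 := Hxy (0, -1, n) (box _ _ _ (by simp) (by simp; omega) le_rfl) (by simp [w0, r0])
      have e3 := Hxy (1, 1, iM) (box _ _ _ (by simp; omega) (by simp; omega) hiM.le)
        (by simpa [hiM'] using hwM)
      simp [w0, hiM'] at e1 e2 e3
      constructor <;> rw [abs_le] <;> constructor <;> linarith)
  obtain ⟨t₃, t₄, ht₃, ht₄, hY, hYle⟩ := exists_vertex_box (K := 60 * κ) (n := n) (w := h)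
    (cramerSnd w t₁ t₂) (cramerFst w t₁ t₂) (x₀ := T₀.q) (y₀ := T₀.s) (B := N) (by
      intro x y Hxy
      have e1 := Hxy (-1, 0, n) (box _ _ _ (by simp; omega) (by simp) le_rfl) (by simp [h0, q0])
      have e2 := Hxy (0, -1, n) (box _ _ _ (by simp) (by simp; omega) le_rfl) (by simp [h0, s0])
      have e3 := Hxy (1, 0, iN) (box _ _ _ (by simp; omega) (by simp) hiN.le)
        (by simpa [hiN'] using hq)
      have e4 := Hxy (0, 1, iN) (box _ _ _ (by simp) (by simp; omega) hiN.le)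
        (by simpa [hiN'] using hs)
      simp [h0, hiN'] at e1 e2 e3 e4
      constructor <;> rw [abs_le] <;> constructor <;> linarith)
  refine ⟨t₁, t₂, t₃, t₄, ht₁, ht₂, ht₃, ht₄, ?_⟩
  have hdet : T.det ≤ (cand w h t₁ t₂ t₃ t₄).det := by
    rw [← e₀.det_eq]
    simp only [det, cand]
    linarith
  set C := cand w h t₁ t₂ t₃ t₄ with hC
  have hX' : ∀ (A B : ℤ) (c : ℕ), |A| ≤ 60 * κ → |B| ≤ 60 * κ → c ≤ n →
      A * T₀.p + B * T₀.r ≤ w c → A * C.p + B * C.r ≤ w c := fun A B c h1 h2 h3 h4 =>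
    hX (A, B, c) (box A B c h1 h2 h3) h4
  have hY' : ∀ (A B : ℤ) (c : ℕ), |A| ≤ 60 * κ → |B| ≤ 60 * κ → c ≤ n →
      A * T₀.q + B * T₀.s ≤ h c → A * C.q + B * C.s ≤ h c := fun A B c h1 h2 h3 h4 =>
    hY (A, B, c) (box A B c h1 h2 h3) h4
  have f1 := hX' (-1) 0 n (by simp; omega) (by simp) le_rfl (by simp [w0, p0])
  have f2 := hX' 0 (-1) n (by simp) (by simp; omega) le_rfl (by simp [w0, r0])
  have f3 := hX' 1 1 iM (by simp; omega) (by simp; omega) hiM.le (by simpa [hiM'] using hwM)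
  have f4 := hY' (-1) 0 n (by simp; omega) (by simp) le_rfl (by simp [h0, q0])
  have f5 := hY' 0 (-1) n (by simp) (by simp; omega) le_rfl (by simp [h0, s0])
  have f6 := hY' 1 0 iN (by simp; omega) (by simp) hiN.le (by simpa [hiN'] using hq)
  have f7 := hY' 0 1 iN (by simp) (by simp; omega) hiN.le (by simpa [hiN'] using hs)
  simp [w0, h0, hiM', hiN'] at f1 f2 f3 f4 f5 f6 f7
  have hCa : C.Adapted := ⟨f1, f4, f2, f5, hT.adapted.det_pos.trans_le hdet⟩
  refine ⟨⟨hCa, fun i hi => ?_, fun T' h1 h2 => ?_⟩, hdet, f3, by unfold height; linarith⟩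
  · obtain ⟨a, b, c, d, k1, ⟨k2, k3, k4, k5, -⟩, k6, k7, k8, ka, kb, kc, kd⟩ := hwit i hi
    apply pierces_of_comb (a := a) (b := b) (c := c) (d := d)
    simp only [comb] at k2 k3 k4 k5 k6 k7 k8
    have na : |(-a)| ≤ 60 * κ := by rw [abs_neg]; linarith
    have nb : |(-b)| ≤ 60 * κ := by rw [abs_neg]; linarith
    have nc : |(-c)| ≤ 60 * κ := by rw [abs_neg]; linarith
    have nd : |(-d)| ≤ 60 * κ := by rw [abs_neg]; linarith
    have pa : |a| ≤ 60 * κ := by linarith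
    have pb : |b| ≤ 60 * κ := by linarith
    have pc : |c| ≤ 60 * κ := by linarith
    have pd : |d| ≤ 60 * κ := by linarith
    have g1 := hX' (-a) (-b) n na nb le_rfl (by push_cast; rw [w0]; linarith)
    have g2 := hX' (-c) (-d) n nc nd le_rfl (by push_cast; rw [w0]; linarith)
    have g3 := hX' (a + c) (b + d) i ((abs_add_le a c).trans (by linarith))
      ((abs_add_le b d).trans (by linarith)) hi.le (by push_cast; linarith)
    have g4 := hY' (-a) b n na pb le_rfl (by push_cast; rw [h0]; linarith)
    have g5 := hY' c (-d) n pc nd le_rfl (by push_cast; rw [h0]; linarith)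
    have g6 := hY' a (-b) i pa nb hi.le (by push_cast; linarith)
    have g7 := hY' (-c) d i nc pd hi.le (by push_cast; linarith)
    push_cast at g1 g2 g3 g4 g5 g6 g7
    rw [w0] at g1 g2
    rw [h0] at g4 g5
    refine Adapted.pierces ⟨?_, ?_, ?_, ?_, ?_⟩ ?_ ?_ ?_
    · simp only [comb]; linarith
    · simp only [comb]; linarith
    · simp only [comb]; linarith
    · simp only [comb]; linarith
    · rw [det_comb, show (a * d - b * c : ℝ) = 1 by exact_mod_cast k1, one_mul]
      exact hCa.det_pos
    · simp only [comb]; linarith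
    · simp only [comb]; linarith
    · simp only [comb]; linarith
  · exact (hT.near T' h1 h2).trans_le (by linarith)

/-! ### The piercing test -/

open Classical in
/-- One step of the piercing test; the rectangles with index below `st.2` are known to be
pierced. -/
noncomputable def checkStep (n : ℕ) (w h : ℕ → ℝ) (st : Quad × ℕ) : Quad × ℕ :=
  if st.2 < n then
    if st.1.width ≤ w st.2 then
      if st.1.fwd.width ≤ w st.2 then (st.1.fwd, st.2)
      else if st.1.q ≤ h st.2 ∧ st.1.s ≤ h st.2 then (st.1, st.2 + 1) else st
    else (st.1.bwd, st.2)
  else st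

theorem checkStep_sound {T : Quad} (hT : T.Adapted) (j : ℕ) :
    T.Equivalent ((checkStep n w h)^[j] (T, 0)).1 ∧ ((checkStep n w h)^[j] (T, 0)).1.Adapted ∧
      ∀ i < ((checkStep n w h)^[j] (T, 0)).2, T.Pierces (w i) (h i) := by
  induction j with
  | zero => exact ⟨Equivalent.refl T, hT, by simp⟩
  | succ j ih =>
    rw [Function.iterate_succ_apply']
    obtain ⟨h1, h2, h3⟩ := ih
    unfold checkStep
    split_ifs with c1 c2 c3 c4
    · exact ⟨h1.trans (equivalent_fwd _), h2.fwd, h3⟩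
    · refine ⟨h1, h2, fun i hi => ?_⟩
      rcases Nat.lt_succ_iff_lt_or_eq.1 hi with h4 | rfl
      · exact h3 i h4
      · exact h1.symm.pierces (h2.pierces c2 c4.1 c4.2)
    · exact ⟨h1, h2, h3⟩
    · exact ⟨h1.trans (equivalent_bwd _), h2.bwd, h3⟩
    · exact ⟨h1, h2, h3⟩

theorem checkStep_iterate_of_le {st : Quad × ℕ} (hst : n ≤ st.2) (j : ℕ) :
    (checkStep n w h)^[j] st = st := by
  refine Function.iterate_fixed ?_ j
  rw [checkStep, if_neg (by omega)]

theorem checkStep_complete_of_width_le (D : Data n w h M N W H κ)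
    (hsort : ∀ i j, i < j → j < n → w i ≤ w j) (j : ℕ) {T : Quad} {i : ℕ} (hT : T.NearOpt n w h)
    (hi : i ≤ n) (hTi : i < n → T.width ≤ w i)
    (hj : 6 * κ * (M * N - (T.width * N - T.height * M)) + (n - i) * (M * N) ≤ j * (M * N)) :
    ((checkStep n w h)^[j] (T, i)).2 = n := by
  have hM := D.M_pos
  have hN := D.N_pos
  have hMN : 0 < M * N := by positivity
  have hκ : (0 : ℝ) < κ := by exact_mod_cast D.one_le
  have hstep : ∀ T : Quad, T.NearOpt n w h →
      6 * κ * (T.fwd.width * N - T.fwd.height * M) ≥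
        6 * κ * (T.width * N - T.height * M) + M * N := fun T hT => by
    have := (D.longVectors hT).fwd_le
    have h2 : 6 * κ * (M * N / (6 * κ)) = M * N := by field_simp
    rw [← h2, ge_iff_le, ← mul_add]
    gcongr
  induction j generalizing T i with
  | zero =>
    rcases hi.eq_or_lt with h1 | h1
    · exact h1
    · exfalso
      have h2 : T.width ≤ M := (hTi h1).trans (D.le_M i h1)
      have h3 : 0 ≤ T.height := add_nonneg hT.adapted.q_nonneg hT.adapted.s_nonneg
      have h4 : (i : ℝ) + 1 ≤ n := by exact_mod_cast h1
      have h5 : 0 ≤ κ * (M * N - (T.width * N - T.height * M)) := by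
        refine mul_nonneg hκ.le ?_
        nlinarith
      simp only [CharP.cast_eq_zero, zero_mul] at hj
      nlinarith
  | succ j ih =>
    rcases hi.eq_or_lt with h1 | h1
    · rw [checkStep_iterate_of_le (by simp [h1])]; exact h1
    rw [Function.iterate_succ_apply]
    have e : (checkStep n w h (T, i)) = if T.fwd.width ≤ w i then (T.fwd, i) else (T, i + 1) := by
      simp only [checkStep, if_pos h1, if_pos (hTi h1)]
      split_ifs with c1 c2
      · rfl
      · rfl
      · exfalso
        apply c2
        rcases hT.adapted.fwd.not_empty_rectangle
          ((equivalent_fwd T).pierces (hT.pierces i h1)) with h8 | h8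
        · exact absurd h8 c1
        · have : T.fwd.height ≤ h i := h8
          rw [height_fwd] at this
          exact max_le_iff.1 this
    rw [e]
    push_cast at hj
    split_ifs with c1
    · refine ih (hT.of_equivalent (equivalent_fwd T) hT.adapted.fwd) hi (fun _ => c1) ?_
      have := hstep T hT
      linarith
    · refine ih hT h1 (fun h2 => (hTi h1).trans (hsort i (i + 1) (by omega) h2)) ?_
      push_cast
      linarith

theorem checkStep_complete (D : Data n w h M N W H κ)
    (hsort : ∀ i j, i < j → j < n → w i ≤ w j) {T : Quad} (hT : T.NearOpt n w h)
    (hTM : T.width ≤ M) (hTN : T.height ≤ 2 * N) :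
    ((checkStep n w h)^[n + 30 * κ] (T, 0)).2 = n := by
  have hM := D.M_pos
  have hN := D.N_pos
  have hMN : 0 < M * N := by positivity
  have hκ : (0 : ℝ) < κ := by exact_mod_cast D.one_le
  suffices key : ∀ (j : ℕ) (T : Quad), T.NearOpt n w h → T.height ≤ 2 * N →
      6 * κ * ((T.width * N - T.height * M) + M * N) ≤ j * (M * N) →
      ((checkStep n w h)^[j + (n + 18 * κ)] (T, 0)).2 = n by
    rw [show n + 30 * κ = 12 * κ + (n + 18 * κ) by ring]
    refine key _ T hT hTN ?_
    push_cast
    have h3 : 0 ≤ T.height := add_nonneg hT.adapted.q_nonneg hT.adapted.s_nonneg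
    have : T.width * N - T.height * M ≤ M * N := by nlinarith
    nlinarith
  intro j
  induction j with
  | zero =>
    intro T hT hTN hj
    have hle : T.width ≤ w 0 := by
      by_contra hc
      rcases hT.adapted.not_empty_rectangle (hT.pierces 0 D.n_pos) with h1 | h1
      · exact hc h1
      · have h2 : T.height ≤ N := h1.trans (D.le_N 0 D.n_pos)
        have h3 : 0 < T.width := hT.adapted.width_pos
        have h4 : 0 < (T.width * N - T.height * M) + M * N := by nlinarith
        have := mul_pos hκ h4
        simp only [CharP.cast_eq_zero, zero_mul] at hj
        linarith
    refine checkStep_complete_of_width_le D hsort _ hT D.n_pos.le (fun _ => hle) ?_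
    have h3 : 0 < T.width := hT.adapted.width_pos
    have : -(2 * (M * N)) ≤ T.width * N - T.height * M := by nlinarith
    push_cast
    nlinarith
  | succ j ih =>
    intro T hT hTN hj
    by_cases hc : T.width ≤ w 0
    · refine checkStep_complete_of_width_le D hsort _ hT D.n_pos.le (fun _ => hc) ?_
      have h3 : 0 < T.width := hT.adapted.width_pos
      have : -(2 * (M * N)) ≤ T.width * N - T.height * M := by nlinarith
      push_cast
      have h5 : (0 : ℝ) ≤ j * (M * N) := by positivity
      nlinarith
    · have hle : T.height ≤ N := by
        rcases hT.adapted.not_empty_rectangle (hT.pierces 0 D.n_pos) with h1 | h1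
        · exact absurd h1 hc
        · exact h1.trans (D.le_N 0 D.n_pos)
      rw [show j + 1 + (n + 18 * κ) = j + (n + 18 * κ) + 1 by ring, Function.iterate_succ_apply]
      have e : checkStep n w h (T, 0) = (T.bwd, 0) := by
        simp only [checkStep, if_pos D.n_pos, if_neg hc]
      rw [e]
      refine ih _ (hT.of_equivalent (equivalent_bwd T) hT.adapted.bwd) ?_ ?_
      · rw [height_bwd]
        have h1 := hT.adapted.q_nonneg
        have h2 := hT.adapted.s_nonneg
        have h4 : T.q + T.s ≤ N := hle
        unfold height
        split_ifs <;> linarith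
      · have := (D.longVectors hT).le_bwd
        have h2 : 6 * κ * (M * N / (6 * κ)) = M * N := by field_simp
        have h3 := mul_le_mul_of_nonneg_left this (show (0 : ℝ) ≤ 6 * κ by positivity)
        push_cast at hj
        linarith

/-- The candidate is a basis, and the piercing test succeeds within `L` steps. -/
def Accepted (n : ℕ) (w h : ℕ → ℝ) (L : ℕ) (T : Quad) : Prop :=
  T.Adapted ∧ n ≤ ((checkStep n w h)^[L] (T, 0)).2

theorem Accepted.piercesAll {L : ℕ} {T : Quad} (hT : T.Accepted n w h L) : T.PiercesAll n w h :=
  fun i hi => (checkStep_sound hT.1 L).2.2 i (hi.trans_le hT.2)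

theorem exists_nearOpt (hn : 0 < n) {T₀ : Quad} (h₀ : T₀.Adapted)
    (h₀' : T₀.PiercesAll n w h) : ∃ T : Quad, T.NearOpt n w h ∧ T₀.det ≤ T.det := by
  let S : Set ℝ := {d | ∃ T : Quad, T.Adapted ∧ T.PiercesAll n w h ∧ T.det = d}
  have hS : BddAbove S := by
    refine ⟨w 0 * h 0, ?_⟩
    rintro _ ⟨T, h1, h2, rfl⟩
    exact h1.det_le (h2 0 hn)
  have hmem : T₀.det ∈ S := ⟨T₀, h₀, h₀', rfl⟩
  have hpos : 0 < sSup S := h₀.det_pos.trans_le (le_csSup hS hmem)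
  obtain ⟨_, ⟨T, h1, h2, rfl⟩, h3⟩ := exists_lt_of_lt_csSup ⟨_, hmem⟩
    (show 2 / 3 * sSup S < sSup S by linarith)
  rcases le_total T₀.det T.det with h4 | h4
  · exact ⟨T, ⟨h1, h2, fun T' k1 k2 => by linarith [le_csSup hS ⟨T', k1, k2, rfl⟩]⟩, h4⟩
  · exact ⟨T₀, ⟨h₀, h₀', fun T' k1 k2 => by linarith [le_csSup hS ⟨T', k1, k2, rfl⟩]⟩, le_rfl⟩

/-- Some accepted candidate is at least as good as a given piercing lattice. -/
theorem exists_accepted (D : Data n w h M N W H κ)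
    (hsort : ∀ i j, i < j → j < n → w i ≤ w j) {T₀ : Quad} (h₀ : T₀.Adapted)
    (h₀' : T₀.PiercesAll n w h) : ∃ t₁ t₂ t₃ t₄, InBox (60 * κ) n t₁ ∧ InBox (60 * κ) n t₂ ∧
      InBox (60 * κ) n t₃ ∧ InBox (60 * κ) n t₄ ∧
      (cand w h t₁ t₂ t₃ t₄).Accepted n w h (n + 30 * κ) ∧
      T₀.det ≤ (cand w h t₁ t₂ t₃ t₄).det := by
  obtain ⟨T, hT, hle⟩ := exists_nearOpt D.n_pos h₀ h₀'
  obtain ⟨t₁, t₂, t₃, t₄, b₁, b₂, b₃, b₄, hC, hdet, hwid, hhei⟩ := exists_cand D hT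
  exact ⟨t₁, t₂, t₃, t₄, b₁, b₂, b₃, b₄,
    ⟨hC.adapted, (checkStep_complete D hsort hC hwid hhei).ge⟩, hle.trans hdet⟩

theorem Data.exists_piercing (D : Data n w h M N W H κ) :
    ∃ T : Quad, T.Adapted ∧ T.PiercesAll n w h := by
  have hW := D.W_pos
  have hH := D.H_pos
  have ha : (⟨W, 0, 0, H⟩ : Quad).Adapted :=
    ⟨hW.le, le_rfl, le_rfl, hH.le, by simp only [det]; nlinarith⟩
  exact ⟨_, ha, fun i hi => ha.pierces (by simpa using D.W_le i hi)
    (by simpa using hH.le.trans (D.H_le i hi)) (by simpa using D.H_le i hi)⟩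

end

end Quad

end LatticePiercing

namespace LatticePiercing

open Module

namespace Quad

/-! ### Plane lattices and adapted bases -/

/-- The first basis vector. -/
def fstVec (T : Quad) : Fin 2 → ℝ := ![T.p, -T.q]

/-- The second basis vector. -/
def sndVec (T : Quad) : Fin 2 → ℝ := ![T.r, T.s]

/-- The lattice generated by the basis. -/
def lattice (T : Quad) : Submodule ℤ (Fin 2 → ℝ) := Submodule.span ℤ {T.fstVec, T.sndVec}

theorem mem_lattice {T : Quad} {z : Fin 2 → ℝ} : z ∈ T.lattice ↔
    ∃ a b : ℤ, a * T.p + b * T.r = z 0 ∧ b * T.s - a * T.q = z 1 := by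
  rw [lattice, Submodule.mem_span_pair]
  refine exists_congr fun a => exists_congr fun b => ?_
  rw [funext_iff, Fin.forall_fin_two]
  simp only [fstVec, sndVec, Pi.add_apply, Pi.smul_apply, Matrix.cons_val_zero,
    Matrix.cons_val_one]
  simp only [zsmul_eq_mul]
  refine and_congr Iff.rfl ?_
  rw [show (b : ℝ) * T.s - a * T.q = a * -T.q + b * T.s by ring]

theorem lattice_comb_le (a b c d : ℤ) (T : Quad) : (comb a b c d T).lattice ≤ T.lattice := by
  intro z hz
  obtain ⟨m, n, h1, h2⟩ := mem_lattice.1 hz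
  refine mem_lattice.2 ⟨m * a + n * c, m * b + n * d, ?_, ?_⟩
  · rw [← h1]; simp only [comb]; push_cast; ring
  · rw [← h2]; simp only [comb]; push_cast; ring

theorem lattice_comb {a b c d : ℤ} (h : (a * d - b * c) * (a * d - b * c) = 1) (T : Quad) :
    (comb a b c d T).lattice = T.lattice := by
  refine le_antisymm (lattice_comb_le _ _ _ _ _) ?_
  set e := a * d - b * c
  have : comb (e * d) (-(e * b)) (-(e * c)) (e * a) (comb a b c d T) = T := by
    rw [comb_comb, show e * d * a + -(e * b) * c = 1 by rw [← h]; ring,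
      show e * d * b + -(e * b) * d = 0 by ring, show -(e * c) * a + e * a * c = 0 by ring,
      show -(e * c) * b + e * a * d = 1 by rw [← h]; ring, comb_one]
  conv_lhs => rw [← this]
  exact lattice_comb_le _ _ _ _ _

theorem isPiercing_lattice {n : ℕ} (F : RectFamily n) (T : Quad) :
    IsPiercing F T.lattice ↔ ∀ i, T.Pierces (F.width i) (F.height i) := by
  refine forall_congr' fun i => ⟨fun H x y => ?_, fun H x => ?_⟩
  · obtain ⟨z, hz, h1, h2⟩ := H ![x, y]
    obtain ⟨a, b, e1, e2⟩ := mem_lattice.1 hz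
    have k1 := h1 0
    have k2 := h1 1
    have k3 := h2 0
    have k4 := h2 1
    simp only [Pi.add_apply, Matrix.cons_val_zero, Matrix.cons_val_one] at k1 k2 k3 k4
    exact ⟨a, b, ⟨by rw [e1]; exact k1, by rw [e1]; exact k3⟩, by rw [e2]; exact k2,
      by rw [e2]; exact k4⟩
  · obtain ⟨a, b, ⟨h1, h2⟩, h3, h4⟩ := H (x 0) (x 1)
    refine ⟨![a * T.p + b * T.r, b * T.s - a * T.q], mem_lattice.2 ⟨a, b, rfl, rfl⟩, ?_, ?_⟩
    · intro j; fin_cases j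
      · exact h1
      · exact h3
    · intro j; fin_cases j
      · exact h2
      · exact h4

theorem matrix_det (T : Quad) : (Matrix.of ![T.fstVec, T.sndVec]).det = T.det := by
  simp [Matrix.det_fin_two, fstVec, sndVec, det]

theorem linearIndependent {T : Quad} (hT : T.det ≠ 0) :
    LinearIndependent ℝ ![T.fstVec, T.sndVec] :=
  Matrix.linearIndependent_rows_of_det_ne_zero (A := Matrix.of ![T.fstVec, T.sndVec])
    (by rwa [matrix_det])

theorem isPlaneLattice_and_covolume {T : Quad} (hT : T.det ≠ 0) :
    IsPlaneLattice T.lattice ∧ ZLattice.covolume T.lattice = |T.det| := by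
  let b : Basis (Fin 2) ℝ (Fin 2 → ℝ) :=
    basisOfLinearIndependentOfCardEqFinrank (linearIndependent hT) (by simp)
  have hb : ⇑b = ![T.fstVec, T.sndVec] := coe_basisOfLinearIndependentOfCardEqFinrank _ _
  have hspan : Submodule.span ℤ (Set.range b) = T.lattice := by
    rw [hb, lattice, Matrix.range_cons, Matrix.range_cons, Matrix.range_empty, Set.union_empty]
    rfl
  rw [← hspan]
  refine ⟨⟨inferInstance, inferInstance⟩, ?_⟩
  rw [ZLattice.covolume_eq_det _ (b.restrictScalars ℤ)]
  congr 1
  rw [← matrix_det, ← hb]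
  congr 2
  ext i j
  simp

theorem Adapted.isPlaneLattice {T : Quad} (hT : T.Adapted) : IsPlaneLattice T.lattice :=
  (isPlaneLattice_and_covolume hT.det_pos.ne').1

theorem Adapted.density {T : Quad} (hT : T.Adapted) : density T.lattice = T.det⁻¹ := by
  rw [LatticePiercing.density, (isPlaneLattice_and_covolume hT.det_pos.ne').2,
    abs_of_pos hT.det_pos]

/-- The sum of the lengths of the two basis vectors. -/
def length (T : Quad) : ℝ := |T.p| + |T.q| + |T.r| + |T.s|

theorem exists_adapted_of_minimal {T : Quad} (hd : T.det ≠ 0)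
    (hmin : ∀ a b c d : ℤ, (a * d - b * c) * (a * d - b * c) = 1 →
      T.length ≤ (comb a b c d T).length) (hp : 0 ≤ T.p) (hr : 0 ≤ T.r) :
    ∃ T' : Quad, T'.Adapted ∧ T'.lattice = T.lattice := by
  -- any basis with the right signs will do
  have fin : ∀ a b c d : ℤ, (a * d - b * c) * (a * d - b * c) = 1 →
      0 ≤ (comb a b c d T).p → 0 ≤ (comb a b c d T).q → 0 ≤ (comb a b c d T).r →
      0 ≤ (comb a b c d T).s → ∃ T' : Quad, T'.Adapted ∧ T'.lattice = T.lattice := by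
    intro a b c d h h1 h2 h3 h4
    refine ⟨_, ⟨h1, h2, h3, h4, ?_⟩, lattice_comb h T⟩
    refine lt_of_le_of_ne (add_nonneg (mul_nonneg h1 h4) (mul_nonneg h2 h3)) (Ne.symm ?_)
    rw [det_comb]
    refine mul_ne_zero ?_ hd
    intro h0
    have h0' : a * d - b * c = 0 := by exact_mod_cast h0
    simp [h0'] at h
  have m1 := hmin 1 (-1) 0 1 (by norm_num)
  have m2 := hmin 1 0 (-1) 1 (by norm_num)
  have f0 := fin 1 0 0 1 (by norm_num)
  have f1 := fin 0 1 1 0 (by norm_num)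
  have f2 := fin 1 (-1) 0 1 (by norm_num)
  have f3 := fin (-1) 1 1 0 (by norm_num)
  have f4 := fin 0 1 1 (-1) (by norm_num)
  have f5 := fin 1 0 (-1) 1 (by norm_num)
  simp only [comb, length, Int.cast_one, Int.cast_zero, Int.cast_neg, one_mul, zero_mul, neg_mul,
    add_zero, zero_add, sub_neg_eq_add, sub_zero, zero_sub] at m1 m2 f0 f1 f2 f3 f4 f5
  rcases le_total 0 T.q with hq | hq <;> rcases le_total 0 T.s with hs | hs
  · exact f0 hp hq hr hs
  · rcases le_total T.r T.p with h1 | h1 <;> rcases le_total (-T.s) T.q with h2 | h2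
    · rw [abs_of_nonneg (show 0 ≤ T.p + -T.r by linarith),
        abs_of_nonneg (show 0 ≤ T.q + T.s by linarith), abs_of_nonneg hp, abs_of_nonneg hq] at m1
      have e1 : T.r = 0 := by linarith
      have e2 : T.s = 0 := by linarith
      exact absurd (by simp [det, e1, e2]) hd
    · exact f4 hr (by linarith) (by linarith) (by linarith)
    · exact f5 hp hq (by linarith) (by linarith)
    · rw [abs_of_nonneg (show 0 ≤ -T.p + T.r by linarith),
        abs_of_nonpos (show T.s + T.q ≤ 0 by linarith), abs_of_nonneg hr, abs_of_nonpos hs,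
        abs_of_nonneg hp, abs_of_nonneg hq] at m2
      have e1 : T.p = 0 := by linarith
      have e2 : T.q = 0 := by linarith
      exact absurd (by simp [det, e1, e2]) hd
  · rcases le_total T.r T.p with h1 | h1 <;> rcases le_total T.s (-T.q) with h2 | h2
    · rw [abs_of_nonneg (show 0 ≤ T.p + -T.r by linarith),
        abs_of_nonpos (show T.q + T.s ≤ 0 by linarith), abs_of_nonneg hp, abs_of_nonpos hq] at m1
      have e1 : T.r = 0 := by linarith
      have e2 : T.s = 0 := by linarith
      exact absurd (by simp [det, e1, e2]) hd
    · exact f2 (by linarith) (by linarith) hr hs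
    · exact f3 (by linarith) (by linarith) hp (by linarith)
    · rw [abs_of_nonneg (show 0 ≤ -T.p + T.r by linarith),
        abs_of_nonneg (show 0 ≤ T.s + T.q by linarith), abs_of_nonneg hr, abs_of_nonneg hs,
        abs_of_nonneg hp, abs_of_nonpos hq] at m2
      have e1 : T.p = 0 := by linarith
      have e2 : T.q = 0 := by linarith
      exact absurd (by simp [det, e1, e2]) hd
  · exact f1 hr (by linarith) hp (by linarith)

theorem exists_lattice_eq {Λ : Submodule ℤ (Fin 2 → ℝ)} (hΛ : IsPlaneLattice Λ) :
    ∃ T : Quad, T.Adapted ∧ T.lattice = Λ := by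
  obtain ⟨_, _⟩ := hΛ
  let b := IsZLattice.basis Λ
  let T₀ : Quad := ⟨(b 0 : Fin 2 → ℝ) 0, -(b 0 : Fin 2 → ℝ) 1, (b 1 : Fin 2 → ℝ) 0,
    (b 1 : Fin 2 → ℝ) 1⟩
  have hu : T₀.fstVec = b 0 := by ext j; fin_cases j <;> simp [fstVec, T₀]
  have hv : T₀.sndVec = b 1 := by ext j; fin_cases j <;> simp [sndVec, T₀]
  have hT₀ : T₀.lattice = Λ := by
    have h1 := congrArg (Submodule.map Λ.subtype) b.span_eq
    rw [Submodule.map_span, Submodule.map_top, Submodule.range_subtype] at h1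
    rw [← h1, lattice, hu, hv]
    congr 1
    ext z
    simp [Fin.exists_fin_two, eq_comm]
  have hd₀ : T₀.det ≠ 0 := by
    have h1 := ZLattice.covolume_pos Λ
    rw [ZLattice.covolume_eq_det Λ b] at h1
    rw [← matrix_det]
    convert abs_pos.1 h1 using 2
    ext i j
    fin_cases i <;> simp [hu, hv]
  -- a basis of minimal length
  let S : Set Quad := {T | T.lattice = Λ ∧ T.det ≠ 0 ∧ T.length ≤ T₀.length}
  have hfin : S.Finite := by
    have hF : (Metric.closedBall (0 : Fin 2 → ℝ) T₀.length ∩ Λ).Finite :=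
      Metric.finite_isBounded_inter_isClosed DiscreteTopology.isDiscrete
        Metric.isBounded_closedBall (AddSubgroup.isClosed_of_discrete (H := Λ.toAddSubgroup))
    refine ((hF.prod hF).image fun z => (⟨z.1 0, -z.1 1, z.2 0, z.2 1⟩ : Quad)).subset ?_
    rintro T ⟨h1, -, h3⟩
    have h₀ : 0 ≤ T₀.length := by unfold length; positivity
    rw [length] at h3
    have k1 := abs_nonneg T.p
    have k2 := abs_nonneg T.q
    have k3 := abs_nonneg T.r
    have k4 := abs_nonneg T.s
    refine ⟨(T.fstVec, T.sndVec), ⟨⟨?_, ?_⟩, ?_, ?_⟩, by simp [fstVec, sndVec]⟩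
    · rw [mem_closedBall_zero_iff, pi_norm_le_iff_of_nonneg h₀]
      intro j; fin_cases j <;> simp [fstVec] <;> linarith
    · rw [← h1]; exact Submodule.subset_span (by simp)
    · rw [mem_closedBall_zero_iff, pi_norm_le_iff_of_nonneg h₀]
      intro j; fin_cases j <;> simp [sndVec] <;> linarith
    · rw [← h1]; exact Submodule.subset_span (by simp)
  obtain ⟨T₁, ⟨h1, h2, h3⟩, hmin⟩ := Set.exists_min_image S length hfin ⟨T₀, hT₀, hd₀, le_rfl⟩
  have hmin1 : ∀ a b c d : ℤ, (a * d - b * c) * (a * d - b * c) = 1 →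
      T₁.length ≤ (comb a b c d T₁).length := by
    intro a b c d h
    by_contra! hc
    refine hc.not_ge (hmin _ ⟨(lattice_comb h T₁).trans h1, ?_, hc.le.trans h3⟩)
    rw [det_comb]
    refine mul_ne_zero ?_ h2
    intro h0
    have h0' : a * d - b * c = 0 := by exact_mod_cast h0
    simp [h0'] at h
  -- make the first coordinates nonnegative
  obtain ⟨a, d, ha, hd, hp, hr⟩ : ∃ a d : ℤ, a * a = 1 ∧ d * d = 1 ∧ 0 ≤ (comb a 0 0 d T₁).p ∧
      0 ≤ (comb a 0 0 d T₁).r := by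
    have sgn : ∀ x : ℝ, ∃ a : ℤ, a * a = 1 ∧ 0 ≤ a * x := fun x => by
      rcases le_total 0 x with h | h
      · exact ⟨1, by norm_num, by simpa⟩
      · exact ⟨-1, by norm_num, by simpa⟩
    obtain ⟨a, ha, hp⟩ := sgn T₁.p
    obtain ⟨d, hd, hr⟩ := sgn T₁.r
    exact ⟨a, d, ha, hd, by simpa [comb] using hp, by simpa [comb] using hr⟩
  have had : (a * d - 0 * 0) * (a * d - 0 * 0) = 1 := by linear_combination d * d * ha + hd
  have habs : ∀ e : ℤ, e * e = 1 → |(e : ℝ)| = 1 := fun e he => by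
    have h1 : |(e : ℝ)| * |(e : ℝ)| = 1 := by rw [abs_mul_abs_self]; exact_mod_cast he
    nlinarith [abs_nonneg (e : ℝ)]
  have hlen : (comb a 0 0 d T₁).length = T₁.length := by
    simp [comb, length, abs_mul, habs a ha, habs d hd]
  obtain ⟨T, hT, hTl⟩ := exists_adapted_of_minimal (T := comb a 0 0 d T₁) (by
      rw [det_comb]
      refine mul_ne_zero ?_ h2
      intro h0
      have h0' : a * d - 0 * 0 = 0 := by exact_mod_cast h0
      rw [h0'] at had
      simp at had) (by
      intro a' b' c' d' h'
      rw [hlen, comb_comb]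
      apply hmin1
      linear_combination (a' * d' - b' * c') * (a' * d' - b' * c') * had + h') hp hr
  exact ⟨T, hT, hTl.trans ((lattice_comb had T₁).trans h1)⟩

end Quad

end LatticePiercing

namespace LatticePiercing

open Quad Function

/-! ### Loops over all equations -/

/-- The best basis found so far: its determinant is in `R[4]`, its vectors are in `R[0]`, …,
`R[3]`. -/
def Best (n : ℕ) (w h : ℕ → ℝ) (st : Config) : Prop :=
  st.rreg 4 = 0 ∨ ∃ T : Quad, T.Adapted ∧ T.PiercesAll n w h ∧ st.rreg 4 = T.det ∧
    st.rreg 0 = T.p ∧ st.rreg 1 = -T.q ∧ st.rreg 2 = T.r ∧ st.rreg 3 = T.s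

/-- The registers and memory cells which stay constant during the enumeration. -/
structure Ctx (n : ℕ) (w h : ℕ → ℝ) (K L : ℕ) (st : Config) : Prop where
  ireg_zero : st.ireg 0 = n
  ireg_two : st.ireg 2 = n + 1
  ireg_three : st.ireg 3 = 2 * K + 1
  ireg_four : st.ireg 4 = L
  rreg_five : st.rreg 5 = -K
  rreg_six : st.rreg 6 = 1
  rreg_seven : st.rreg 7 = 0
  width : ∀ i ≤ n, st.rmem (2 * i) = w i
  height : ∀ i ≤ n, st.rmem (2 * i + 1) = h i

/-- The enumeration at the level with first free registers `I[d]` and `R[ρ]` keeps the constants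
and the registers of the outer levels. -/
structure Frame (d ρ : ℕ) (st st' : Config) : Prop where
  ireg_const : ∀ x, x = 0 ∨ x = 2 ∨ x = 3 ∨ x = 4 → st'.ireg x = st.ireg x
  ireg_outer : ∀ x, 10 ≤ x → x < d → st'.ireg x = st.ireg x
  rreg_const : ∀ x, x = 5 ∨ x = 6 ∨ x = 7 → st'.rreg x = st.rreg x
  rreg_outer : ∀ x, 10 ≤ x → x < ρ → st'.rreg x = st.rreg x
  rmem : st'.rmem = st.rmem

theorem Frame.trans {d ρ : ℕ} {s t u : Config} (h : Frame d ρ s t) (h' : Frame d ρ t u) :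
    Frame d ρ s u where
  ireg_const x hx := (h'.1 x hx).trans (h.1 x hx)
  ireg_outer x hx hx' := (h'.2 x hx hx').trans (h.2 x hx hx')
  rreg_const x hx := (h'.3 x hx).trans (h.3 x hx)
  rreg_outer x hx hx' := (h'.4 x hx hx').trans (h.4 x hx hx')
  rmem := h'.5.trans h.5

theorem Frame.mono {d ρ d' ρ' : ℕ} {s t : Config} (h : Frame d' ρ' s t) (hd : d ≤ d')
    (hρ : ρ ≤ ρ') : Frame d ρ s t :=
  ⟨h.1, fun x h1 h2 => h.2 x h1 (by omega), h.3, fun x h1 h2 => h.4 x h1 (by omega), h.5⟩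

section

variable {n : ℕ} {w h : ℕ → ℝ} {K L : ℕ}

theorem Ctx.of_frame {d ρ : ℕ} {st st' : Config} (hc : Ctx n w h K L st) (hf : Frame d ρ st st') :
    Ctx n w h K L st' where
  ireg_zero := by rw [hf.1 0 (by simp), hc.1]
  ireg_two := by rw [hf.1 2 (by simp), hc.2]
  ireg_three := by rw [hf.1 3 (by simp), hc.3]
  ireg_four := by rw [hf.1 4 (by simp), hc.4]
  rreg_five := by rw [hf.3 5 (by simp), hc.5]
  rreg_six := by rw [hf.3 6 (by simp), hc.6]
  rreg_seven := by rw [hf.3 7 (by simp), hc.7]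
  width := by rw [hf.5]; exact hc.8
  height := by rw [hf.5]; exact hc.9

/-- The command `c` keeps the frame, improves the best basis and ends with `R[4]` having property
`G`. -/
def Spec (n : ℕ) (w h : ℕ → ℝ) (K L d ρ : ℕ) (c : Cmd) (T : ℕ) (G : Config → ℝ → Prop) : Prop :=
  ∀ st, Ctx n w h K L st → Best n w h st → wp c st T fun st' => Frame d ρ st st' ∧
    Best n w h st' ∧ st.rreg 4 ≤ st'.rreg 4 ∧ G st (st'.rreg 4)

/-- `R[ρ]` runs through the integers of absolute value at most `K`. -/
def coefLoop (d ρ : ℕ) (c : Cmd) : Cmd :=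
  .seq (.block [.radd ρ 5 7]) (.for d 3 (.seq c (.block [.radd ρ ρ 6])))

/-- `(R[ρ], R[ρ + 1])` runs through the sides of the rectangles, followed by `(0, 0)`. -/
def indexLoop (d ρ : ℕ) (c : Cmd) : Cmd :=
  .for d 2 (.seq (.block [.iadd 5 d d, .rload ρ 5, .iconst 6 1, .iadd 5 5 6, .rload (ρ + 1) 5]) c)

theorem spec_coefLoop {d ρ : ℕ} (hd : 10 ≤ d) (hρ : 10 ≤ ρ) {c : Cmd} {T : ℕ}
    {G : Config → ℝ → Prop} (hG : ∀ st x y, x ≤ y → G st x → G st y)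
    (hc : Spec n w h K L (d + 1) (ρ + 1) c T G) :
    Spec n w h K L d ρ (coefLoop d ρ c) ((2 * K + 1) * (T + 5) + 3) fun st x =>
      ∀ a : ℤ, |a| ≤ K → ∃ st1, Frame d ρ st st1 ∧ st1.rreg ρ = a ∧ G st1 x := by
  intro st hctx hbest
  refine wp_seq_le 1 ((2 * K + 1) * ((T + 1) + 4) + 2) (le_of_eq (by ring))
    (wp_block_le (by simp [Instr.IsOp]) (by simp) ?_)
  refine wp_for (by omega) (by omega) (by omega) (by simpa [Instr.exec] using hctx.ireg_three)
    (fun j s => Frame d ρ st s ∧ Best n w h s ∧ st.rreg 4 ≤ s.rreg 4 ∧ s.rreg ρ = -K + j ∧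
      ∀ j' < j, ∃ st1, Frame d ρ st st1 ∧ st1.rreg ρ = -K + j' ∧ G st1 (s.rreg 4)) ?_ ?_ ?_
  · intro pc
    have e : ∀ x, x ≠ ρ → update st.rreg ρ (st.rreg 5 + st.rreg 7) x = st.rreg x :=
      fun x hx => update_of_ne hx _ _
    refine ⟨⟨fun x hx => ?_, fun x h1 h2 => ?_, fun x hx => ?_, fun x h1 h2 => ?_, rfl⟩,
      ?_, ?_, ?_, fun j' hj' => absurd hj' (by omega)⟩
    · exact update_of_ne (by omega) _ _
    · exact update_of_ne (by omega) _ _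
    · exact e x (by omega)
    · exact e x (by omega)
    · simpa [Best, Instr.exec, e 0 (by omega), e 1 (by omega), e 2 (by omega), e 3 (by omega),
        e 4 (by omega)] using hbest
    · simp [Instr.exec, e 4 (by omega)]
    · simp [Instr.exec, hctx.rreg_five, hctx.rreg_seven]
  · rintro j - s ⟨hf, hb, hle, hr, hG'⟩ h1 h2
    refine wp_seq ((hc s (hctx.of_frame hf) hb).mono le_rfl ?_)
    rintro s' ⟨hf', hb', hle', hg⟩
    refine wp_block (by simp [Instr.IsOp]) ?_
    have e : ∀ x, x ≠ ρ → update s'.rreg ρ (s'.rreg ρ + s'.rreg 6) x = s'.rreg x :=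
      fun x hx => update_of_ne hx _ _
    have hf'' : Frame d ρ s s' := hf'.mono (by omega) (by omega)
    refine ⟨?_, ?_, fun pc => ⟨hf.trans (hf''.trans ⟨fun x hx => ?_, fun x h3 h4 => ?_,
      fun x hx => ?_, fun x h3 h4 => ?_, rfl⟩), ?_, ?_, ?_, ?_⟩⟩
    · simpa [Instr.exec] using (hf'.2 d hd (by omega)).trans h1
    · simpa [Instr.exec] using (hf'.1 3 (by simp)).trans h2
    · exact (update_of_ne (by omega) _ _).trans (update_of_ne (by omega) _ _)
    · exact (update_of_ne (by omega) _ _).trans (update_of_ne (by omega) _ _)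
    · exact e x (by omega)
    · exact e x (by omega)
    · simpa [Best, Instr.exec, e 0 (by omega), e 1 (by omega), e 2 (by omega), e 3 (by omega),
        e 4 (by omega)] using hb'
    · simpa [Instr.exec, e 4 (by omega)] using hle.trans hle'
    · simp [Instr.exec, hf'.4 ρ hρ (by omega), hr, hf'.3 6 (by simp), (hctx.of_frame hf).rreg_six,
        add_assoc]
    · intro j' hj'
      simp only [List.foldl_cons, List.foldl_nil, Instr.exec, e 4 (by omega)]
      rcases Nat.lt_succ_iff_lt_or_eq.1 hj' with h5 | rfl
      · obtain ⟨st1, k1, k2, k3⟩ := hG' j' h5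
        exact ⟨st1, k1, k2, hG _ _ _ hle' k3⟩
      · exact ⟨s, hf, hr, hg⟩
  · rintro s ⟨hf, hb, hle, -, hG'⟩ -
    refine ⟨hf, hb, hle, fun a ha => ?_⟩
    rw [abs_le] at ha
    obtain ⟨st1, k1, k2, k3⟩ := hG' (a + K).toNat (by omega)
    refine ⟨st1, k1, ?_, k3⟩
    rw [k2]
    have : (((a + K).toNat : ℤ) : ℝ) = ((a + K : ℤ) : ℝ) := by
      rw [Int.toNat_of_nonneg (by omega)]
    push_cast at this
    rw [this]; ring

theorem spec_indexLoop {d ρ : ℕ} (hd : 10 ≤ d) (hρ : 10 ≤ ρ) {c : Cmd} {T : ℕ}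
    {G : Config → ℝ → Prop} (hG : ∀ st x y, x ≤ y → G st x → G st y)
    (hc : Spec n w h K L (d + 1) (ρ + 2) c T G) :
    Spec n w h K L d ρ (indexLoop d ρ c) ((n + 1) * (T + 9) + 2) fun st x =>
      ∀ i ≤ n, ∃ st1, Frame d ρ st st1 ∧ st1.rreg ρ = w i ∧ st1.rreg (ρ + 1) = h i ∧ G st1 x := by
  intro st hctx hbest
  refine (wp_for (m := n + 1) (T := T + 5) (by omega) (by omega) (by omega) hctx.ireg_two
    (fun j s => Frame d ρ st s ∧ Best n w h s ∧ st.rreg 4 ≤ s.rreg 4 ∧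
      ∀ j' < j, ∃ st1, Frame d ρ st st1 ∧ st1.rreg ρ = w j' ∧ st1.rreg (ρ + 1) = h j' ∧
        G st1 (s.rreg 4)) ?_ ?_ ?_).mono (by lia) fun _ h => h
  · intro pc
    refine ⟨⟨fun x hx => ?_, fun x h1 h2 => ?_, fun x hx => rfl, fun x h1 h2 => rfl, rfl⟩,
      hbest, le_rfl, fun j' hj' => absurd hj' (by omega)⟩
    · exact update_of_ne (by omega) _ _
    · exact update_of_ne (by omega) _ _
  · rintro j hj s ⟨hf, hb, hle, hG'⟩ h1 h2
    refine wp_seq_le 5 T (by omega) (wp_block_le (by simp [Instr.IsOp]) (by simp) ?_)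
    set s1 := List.foldl (fun c a => Instr.exec c a) s
      [.iadd 5 d d, .rload ρ 5, .iconst 6 1, .iadd 5 5 6, .rload (ρ + 1) 5] with hs1
    have hcs := hctx.of_frame hf
    have hi : ∀ x, x ≠ 5 → x ≠ 6 → s1.ireg x = s.ireg x := fun x h3 h4 => by
      simp [hs1, Instr.exec, h3, h4]
    have hr : ∀ x, x ≠ ρ → x ≠ ρ + 1 → s1.rreg x = s.rreg x := fun x h3 h4 => by
      simp [hs1, Instr.exec, h3, h4]
    have hw : s1.rreg ρ = w j := by
      simp [hs1, Instr.exec, h1, ← two_mul, hcs.width j (by omega)]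
    have hh : s1.rreg (ρ + 1) = h j := by
      simp [hs1, Instr.exec, h1, ← two_mul, hcs.height j (by omega)]
    have hm : s1.rmem = s.rmem := by simp [hs1, Instr.exec]
    have hfs : Frame d ρ s s1 := ⟨fun x hx => hi x (by omega) (by omega),
      fun x h3 h4 => hi x (by omega) (by omega), fun x hx => hr x (by omega) (by omega),
      fun x h3 h4 => hr x (by omega) (by omega), hm⟩
    have hbs : Best n w h s1 := by
      simpa [Best, hr 0 (by omega) (by omega), hr 1 (by omega) (by omega),
        hr 2 (by omega) (by omega), hr 3 (by omega) (by omega), hr 4 (by omega) (by omega)] using hb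
    refine (hc s1 (hcs.of_frame hfs) hbs).mono le_rfl ?_
    rintro s' ⟨hf', hb', hle', hg⟩
    have hf'' : Frame d ρ s1 s' := hf'.mono (by omega) (by omega)
    rw [hr 4 (by omega) (by omega)] at hle'
    refine ⟨?_, ?_, fun pc => ⟨hf.trans (hfs.trans (hf''.trans ⟨fun x hx => ?_, fun x h3 h4 => ?_,
      fun x hx => rfl, fun x h3 h4 => rfl, rfl⟩)), hb', hle.trans hle', ?_⟩⟩
    · rw [hf'.2 d hd (by omega), hi d (by omega) (by omega), h1]
    · rw [hf'.1 2 (by simp), hi 2 (by omega) (by omega), h2]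
    · exact (update_of_ne (by omega) _ _).trans (update_of_ne (by omega) _ _)
    · exact (update_of_ne (by omega) _ _).trans (update_of_ne (by omega) _ _)
    · intro j' hj'
      rcases Nat.lt_succ_iff_lt_or_eq.1 hj' with h5 | rfl
      · obtain ⟨st1, k1, k2, k3, k4⟩ := hG' j' h5
        exact ⟨st1, k1, k2, k3, hG _ _ _ hle' k4⟩
      · exact ⟨s1, hf.trans hfs, hw, hh, hg⟩
  · rintro s ⟨hf, hb, hle, hG'⟩ -
    exact ⟨hf, hb, hle, fun i hi => hG' i (by omega)⟩

end

end LatticePiercing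

namespace LatticePiercing

open Quad Function

/-! ### Testing one candidate -/

/-- The empty command. -/
def skip : Cmd := .block []

theorem wp_skip {st : Config} {T : ℕ} {Q : Config → Prop} (h : Q st) : wp skip st T Q :=
  wp_block_le (by simp) (by simp) h

/-- If the current basis, in `R[40]`, …, `R[43]`, is low enough for the current rectangle, of
height `R[31]`, then proceed to the next rectangle. -/
def advance : Cmd := .rle 41 31 (.rle 43 31 (.block [.iconst 6 1, .iadd 7 7 6]) skip) skip

/-- One step of the piercing test; `I[7]` is the index of the current rectangle. -/
def checkCmd : Cmd :=
  .ile 0 7 skip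
    (.seq (.block [.iadd 5 7 7, .rload 30 5, .iconst 6 1, .iadd 5 5 6, .rload 31 5, .radd 32 40 42])
      (.rle 32 30
        (.rle 41 43
          (.seq (.block [.radd 33 32 40])
            (.rle 33 30 (.block [.radd 42 42 40, .rsub 43 43 41]) advance))
          (.seq (.block [.radd 33 32 42])
            (.rle 33 30 (.block [.radd 40 40 42, .rsub 41 41 43]) advance)))
        (.rle 42 40 (.block [.rsub 40 40 42, .radd 41 41 43])
          (.block [.rsub 42 42 40, .radd 43 43 41]))))

/-- The registers hold the state `z` of the piercing test. -/
structure Holds (st : Config) (z : Quad × ℕ) : Prop where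
  p : st.rreg 40 = z.1.p
  q : st.rreg 41 = z.1.q
  r : st.rreg 42 = z.1.r
  s : st.rreg 43 = z.1.s
  i : st.ireg 7 = z.2

/-- The piercing test changes scratch registers only. -/
structure Local (st st' : Config) : Prop where
  ireg : ∀ x, x ≠ 1 → x ≠ 5 → x ≠ 6 → x ≠ 7 → st'.ireg x = st.ireg x
  rreg : ∀ x, x < 30 ∨ (35 ≤ x ∧ x < 40) ∨ 44 ≤ x → st'.rreg x = st.rreg x
  rmem : st'.rmem = st.rmem

theorem Local.trans {s t u : Config} (h : Local s t) (h' : Local t u) : Local s u :=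
  ⟨fun x a b c d => (h'.1 x a b c d).trans (h.1 x a b c d),
    fun x a => (h'.2 x a).trans (h.2 x a), h'.3.trans h.3⟩

section

variable {n : ℕ} {w h : ℕ → ℝ} {K L : ℕ}

theorem wp_advance {st : Config} {z : Quad × ℕ} (hz : Holds st z) {y : ℝ} (hy : st.rreg 31 = y) :
    wp advance st 6 fun st' => Local st st' ∧
      Holds st' (if z.1.q ≤ y ∧ z.1.s ≤ y then (z.1, z.2 + 1) else z) := by
  have refl : Local st st := ⟨fun _ _ _ _ _ => rfl, fun _ _ => rfl, rfl⟩
  refine wp_rle_le 4 le_rfl (fun h1 => wp_rle_le 2 le_rfl (fun h2 => ?_) fun h2 => ?_) fun h1 => ?_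
  · rw [hz.q, hy] at h1
    rw [hz.s, hy] at h2
    rw [if_pos ⟨h1, h2⟩]
    refine wp_block (by simp [Instr.IsOp]) ⟨⟨fun x a b c d => ?_, fun x a => rfl, rfl⟩,
      hz.p, hz.q, hz.r, hz.s, ?_⟩
    · simp [Instr.exec, c, d]
    · simp [Instr.exec, hz.i]
  · rw [hz.s, hy] at h2
    rw [if_neg fun h => h2 h.2]
    exact wp_skip ⟨refl, hz⟩
  · rw [hz.q, hy] at h1
    rw [if_neg fun h => h1 h.1]
    exact wp_skip ⟨refl, hz⟩

theorem wp_checkCmd {st : Config} (hctx : Ctx n w h K L st) {z : Quad × ℕ} (hz : Holds st z) :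
    wp checkCmd st 21 fun st' => Local st st' ∧ Holds st' (checkStep n w h z) := by
  refine wp_ile_le 19 le_rfl (fun h1 => ?_) fun h1 => ?_
  · rw [hctx.ireg_zero, hz.i] at h1
    rw [checkStep, if_neg (by omega)]
    exact wp_skip ⟨⟨fun _ _ _ _ _ => rfl, fun _ _ => rfl, rfl⟩, hz⟩
  rw [hctx.ireg_zero, hz.i, not_le] at h1
  refine wp_seq_le 6 13 le_rfl (wp_block_le (by simp [Instr.IsOp]) le_rfl ?_)
  set s1 := List.foldl (fun c a => Instr.exec c a) st
    [.iadd 5 7 7, .rload 30 5, .iconst 6 1, .iadd 5 5 6, .rload 31 5, .radd 32 40 42] with hs1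
  have hl : Local st s1 := by
    refine ⟨fun x a b c d => ?_, fun x a => ?_, rfl⟩
    · simp [hs1, Instr.exec, b, c]
    · simp [hs1, Instr.exec, show x ≠ 30 by omega, show x ≠ 31 by omega, show x ≠ 32 by omega]
  have h30 : s1.rreg 30 = w z.2 := by
    simp [hs1, Instr.exec, hz.i, ← two_mul, hctx.width z.2 h1.le]
  have h31 : s1.rreg 31 = h z.2 := by
    simp [hs1, Instr.exec, hz.i, ← two_mul, hctx.height z.2 h1.le]
  have h32 : s1.rreg 32 = z.1.width := by simp [hs1, Instr.exec, hz.p, hz.r, width]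
  have hz1 : Holds s1 z := ⟨by simp [hs1, Instr.exec, hz.p], by simp [hs1, Instr.exec, hz.q],
    by simp [hs1, Instr.exec, hz.r], by simp [hs1, Instr.exec, hz.s],
    by simp [hs1, Instr.exec, hz.i]⟩
  clear_value s1
  refine wp_rle_le 11 le_rfl (fun c1 => wp_rle_le 9 le_rfl (fun c2 => ?_) fun c2 => ?_)
    fun c1 => wp_rle_le 2 (by omega) (fun c2 => ?_) fun c2 => ?_
  all_goals rw [h32, h30] at c1
  · rw [hz1.q, hz1.s] at c2
    refine wp_seq_le 1 8 le_rfl (wp_block (by simp [Instr.IsOp]) ?_)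
    set s2 := List.foldl (fun c a => Instr.exec c a) s1 [.radd 33 32 40] with hs2
    have hl2 : Local s1 s2 := by
      refine ⟨fun x a b c d => rfl, fun x a => ?_, rfl⟩
      simp [hs2, Instr.exec, show x ≠ 33 by omega]
    have e : s2.rreg 33 = z.1.fwd.width := by
      simp [hs2, Instr.exec, h32, hz1.p, width_fwd, if_pos c2]
    have e0 : s2.rreg 30 = w z.2 := by simp [hs2, Instr.exec, h30]
    have e1 : s2.rreg 31 = h z.2 := by simp [hs2, Instr.exec, h31]
    have hz2 : Holds s2 z := ⟨by simp [hs2, Instr.exec, hz1.p], by simp [hs2, Instr.exec, hz1.q],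
      by simp [hs2, Instr.exec, hz1.r], by simp [hs2, Instr.exec, hz1.s],
      by simp [hs2, Instr.exec, hz1.i]⟩
    clear_value s2
    rw [checkStep, if_pos h1, if_pos c1]
    refine wp_rle_le 6 le_rfl (fun c3 => ?_) fun c3 => ?_
    · rw [e, e0] at c3
      rw [if_pos c3]
      refine wp_block_le (by simp [Instr.IsOp]) (by simp)
        ⟨hl.trans (hl2.trans ⟨fun x a b c d => rfl, fun x a => ?_, rfl⟩), ?_⟩
      · simp [Instr.exec, show x ≠ 42 by omega, show x ≠ 43 by omega]
      · constructor <;> simp [Instr.exec, fwd, if_pos c2, hz2.p, hz2.q, hz2.r, hz2.s, hz2.i]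
    · rw [e, e0] at c3
      rw [if_neg c3]
      exact (wp_advance hz2 e1).mono le_rfl fun s3 hs3 => ⟨hl.trans (hl2.trans hs3.1), hs3.2⟩
  · rw [hz1.q, hz1.s] at c2
    refine wp_seq_le 1 8 le_rfl (wp_block (by simp [Instr.IsOp]) ?_)
    set s2 := List.foldl (fun c a => Instr.exec c a) s1 [.radd 33 32 42] with hs2
    have hl2 : Local s1 s2 := by
      refine ⟨fun x a b c d => rfl, fun x a => ?_, rfl⟩
      simp [hs2, Instr.exec, show x ≠ 33 by omega]
    have e : s2.rreg 33 = z.1.fwd.width := by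
      simp [hs2, Instr.exec, h32, hz1.r, width_fwd, if_neg c2]
    have e0 : s2.rreg 30 = w z.2 := by simp [hs2, Instr.exec, h30]
    have e1 : s2.rreg 31 = h z.2 := by simp [hs2, Instr.exec, h31]
    have hz2 : Holds s2 z := ⟨by simp [hs2, Instr.exec, hz1.p], by simp [hs2, Instr.exec, hz1.q],
      by simp [hs2, Instr.exec, hz1.r], by simp [hs2, Instr.exec, hz1.s],
      by simp [hs2, Instr.exec, hz1.i]⟩
    clear_value s2
    rw [checkStep, if_pos h1, if_pos c1]
    refine wp_rle_le 6 le_rfl (fun c3 => ?_) fun c3 => ?_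
    · rw [e, e0] at c3
      rw [if_pos c3]
      refine wp_block_le (by simp [Instr.IsOp]) (by simp)
        ⟨hl.trans (hl2.trans ⟨fun x a b c d => rfl, fun x a => ?_, rfl⟩), ?_⟩
      · simp [Instr.exec, show x ≠ 40 by omega, show x ≠ 41 by omega]
      · constructor <;> simp [Instr.exec, fwd, if_neg c2, hz2.p, hz2.q, hz2.r, hz2.s, hz2.i]
    · rw [e, e0] at c3
      rw [if_neg c3]
      exact (wp_advance hz2 e1).mono le_rfl fun s3 hs3 => ⟨hl.trans (hl2.trans hs3.1), hs3.2⟩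
  · rw [hz1.r, hz1.p] at c2
    rw [checkStep, if_pos h1, if_neg c1]
    refine wp_block (by simp [Instr.IsOp]) ⟨hl.trans ⟨fun x a b c d => rfl, fun x a => ?_, rfl⟩, ?_⟩
    · simp [Instr.exec, show x ≠ 40 by omega, show x ≠ 41 by omega]
    · constructor <;> simp [Instr.exec, bwd, if_pos c2, hz1.p, hz1.q, hz1.r, hz1.s, hz1.i]
  · rw [hz1.r, hz1.p] at c2
    rw [checkStep, if_pos h1, if_neg c1]
    refine wp_block (by simp [Instr.IsOp]) ⟨hl.trans ⟨fun x a b c d => rfl, fun x a => ?_, rfl⟩, ?_⟩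
    · simp [Instr.exec, show x ≠ 42 by omega, show x ≠ 43 by omega]
    · constructor <;> simp [Instr.exec, bwd, if_neg c2, hz1.p, hz1.q, hz1.r, hz1.s, hz1.i]

/-- Solve the four equations; the basis is put into `R[35]`, …, `R[38]` and `R[40]`, …, `R[43]`,
the determinant into `R[39]`. -/
def solveOps : List Instr :=
  [.rmul 30 12 15, .rmul 31 16 11, .rsub 30 30 31, .rmul 31 10 15, .rmul 32 14 11, .rsub 31 31 32,
    .rdiv 40 30 31, .rmul 30 10 16, .rmul 32 14 12, .rsub 30 30 32, .rdiv 42 30 31,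
    .rmul 30 21 23, .rmul 31 25 19, .rsub 30 30 31, .rmul 31 18 23, .rmul 32 22 19, .rsub 31 31 32,
    .rdiv 41 30 31, .rmul 30 18 25, .rmul 32 22 21, .rsub 30 30 32, .rdiv 43 30 31,
    .rmul 30 40 43, .rmul 31 41 42, .radd 39 30 31,
    .radd 35 40 7, .radd 36 41 7, .radd 37 42 7, .radd 38 43 7, .iconst 7 0]

/-- Solve the equations, test the solution and keep it if it is better than the best basis. -/
def candCmd : Cmd :=
  .seq (.block solveOps)
    (.rle 39 4 skip (.rle 7 35 (.rle 7 36 (.rle 7 37 (.rle 7 38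
      (.seq (.for 8 4 checkCmd)
        (.ile 0 7 (.block [.radd 0 35 7, .rsub 1 7 36, .radd 2 37 7, .radd 3 38 7, .radd 4 39 7])
          skip))
      skip) skip) skip) skip))

/-- The registers of one level hold the equation `t`. -/
def HoldsEq (w h : ℕ → ℝ) (st : Config) (ρ : ℕ) (t : ℤ × ℤ × ℕ) : Prop :=
  st.rreg ρ = t.1 ∧ st.rreg (ρ + 1) = t.2.1 ∧ st.rreg (ρ + 2) = w t.2.2 ∧ st.rreg (ρ + 3) = h t.2.2

/-- The candidate given by the registers, if accepted, is not better than `x`. -/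
def CandLe (n : ℕ) (w h : ℕ → ℝ) (L : ℕ) (st : Config) (x : ℝ) : Prop :=
  ∀ t₁ t₂ t₃ t₄, HoldsEq w h st 10 t₁ → HoldsEq w h st 14 t₂ → HoldsEq w h st 18 t₃ →
    HoldsEq w h st 22 t₄ → (cand w h t₁ t₂ t₃ t₄).Accepted n w h L → (cand w h t₁ t₂ t₃ t₄).det ≤ x

/-- The basis computed by `solveOps`. -/
noncomputable def solution (st : Config) : Quad where
  p := (st.rreg 12 * st.rreg 15 - st.rreg 16 * st.rreg 11) /
    (st.rreg 10 * st.rreg 15 - st.rreg 14 * st.rreg 11)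
  q := (st.rreg 21 * st.rreg 23 - st.rreg 25 * st.rreg 19) /
    (st.rreg 18 * st.rreg 23 - st.rreg 22 * st.rreg 19)
  r := (st.rreg 10 * st.rreg 16 - st.rreg 14 * st.rreg 12) /
    (st.rreg 10 * st.rreg 15 - st.rreg 14 * st.rreg 11)
  s := (st.rreg 18 * st.rreg 25 - st.rreg 22 * st.rreg 21) /
    (st.rreg 18 * st.rreg 23 - st.rreg 22 * st.rreg 19)

theorem candLe_of_solution {st : Config} {x : ℝ}
    (H : (solution st).Accepted n w h L → (solution st).det ≤ x) : CandLe n w h L st x := by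
  intro t₁ t₂ t₃ t₄ ⟨a1, a2, a3, a4⟩ ⟨b1, b2, b3, b4⟩ ⟨c1, c2, c3, c4⟩ ⟨d1, d2, d3, d4⟩
  have : cand w h t₁ t₂ t₃ t₄ = solution st := by
    simp only [cand, cramerFst, cramerSnd, solution, a1, a2, a3, b1, b2, b3, c1, c2, c4, d1, d2, d4]
  rw [this]
  exact H

theorem spec_candCmd : Spec n w h K L 22 26 candCmd (25 * L + 60) (CandLe n w h L) := by
  intro st hctx hbest
  refine wp_seq_le 30 (25 * L + 30) (by omega)
    (wp_block_le (by simp [solveOps, Instr.IsOp]) (by simp [solveOps]) ?_)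
  set T := solution st with hT
  set s1 := List.foldl (fun c a => Instr.exec c a) st solveOps with hs1
  have hi : ∀ x, x ≠ 7 → s1.ireg x = st.ireg x := fun x hx => by
    simp [hs1, solveOps, Instr.exec, hx]
  have hr : ∀ x, x < 30 → s1.rreg x = st.rreg x := fun x hx => by
    simp [hs1, solveOps, Instr.exec, show x ≠ 30 by omega, show x ≠ 31 by omega,
      show x ≠ 32 by omega, show x ≠ 35 by omega, show x ≠ 36 by omega, show x ≠ 37 by omega,
      show x ≠ 38 by omega, show x ≠ 39 by omega, show x ≠ 40 by omega, show x ≠ 41 by omega,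
      show x ≠ 42 by omega, show x ≠ 43 by omega]
  have hm : s1.rmem = st.rmem := by simp [hs1, solveOps, Instr.exec]
  have h7 := hctx.rreg_seven
  have e40 : s1.rreg 40 = T.p := by simp [hs1, solveOps, Instr.exec, hT, solution]
  have e41 : s1.rreg 41 = T.q := by simp [hs1, solveOps, Instr.exec, hT, solution]
  have e42 : s1.rreg 42 = T.r := by simp [hs1, solveOps, Instr.exec, hT, solution]
  have e43 : s1.rreg 43 = T.s := by simp [hs1, solveOps, Instr.exec, hT, solution]
  have e35 : s1.rreg 35 = T.p := by simp [hs1, solveOps, Instr.exec, hT, solution, h7]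
  have e36 : s1.rreg 36 = T.q := by simp [hs1, solveOps, Instr.exec, hT, solution, h7]
  have e37 : s1.rreg 37 = T.r := by simp [hs1, solveOps, Instr.exec, hT, solution, h7]
  have e38 : s1.rreg 38 = T.s := by simp [hs1, solveOps, Instr.exec, hT, solution, h7]
  have e39 : s1.rreg 39 = T.det := by simp [hs1, solveOps, Instr.exec, hT, solution, det]
  have e7 : s1.ireg 7 = 0 := by simp [hs1, solveOps, Instr.exec]
  clear_value s1
  have hf1 : Frame 22 26 st s1 := ⟨fun x hx => hi x (by omega), fun x a b => hi x (by omega),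
    fun x hx => hr x (by omega), fun x a b => hr x (by omega), hm⟩
  have hb1 : Best n w h s1 := by
    simpa [Best, hr 0 (by omega), hr 1 (by omega), hr 2 (by omega), hr 3 (by omega),
      hr 4 (by omega)] using hbest
  have hc1 := hctx.of_frame hf1
  have hz1 : Holds s1 (T, 0) := ⟨e40, e41, e42, e43, e7⟩
  have h71 := hc1.rreg_seven
  -- the solution is not accepted, or not better
  have done : ∀ s2, Frame 22 26 st s2 → Best n w h s2 → s2.rreg 4 = st.rreg 4 →
      (T.Accepted n w h L → T.det ≤ st.rreg 4) → Frame 22 26 st s2 ∧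
      Best n w h s2 ∧ st.rreg 4 ≤ s2.rreg 4 ∧ CandLe n w h L st (s2.rreg 4) :=
    fun s2 h1 h2 h3 h4 => ⟨h1, h2, h3.ge, candLe_of_solution (by rw [h3]; exact h4)⟩
  refine wp_rle_le (25 * L + 28) (by omega) (fun c0 => ?_) fun c0 => ?_
  · refine wp_skip (done _ hf1 hb1 (hr 4 (by omega)) fun _ => ?_)
    rwa [e39, hr 4 (by omega)] at c0
  rw [e39, hr 4 (by omega), not_le] at c0
  refine wp_rle_le (25 * L + 26) (by omega) (fun c1 => ?_) fun c1 => ?_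
  swap
  · rw [h71, e35] at c1
    exact wp_skip (done _ hf1 hb1 (hr 4 (by omega)) fun h => absurd h.1.p_nonneg c1)
  refine wp_rle_le (25 * L + 24) (by omega) (fun c2 => ?_) fun c2 => ?_
  swap
  · rw [h71, e36] at c2
    exact wp_skip (done _ hf1 hb1 (hr 4 (by omega)) fun h => absurd h.1.q_nonneg c2)
  refine wp_rle_le (25 * L + 22) (by omega) (fun c3 => ?_) fun c3 => ?_
  swap
  · rw [h71, e37] at c3
    exact wp_skip (done _ hf1 hb1 (hr 4 (by omega)) fun h => absurd h.1.r_nonneg c3)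
  refine wp_rle_le (25 * L + 20) (by omega) (fun c4 => ?_) fun c4 => ?_
  swap
  · rw [h71, e38] at c4
    exact wp_skip (done _ hf1 hb1 (hr 4 (by omega)) fun h => absurd h.1.s_nonneg c4)
  rw [h71, e35] at c1
  rw [h71, e36] at c2
  rw [h71, e37] at c3
  rw [h71, e38] at c4
  have hbest0 : 0 ≤ st.rreg 4 := by
    rcases hbest with h1 | ⟨T', h1, -, h2, -⟩
    · exact h1.ge
    · rw [h2]; exact h1.det_pos.le
  have hTa : T.Adapted := ⟨c1, c2, c3, c4, hbest0.trans_lt c0⟩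
  refine wp_seq_le (L * (21 + 4) + 2) 18 (by omega) ?_
  refine wp_for (by omega) (by omega) (by omega) hc1.ireg_four
    (fun j s => Holds s ((checkStep n w h)^[j] (T, 0)) ∧
      (∀ x, x ≠ 1 → x ≠ 5 → x ≠ 6 → x ≠ 7 → x ≠ 8 → s.ireg x = s1.ireg x) ∧
      (∀ x, x < 30 ∨ (35 ≤ x ∧ x < 40) ∨ 44 ≤ x → s.rreg x = s1.rreg x) ∧ s.rmem = s1.rmem)
    ?_ ?_ ?_
  · intro pc
    refine ⟨⟨e40, e41, e42, e43, ?_⟩, fun x _ _ _ _ h8 => ?_, fun _ _ => rfl, rfl⟩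
    · simpa using e7
    · exact update_of_ne h8 _ _
  · rintro j - s ⟨k1, k2, k3, k4⟩ h1 h2
    have hcs : Ctx n w h K L s := hc1.of_frame (d := 22) (ρ := 26)
      ⟨fun x hx => k2 x (by omega) (by omega) (by omega) (by omega) (by omega),
        fun x _ _ => k2 x (by omega) (by omega) (by omega) (by omega) (by omega),
        fun x hx => k3 x (by omega), fun x _ _ => k3 x (by omega), k4⟩
    refine (wp_checkCmd hcs k1).mono le_rfl ?_
    rintro s' ⟨l1, l2⟩
    refine ⟨?_, ?_, fun pc => ⟨⟨?_, ?_, ?_, ?_, ?_⟩, fun x h1 h5 h6 h7 h8 => ?_, fun x hx => ?_, ?_⟩⟩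
    · rw [l1.1 8 (by omega) (by omega) (by omega) (by omega), h1]
    · rw [l1.1 4 (by omega) (by omega) (by omega) (by omega), h2]
    · rw [iterate_succ_apply']; exact l2.p
    · rw [iterate_succ_apply']; exact l2.q
    · rw [iterate_succ_apply']; exact l2.r
    · rw [iterate_succ_apply']; exact l2.s
    · rw [iterate_succ_apply']; simpa using l2.i
    · exact (update_of_ne h8 _ _).trans ((update_of_ne h1 _ _).trans
        ((l1.1 x h1 h5 h6 h7).trans (k2 x h1 h5 h6 h7 h8)))
    · exact (l1.2 x hx).trans (k3 x hx)
    · exact l1.3.trans k4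
  · rintro s ⟨k1, k2, k3, k4⟩ -
    have hfs : Frame 22 26 st s := hf1.trans
      ⟨fun x hx => k2 x (by omega) (by omega) (by omega) (by omega) (by omega),
        fun x _ _ => k2 x (by omega) (by omega) (by omega) (by omega) (by omega),
        fun x hx => k3 x (by omega), fun x _ _ => k3 x (by omega), k4⟩
    have hcs := hctx.of_frame hfs
    have r4 : s.rreg 4 = st.rreg 4 := (k3 4 (by omega)).trans (hr 4 (by omega))
    refine wp_ile_le 5 (by omega) (fun c5 => ?_) fun c5 => ?_
    · rw [hcs.ireg_zero, k1.i] at c5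
      have hacc : T.Accepted n w h L := ⟨hTa, c5⟩
      have f35 := (k3 35 (by omega)).trans e35
      have f36 := (k3 36 (by omega)).trans e36
      have f37 := (k3 37 (by omega)).trans e37
      have f38 := (k3 38 (by omega)).trans e38
      have f39 := (k3 39 (by omega)).trans e39
      have f7 := hcs.rreg_seven
      refine wp_block (by simp [Instr.IsOp]) ⟨hfs.trans ⟨fun _ _ => rfl, fun _ _ _ => rfl,
        fun x hx => ?_, fun x h1 h2 => ?_, rfl⟩, .inr ⟨T, hTa, hacc.piercesAll, ?_, ?_, ?_, ?_, ?_⟩,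
        ?_, candLe_of_solution fun _ => ?_⟩
      · simp [Instr.exec, show x ≠ 0 by omega, show x ≠ 1 by omega, show x ≠ 2 by omega,
          show x ≠ 3 by omega, show x ≠ 4 by omega]
      · simp [Instr.exec, show x ≠ 0 by omega, show x ≠ 1 by omega, show x ≠ 2 by omega,
          show x ≠ 3 by omega, show x ≠ 4 by omega]
      · simp [Instr.exec, f39, f7]
      · simp [Instr.exec, f35, f7]
      · simp [Instr.exec, f36, f7]
      · simp [Instr.exec, f37, f7]
      · simp [Instr.exec, f38, f7]
      · simpa [Instr.exec, f39, f7] using c0.le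
      · simp [Instr.exec, f39, f7, ← hT]
    · rw [hcs.ireg_zero, k1.i] at c5
      refine wp_skip (done _ hfs ?_ r4 fun h => absurd h.2 c5)
      simpa [Best, k3 0 (by omega), k3 1 (by omega), k3 2 (by omega), k3 3 (by omega),
        k3 4 (by omega)] using hb1

end

end LatticePiercing

namespace LatticePiercing

open Quad Function

/-! ### The enumeration -/

/-- The loop over all equations at one level. -/
def eqLoop (d ρ : ℕ) (c : Cmd) : Cmd :=
  coefLoop d ρ (coefLoop (d + 1) (ρ + 1) (indexLoop (d + 2) (ρ + 2) c))

/-- The enumeration of all candidates. -/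
def enumCmd : Cmd := eqLoop 10 10 (eqLoop 13 14 (eqLoop 16 18 (eqLoop 19 22 candCmd)))

theorem HoldsEq.of_frame {w h : ℕ → ℝ} {st st' : Config} {ρ d ρ' : ℕ} {t : ℤ × ℤ × ℕ}
    (H : HoldsEq w h st ρ t) (hf : Frame d ρ' st st') (h1 : 10 ≤ ρ) (h2 : ρ + 4 ≤ ρ') :
    HoldsEq w h st' ρ t := by
  obtain ⟨a, b, c, d⟩ := H
  exact ⟨(hf.4 _ h1 (by omega)).trans a, (hf.4 _ (by omega) (by omega)).trans b,
    (hf.4 _ (by omega) (by omega)).trans c, (hf.4 _ (by omega) (by omega)).trans d⟩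

section

variable {n : ℕ} {w h : ℕ → ℝ} {K L : ℕ}

theorem spec_eqLoop {d ρ : ℕ} (hd : 10 ≤ d) (hρ : 10 ≤ ρ) {c : Cmd} {T : ℕ}
    {G : Config → ℝ → Prop} (hG : ∀ st x y, x ≤ y → G st x → G st y)
    (hc : Spec n w h K L (d + 3) (ρ + 4) c T G) :
    Spec n w h K L d ρ (eqLoop d ρ c) ((2 * K + 1) ^ 2 * (n + 1) * (T + 27)) fun st x =>
      ∀ t, InBox K n t → ∃ st1, Frame d ρ st st1 ∧ HoldsEq w h st1 ρ t ∧ G st1 x := by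
  have s1 := spec_indexLoop (d := d + 2) (ρ := ρ + 2) (by omega) (by omega) hG hc
  have s2 := spec_coefLoop (d := d + 1) (ρ := ρ + 1) (by omega) (by omega) (by
    intro st x y hxy H i hi
    obtain ⟨st1, k1, k2, k3, k4⟩ := H i hi
    exact ⟨st1, k1, k2, k3, hG _ _ _ hxy k4⟩) s1
  have s3 := spec_coefLoop (d := d) (ρ := ρ) (by omega) (by omega) (by
    intro st x y hxy H b hb
    obtain ⟨st1, k1, k2, H⟩ := H b hb
    refine ⟨st1, k1, k2, fun i hi => ?_⟩
    obtain ⟨st2, k1, k2, k3, k4⟩ := H i hi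
    exact ⟨st2, k1, k2, k3, hG _ _ _ hxy k4⟩) s2
  intro st hctx hbest
  refine (s3 st hctx hbest).mono ?_ ?_
  · have h1 : 1 ≤ 2 * K + 1 := by omega
    have h2 : 1 ≤ n + 1 := by omega
    generalize 2 * K + 1 = D at *
    generalize n + 1 = m at *
    have h3 : D ≤ D * D * m := by nlinarith [Nat.mul_le_mul h1 h2, Nat.mul_le_mul h1 h1]
    have h4 : D * D ≤ D * D * m := by nlinarith
    nlinarith
  · rintro st' ⟨k1, k2, k3, k4⟩
    refine ⟨k1, k2, k3, fun t ht => ?_⟩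
    obtain ⟨st1, f1, e1, H1⟩ := k4 t.1 ht.1
    obtain ⟨st2, f2, e2, H2⟩ := H1 t.2.1 ht.2.1
    obtain ⟨st3, f3, e3, e4, H3⟩ := H2 t.2.2 ht.2.2
    refine ⟨st3, f1.trans ((f2.mono (by omega) (by omega)).trans (f3.mono (by omega) (by omega))),
      ⟨?_, ?_, e3, e4⟩, H3⟩
    · rw [f3.4 ρ hρ (by omega), f2.4 ρ hρ (by omega), e1]
    · rw [f3.4 (ρ + 1) (by omega) (by omega), e2]

theorem CandLe.mono (st : Config) (x y : ℝ) (hxy : x ≤ y) (H : CandLe n w h L st x) :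
    CandLe n w h L st y :=
  fun t₁ t₂ t₃ t₄ h1 h2 h3 h4 h5 => (H t₁ t₂ t₃ t₄ h1 h2 h3 h4 h5).trans hxy

theorem spec_enumCmd : Spec n w h K L 10 10 enumCmd
    (((2 * K + 1) ^ 2 * (n + 1)) ^ 4 * (25 * L + 168)) fun _ x =>
      ∀ t₁ t₂ t₃ t₄, InBox K n t₁ → InBox K n t₂ → InBox K n t₃ → InBox K n t₄ →
        (cand w h t₁ t₂ t₃ t₄).Accepted n w h L → (cand w h t₁ t₂ t₃ t₄).det ≤ x := by
  have mono : ∀ {d ρ : ℕ} {G : Config → ℝ → Prop}, (∀ st x y, x ≤ y → G st x → G st y) →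
      ∀ st x y, x ≤ y →
      (∀ t, InBox K n t → ∃ st1, Frame d ρ st st1 ∧ HoldsEq w h st1 ρ t ∧ G st1 x) →
      ∀ t, InBox K n t → ∃ st1, Frame d ρ st st1 ∧ HoldsEq w h st1 ρ t ∧ G st1 y := by
    intro d ρ G hG st x y hxy H t ht
    obtain ⟨st1, k1, k2, k3⟩ := H t ht
    exact ⟨st1, k1, k2, hG _ _ _ hxy k3⟩
  have g0 := CandLe.mono (n := n) (w := w) (h := h) (L := L)
  have s4 := spec_eqLoop (d := 19) (ρ := 22) (by omega) (by omega) g0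
    (spec_candCmd (n := n) (w := w) (h := h) (K := K) (L := L))
  have s3 := spec_eqLoop (d := 16) (ρ := 18) (by omega) (by omega) (mono g0) s4
  have s2 := spec_eqLoop (d := 13) (ρ := 14) (by omega) (by omega) (mono (mono g0)) s3
  have s1 := spec_eqLoop (d := 10) (ρ := 10) (by omega) (by omega) (mono (mono (mono g0))) s2
  intro st hctx hbest
  refine (s1 st hctx hbest).mono ?_ ?_
  · have h1 : 1 ≤ (2 * K + 1) ^ 2 * (n + 1) := Nat.mul_pos (by positivity) (by omega)
    generalize (2 * K + 1) ^ 2 * (n + 1) = E at *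
    have e2 : E ≤ E ^ 4 := Nat.le_self_pow (by norm_num) E
    have e3 : E ^ 2 ≤ E ^ 4 := Nat.pow_le_pow_right h1 (by norm_num)
    have e4 : E ^ 3 ≤ E ^ 4 := Nat.pow_le_pow_right h1 (by norm_num)
    calc E * (E * (E * (E * (25 * L + 60 + 27) + 27) + 27) + 27)
        = E ^ 4 * (25 * L + 87) + 27 * E ^ 3 + 27 * E ^ 2 + 27 * E := by ring
      _ ≤ E ^ 4 * (25 * L + 87) + 27 * E ^ 4 + 27 * E ^ 4 + 27 * E ^ 4 := by gcongr
      _ = _ := by ring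
  · rintro st' ⟨k1, k2, k3, k4⟩
    refine ⟨k1, k2, k3, fun t₁ t₂ t₃ t₄ h1 h2 h3 h4 => ?_⟩
    obtain ⟨st1, f1, e1, H1⟩ := k4 t₁ h1
    obtain ⟨st2, f2, e2, H2⟩ := H1 t₂ h2
    obtain ⟨st3, f3, e3, H3⟩ := H2 t₃ h3
    obtain ⟨st4, f4, e4, H4⟩ := H3 t₄ h4
    exact H4 t₁ t₂ t₃ t₄
      (((e1.of_frame f2 (by omega) (by omega)).of_frame f3 (by omega) (by omega)).of_frame f4
        (by omega) (by omega))
      ((e2.of_frame f3 (by omega) (by omega)).of_frame f4 (by omega) (by omega))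
      (e3.of_frame f4 (by omega) (by omega)) e4

end

/-! ### Sorting the rectangles -/

/-- The widths, continued by `0`. -/
noncomputable def RectFamily.widthAt {n : ℕ} (F : RectFamily n) (i : ℕ) : ℝ :=
  if hi : i < n then F.width ⟨i, hi⟩ else 0

/-- The heights, continued by `0`. -/
noncomputable def RectFamily.heightAt {n : ℕ} (F : RectFamily n) (i : ℕ) : ℝ :=
  if hi : i < n then F.height ⟨i, hi⟩ else 0

/-- The real memory holds the rectangles of the family in some order, and the low registers are
`0`. -/
structure Permuted {n : ℕ} (F : RectFamily n) (st : Config) : Prop where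
  ireg : st.ireg 0 = n
  rreg : ∀ x < 30, st.rreg x = 0
  perm : ∃ σ : Equiv.Perm ℕ, (∀ a, σ a < n ↔ a < n) ∧
    ∀ a, st.rmem (2 * a) = F.widthAt (σ a) ∧ st.rmem (2 * a + 1) = F.heightAt (σ a)

theorem permuted_input {n : ℕ} (F : RectFamily n) : Permuted F F.input := by
  refine ⟨rfl, fun _ _ => rfl, 1, fun a => Iff.rfl, fun a => ⟨?_, ?_⟩⟩
  · by_cases ha : a < n <;> simp [RectFamily.input, RectFamily.widthAt, ha]
  · by_cases ha : a < n <;> simp [RectFamily.input, RectFamily.heightAt, ha,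
      show (2 * a + 1) / 2 = a by omega, show (2 * a + 1) % 2 = 1 by omega]

/-- Exchange the rectangles `I[8] < I[9]` if they are in the wrong order. -/
def swapCmd : Cmd :=
  .ile 9 8 skip
    (.seq (.block [.iadd 5 8 8, .rload 30 5, .iadd 6 9 9, .rload 31 6])
      (.rle 30 31 skip
        (.block [.rstore 5 31, .rstore 6 30, .iconst 1 1, .iadd 5 5 1, .iadd 6 6 1, .rload 30 5,
          .rload 31 6, .rstore 5 31, .rstore 6 30])))

/-- Sort the rectangles by width. -/
def sortCmd : Cmd := .for 8 0 (.for 9 0 swapCmd)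

/-- The first `i` widths are in their places. -/
def SortedTo (n i : ℕ) (st : Config) : Prop :=
  ∀ a < i, ∀ b < n, a < b → st.rmem (2 * a) ≤ st.rmem (2 * b)

/-- The width at `i` is minimal among those between `i` and `j`. -/
def MinimalTo (i j : ℕ) (st : Config) : Prop :=
  ∀ b < j, i < b → st.rmem (2 * i) ≤ st.rmem (2 * b)

section

variable {n : ℕ} {F : RectFamily n}

theorem wp_swapCmd {st : Config} {i j : ℕ} (hP : Permuted F st) (hi : i < n) (hj : j < n)
    (h8 : st.ireg 8 = i) (h9 : st.ireg 9 = j) (hs : SortedTo n i st) (hm : MinimalTo i j st) :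
    wp swapCmd st 17 fun st' => Permuted F st' ∧ st'.ireg 8 = i ∧ st'.ireg 9 = j ∧
      SortedTo n i st' ∧ MinimalTo i (j + 1) st' := by
  refine wp_ile_le 15 le_rfl (fun h1 => ?_) fun h1 => ?_
  · refine wp_skip ⟨hP, h8, h9, hs, fun b hb hib => hm b (by omega) hib⟩
  rw [h8, h9, not_le] at h1
  refine wp_seq_le 4 11 le_rfl (wp_block_le (by simp [Instr.IsOp]) le_rfl ?_)
  set s1 := List.foldl (fun c a => Instr.exec c a) st
    [.iadd 5 8 8, .rload 30 5, .iadd 6 9 9, .rload 31 6] with hs1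
  have i0 : s1.ireg 0 = n := by simp [hs1, Instr.exec, hP.ireg]
  have i8 : s1.ireg 8 = i := by simp [hs1, Instr.exec, h8]
  have i9 : s1.ireg 9 = j := by simp [hs1, Instr.exec, h9]
  have i5 : s1.ireg 5 = 2 * i := by simp [hs1, Instr.exec, h8, two_mul]
  have i6 : s1.ireg 6 = 2 * j := by simp [hs1, Instr.exec, h9, two_mul]
  have r30 : s1.rreg 30 = st.rmem (2 * i) := by simp [hs1, Instr.exec, h8, two_mul]
  have r31 : s1.rreg 31 = st.rmem (2 * j) := by simp [hs1, Instr.exec, h9, two_mul]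
  have hr : ∀ x < 30, s1.rreg x = 0 := fun x hx => by
    simp [hs1, Instr.exec, show x ≠ 30 by omega, show x ≠ 31 by omega, hP.rreg x hx]
  have hmem : s1.rmem = st.rmem := by simp [hs1, Instr.exec]
  clear_value s1
  refine wp_rle_le 9 le_rfl (fun h2 => ?_) fun h2 => ?_
  · rw [r30, r31] at h2
    refine wp_skip ⟨⟨i0, hr, by rw [hmem]; exact hP.perm⟩, i8, i9, ?_, ?_⟩
    · unfold SortedTo; rw [hmem]; exact hs
    · unfold MinimalTo
      rw [hmem]
      intro b hb hib
      rcases Nat.lt_succ_iff_lt_or_eq.1 hb with h3 | rfl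
      · exact hm b h3 hib
      · exact h2
  rw [r30, r31, not_le] at h2
  refine wp_block (by simp [Instr.IsOp]) ?_
  set s2 := List.foldl (fun c a => Instr.exec c a) s1
    [.rstore 5 31, .rstore 6 30, .iconst 1 1, .iadd 5 5 1, .iadd 6 6 1, .rload 30 5,
      .rload 31 6, .rstore 5 31, .rstore 6 30] with hs2
  have hmem2 : s2.rmem = update (update (update (update st.rmem (2 * i) (st.rmem (2 * j))) (2 * j)
      (st.rmem (2 * i))) (2 * i + 1) (st.rmem (2 * j + 1))) (2 * j + 1) (st.rmem (2 * i + 1)) := by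
    simp [hs2, Instr.exec, i5, i6, r30, r31, hmem, show 2 * j + 1 ≠ 2 * i by omega,
      show 2 * i + 1 ≠ 2 * j by omega]
  have ev : ∀ a, s2.rmem (2 * a) = st.rmem (2 * Equiv.swap i j a) := fun a => by
    rw [hmem2, update_of_ne (by omega), update_of_ne (by omega), Equiv.swap_apply_def]
    split_ifs with c1 c2
    · rw [update_of_ne (by omega), c1, update_self]
    · rw [c2, update_self]
    · rw [update_of_ne (by omega), update_of_ne (by omega)]
  have od : ∀ a, s2.rmem (2 * a + 1) = st.rmem (2 * Equiv.swap i j a + 1) := fun a => by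
    rw [hmem2, Equiv.swap_apply_def]
    split_ifs with c1 c2
    · rw [update_of_ne (by omega), c1, update_self]
    · rw [c2, update_self]
    · rw [update_of_ne (by omega), update_of_ne (by omega), update_of_ne (by omega),
        update_of_ne (by omega)]
  have hlt : ∀ a, Equiv.swap i j a < n ↔ a < n := fun a => by
    rw [Equiv.swap_apply_def]; split_ifs <;> omega
  refine ⟨⟨?_, fun x hx => ?_, ?_⟩, ?_, ?_, ?_, ?_⟩
  · simp [hs2, Instr.exec, i0]
  · simp [hs2, Instr.exec, show x ≠ 30 by omega, show x ≠ 31 by omega, hr x hx]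
  · obtain ⟨σ, k1, k2⟩ := hP.perm
    refine ⟨(Equiv.swap i j).trans σ, fun a => ?_, fun a => ?_⟩
    · rw [Equiv.trans_apply, k1, hlt]
    · rw [ev, od, Equiv.trans_apply]; exact k2 _
  · simp [hs2, Instr.exec, i8]
  · simp [hs2, Instr.exec, i9]
  · intro a ha b hb hab
    rw [ev, ev, Equiv.swap_apply_of_ne_of_ne (by omega) (by omega)]
    refine hs a ha _ ((hlt b).2 hb) ?_
    rw [Equiv.swap_apply_def]; split_ifs <;> omega
  · intro b hb hib
    rw [ev, ev, Equiv.swap_apply_left]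
    rcases Nat.lt_succ_iff_lt_or_eq.1 hb with h3 | rfl
    · rw [Equiv.swap_apply_of_ne_of_ne (by omega) (by omega)]
      exact h2.le.trans (hm b h3 hib)
    · rw [Equiv.swap_apply_right]; exact h2.le

theorem Permuted.congr {st st' : Config} (hP : Permuted F st) (h0 : st'.ireg 0 = st.ireg 0)
    (hr : ∀ x < 30, st'.rreg x = st.rreg x) (hm : st'.rmem = st.rmem) : Permuted F st' :=
  ⟨h0.trans hP.1, fun x hx => (hr x hx).trans (hP.2 x hx), by rw [hm]; exact hP.3⟩

theorem wp_sortCmd {st : Config} (hP : Permuted F st) :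
    wp sortCmd st (n * (n * 21 + 6) + 2) fun st' => Permuted F st' ∧ SortedTo n n st' := by
  refine wp_for (m := n) (T := n * (17 + 4) + 2) (by omega) (by omega) (by omega) hP.ireg
    (fun i s => Permuted F s ∧ SortedTo n i s) ?_ ?_ ?_
  · intro pc
    refine ⟨hP.congr (by simp) (fun _ _ => rfl) rfl, fun a ha => absurd ha (by omega)⟩
  · rintro i hi s ⟨hPs, hs⟩ h8 -
    refine wp_for (m := n) (T := 17) (by omega) (by omega) (by omega) hPs.ireg
      (fun j s => Permuted F s ∧ s.ireg 8 = i ∧ SortedTo n i s ∧ MinimalTo i j s) ?_ ?_ ?_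
    · intro pc
      exact ⟨hPs.congr (by simp) (fun _ _ => rfl) rfl, by simpa using h8, hs,
        fun b hb => absurd hb (by omega)⟩
    · rintro j hj s1 ⟨k1, k2, k3, k4⟩ h9 -
      refine (wp_swapCmd k1 hi hj k2 h9 k3 k4).mono le_rfl ?_
      rintro s2 ⟨l1, l2, l3, l4, l5⟩
      exact ⟨l3, l1.ireg, fun pc => ⟨l1.congr (by simp) (fun _ _ => rfl) rfl, by simpa using l2,
        l4, l5⟩⟩
    · rintro s1 ⟨k1, k2, k3, k4⟩ -
      refine ⟨k2, k1.ireg, fun pc => ⟨k1.congr (by simp) (fun _ _ => rfl) rfl, ?_⟩⟩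
      intro a ha b hb hab
      rcases Nat.lt_succ_iff_lt_or_eq.1 ha with h3 | rfl
      · exact k3 a h3 b hb hab
      · exact k4 b hb hab
  · rintro s h -
    exact h

end

end LatticePiercing

namespace LatticePiercing

open Quad Function

/-! ### The constants of the enumeration -/

/-- Load the largest and the smallest width, and the first height twice. -/
def widthOps : List Instr :=
  [.iconst 5 0, .rload 31 5, .iconst 5 1, .rload 32 5, .rload 33 5, .iconst 6 1, .isub 6 0 6,
    .iadd 6 6 6, .rload 30 6]

/-- Update the smallest height `R[32]` and the largest height `R[33]`. -/
def heightCmd : Cmd :=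
  .seq (.block [.iadd 5 8 8, .iconst 6 1, .iadd 5 5 6, .rload 34 5])
    (.seq (.rle 32 34 skip (.block [.radd 32 34 7])) (.rle 34 33 skip (.block [.radd 33 34 7])))

/-- Set the registers that stay constant during the enumeration, from `κ` in `I[9]`. -/
def constOps : List Instr :=
  [.iadd 2 9 9, .iadd 5 2 2, .iadd 5 5 5, .iadd 5 5 5, .iadd 5 5 5, .isub 5 5 2, .iadd 4 0 5,
    .iadd 5 5 5, .iadd 3 5 5, .iconst 1 1, .iadd 3 3 1, .iadd 2 0 1, .rconst 6 1]

/-- Count how often `R[x]` has to be added up to reach `R[y]`. -/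
def ceilCmd (x y : ℕ) : Cmd :=
  .seq (.block [.rconst 34 0, .rconst 35 60])
    (.rwhile y 34 (.block [.radd 34 34 x, .rsub 5 5 35, .iconst 1 1, .iadd 9 9 1]))

/-- Compute the constants. -/
def constCmd : Cmd :=
  .seq (.block widthOps) (.seq (.for 8 0 heightCmd) (.seq (.block [.iconst 9 0])
    (.seq (ceilCmd 31 30) (.seq (ceilCmd 32 33) (.block constOps)))))

/-- The whole program. -/
def mainCmd : Cmd := .seq sortCmd (.seq constCmd enumCmd)

/-- During the computation of the constants, most registers keep their values. -/
structure Fixed (st st' : Config) : Prop where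
  ireg : st'.ireg 0 = st.ireg 0
  rreg : ∀ x < 30, x ≠ 5 → st'.rreg x = st.rreg x
  rmem : st'.rmem = st.rmem

theorem Fixed.trans {s t u : Config} (h : Fixed s t) (h' : Fixed t u) : Fixed s u :=
  ⟨h'.1.trans h.1, fun x a b => (h'.2 x a b).trans (h.2 x a b), h'.3.trans h.3⟩

theorem wp_heightCmd {st : Config} (h7 : st.rreg 7 = 0) :
    wp heightCmd st 10 fun st' => Fixed st st' ∧ st'.ireg 8 = st.ireg 8 ∧
      st'.rreg 30 = st.rreg 30 ∧ st'.rreg 31 = st.rreg 31 ∧ st'.rreg 5 = st.rreg 5 ∧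
      st'.rreg 32 = min (st.rreg 32) (st.rmem (2 * st.ireg 8 + 1)) ∧
      st'.rreg 33 = max (st.rreg 33) (st.rmem (2 * st.ireg 8 + 1)) := by
  refine wp_seq_le 4 6 le_rfl (wp_block_le (by simp [Instr.IsOp]) le_rfl ?_)
  set s1 := List.foldl (fun c a => Instr.exec c a) st
    [.iadd 5 8 8, .iconst 6 1, .iadd 5 5 6, .rload 34 5] with hs1
  have hi : ∀ x, x ≠ 5 → x ≠ 6 → s1.ireg x = st.ireg x := fun x a b => by
    simp [hs1, Instr.exec, a, b]
  have hr : ∀ x, x ≠ 34 → s1.rreg x = st.rreg x := fun x a => by simp [hs1, Instr.exec, a]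
  have h34 : s1.rreg 34 = st.rmem (2 * st.ireg 8 + 1) := by simp [hs1, Instr.exec, two_mul]
  have hm : s1.rmem = st.rmem := by simp [hs1, Instr.exec]
  clear_value s1
  refine wp_seq_le 3 3 le_rfl (wp_rle_le 1 le_rfl (fun h1 => wp_skip ?_) fun h1 =>
    wp_block (by simp [Instr.IsOp]) ?_)
  all_goals rw [h34, hr 32 (by omega)] at h1
  · refine wp_rle_le 1 le_rfl (fun h2 => wp_skip ?_) fun h2 => wp_block (by simp [Instr.IsOp]) ?_
    all_goals rw [h34, hr 33 (by omega)] at h2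
    · refine ⟨⟨hi 0 (by omega) (by omega), fun x a b => hr x (by omega), hm⟩,
        hi 8 (by omega) (by omega), hr 30 (by omega), hr 31 (by omega), hr 5 (by omega), ?_, ?_⟩
      · rw [hr 32 (by omega), min_eq_left h1]
      · rw [hr 33 (by omega), max_eq_left h2]
    · refine ⟨⟨hi 0 (by omega) (by omega), fun x a b => ?_, hm⟩,
        hi 8 (by omega) (by omega), ?_, ?_, ?_, ?_, ?_⟩
      · simp [Instr.exec, show x ≠ 33 by omega, hr x (show x ≠ 34 by omega)]
      · simp [Instr.exec, hr]
      · simp [Instr.exec, hr]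
      · simp [Instr.exec, hr]
      · simp [Instr.exec, hr, min_eq_left h1]
      · simp [Instr.exec, hr, h34, h7, max_eq_right (not_le.1 h2).le]
  · refine wp_rle_le 1 le_rfl (fun h2 => wp_skip ?_) fun h2 => wp_block (by simp [Instr.IsOp]) ?_
    all_goals simp only [List.foldl_cons, List.foldl_nil, Instr.exec, ne_eq,
      Nat.reduceEqDiff, not_false_eq_true, update_of_ne, h34, hr] at h2
    · refine ⟨⟨hi 0 (by omega) (by omega), fun x a b => ?_, hm⟩,
        hi 8 (by omega) (by omega), ?_, ?_, ?_, ?_, ?_⟩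
      · simp [Instr.exec, show x ≠ 32 by omega, hr x (show x ≠ 34 by omega)]
      · simp [Instr.exec, hr]
      · simp [Instr.exec, hr]
      · simp [Instr.exec, hr]
      · simp [Instr.exec, hr, h34, h7, min_eq_right (not_le.1 h1).le]
      · simp [Instr.exec, hr, max_eq_left h2]
    · refine ⟨⟨hi 0 (by omega) (by omega), fun x a b => ?_, hm⟩,
        hi 8 (by omega) (by omega), ?_, ?_, ?_, ?_, ?_⟩
      · simp [Instr.exec, show x ≠ 32 by omega, show x ≠ 33 by omega,
          hr x (show x ≠ 34 by omega)]
      · simp [Instr.exec, hr]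
      · simp [Instr.exec, hr]
      · simp [Instr.exec, hr]
      · simp [Instr.exec, hr, h34, h7, min_eq_right (not_le.1 h1).le]
      · simp [Instr.exec, hr, h34, h7, max_eq_right (not_le.1 h2).le]

theorem wp_ceilCmd {st : Config} {x y : ℕ} (hx : 30 ≤ x ∧ x < 34) (hy : 30 ≤ y ∧ y < 34)
    (hpos : 0 < st.rreg x) {m : ℕ} (hm : m = ⌈st.rreg y / st.rreg x⌉₊) :
    wp (ceilCmd x y) st (m * 6 + 3) fun st' => Fixed st st' ∧
      (∀ z, 30 ≤ z → z < 34 → st'.rreg z = st.rreg z) ∧ st'.rreg 5 = st.rreg 5 - 60 * m ∧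
      st'.ireg 9 = st.ireg 9 + m := by
  refine wp_seq_le 2 (m * (4 + 2) + 1) (by omega) (wp_block (by simp [Instr.IsOp]) ?_)
  refine wp_rwhile (fun j s => Fixed st s ∧ (∀ z, 30 ≤ z → z < 34 → s.rreg z = st.rreg z) ∧
    s.rreg 34 = j * st.rreg x ∧ s.rreg 35 = 60 ∧ s.rreg 5 = st.rreg 5 - 60 * j ∧
    s.ireg 9 = st.ireg 9 + j) ?_ ?_ ?_
  · refine ⟨⟨rfl, fun z a b => ?_, rfl⟩, fun z a b => ?_, ?_, ?_, ?_, ?_⟩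
    · simp [Instr.exec, show z ≠ 34 by omega, show z ≠ 35 by omega]
    · simp [Instr.exec, show z ≠ 34 by omega, show z ≠ 35 by omega]
    · simp [Instr.exec]
    · simp [Instr.exec]
    · simp [Instr.exec]
    · simp [Instr.exec]
  · rintro j hj s ⟨h1, h2, h3, h4, h5, h6⟩
    rw [hm, Nat.lt_ceil, lt_div_iff₀ hpos] at hj
    refine ⟨by rw [h3, h2 y hy.1 hy.2]; exact not_le.2 hj,
      wp_block (by simp [Instr.IsOp]) ⟨h1.trans ⟨?_, fun z a b => ?_, rfl⟩, fun z a b => ?_, ?_, ?_,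
        ?_, ?_⟩⟩
    · simp [Instr.exec]
    · simp [Instr.exec, b, show z ≠ 34 by omega]
    · simp [Instr.exec, show z ≠ 5 by omega, show z ≠ 34 by omega, h2 z a b]
    · simp [Instr.exec, h3, h2 x hx.1 hx.2]; ring
    · simp [Instr.exec, h4]
    · simp [Instr.exec, h4, h5]; ring
    · simp [Instr.exec, h6, add_assoc]
  · rintro s ⟨h1, h2, h3, h4, h5, h6⟩
    refine ⟨?_, h1, h2, h5, h6⟩
    rw [h3, h2 y hy.1 hy.2, hm, ← div_le_iff₀ hpos]
    exact Nat.le_ceil _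

section

variable {n : ℕ} {F : RectFamily n}

theorem RectFamily.widthAt_pos {i : ℕ} (hi : i < n) : 0 < F.widthAt i := by
  rw [RectFamily.widthAt, dif_pos hi]; exact F.width_pos _

theorem RectFamily.heightAt_pos {i : ℕ} (hi : i < n) : 0 < F.heightAt i := by
  rw [RectFamily.heightAt, dif_pos hi]; exact F.height_pos _

theorem wp_constCmd (hn : 0 < n) {st : Config} (hP : Permuted F st) (hs : SortedTo n n st)
    {w h : ℕ → ℝ} (hw : w = fun i => st.rmem (2 * i)) (hh : h = fun i => st.rmem (2 * i + 1)) :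
    ∃ (M N W H : ℝ) (κ : ℕ), Data n w h M N W H κ ∧ κ = ⌈M / W⌉₊ + ⌈N / H⌉₊ ∧
      (∃ i < n, w i = W) ∧ (∃ i < n, h i = H) ∧
      wp constCmd st (14 * n + 6 * κ + 31) fun st' => Ctx n w h (60 * κ) (n + 30 * κ) st' ∧
        st'.rreg 4 = 0 := by
  obtain ⟨σ, k1, k2⟩ := hP.perm
  have wpos : ∀ i < n, 0 < w i := fun i hi => by
    simp only [hw]
    rw [(k2 i).1]
    exact RectFamily.widthAt_pos ((k1 i).2 hi)
  have hpos : ∀ i < n, 0 < h i := fun i hi => by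
    simp only [hh]
    rw [(k2 i).2]
    exact RectFamily.heightAt_pos ((k1 i).2 hi)
  have hσn : ¬ σ n < n := by rw [k1]; omega
  have w0 : w n = 0 := by simp [hw, (k2 n).1, RectFamily.widthAt, hσn]
  have h0 : h n = 0 := by simp [hh, (k2 n).2, RectFamily.heightAt, hσn]
  -- smallest and largest heights of an initial segment
  let lo : ℕ → ℝ := fun j => Nat.rec (h 0) (fun i x => min x (h i)) j
  let hi : ℕ → ℝ := fun j => Nat.rec (h 0) (fun i x => max x (h i)) j
  have hlo : ∀ j ≤ n, (∀ i < j, lo j ≤ h i) ∧ ∃ i < n, h i = lo j := by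
    intro j
    induction j with
    | zero => exact fun _ => ⟨fun i hi => absurd hi (by omega), 0, hn, rfl⟩
    | succ j ih =>
      intro hj
      obtain ⟨e1, i, e2, e3⟩ := ih (by omega)
      refine ⟨fun i' hi' => ?_, ?_⟩
      · rcases Nat.lt_succ_iff_lt_or_eq.1 hi' with e4 | rfl
        · exact (min_le_left _ _).trans (e1 i' e4)
        · exact min_le_right _ _
      · rcases min_choice (lo j) (h j) with e4 | e4
        · exact ⟨i, e2, e3.trans e4.symm⟩
        · exact ⟨j, by omega, e4.symm⟩
  have hhi : ∀ j ≤ n, (∀ i < j, h i ≤ hi j) ∧ ∃ i < n, h i = hi j := by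
    intro j
    induction j with
    | zero => exact fun _ => ⟨fun i hi => absurd hi (by omega), 0, hn, rfl⟩
    | succ j ih =>
      intro hj
      obtain ⟨e1, i, e2, e3⟩ := ih (by omega)
      refine ⟨fun i' hi' => ?_, ?_⟩
      · rcases Nat.lt_succ_iff_lt_or_eq.1 hi' with e4 | rfl
        · exact (e1 i' e4).trans (le_max_left _ _)
        · exact le_max_right _ _
      · rcases max_choice (hi j) (h j) with e4 | e4
        · exact ⟨i, e2, e3.trans e4.symm⟩
        · exact ⟨j, by omega, e4.symm⟩
  obtain ⟨lo1, ilo, lo2, lo3⟩ := hlo n le_rfl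
  obtain ⟨hi1, ihi, hi2, hi3⟩ := hhi n le_rfl
  have Wpos := wpos 0 hn
  have Hpos : 0 < lo n := lo3 ▸ hpos ilo lo2
  refine ⟨w (n - 1), hi n, w 0, lo n, _, ⟨hn, w0, h0, Wpos, Hpos, fun i hi => ?_, lo1,
    fun i hi => ?_, hi1, ⟨n - 1, by omega, rfl⟩, ⟨ihi, hi2, hi3⟩, ?_, ?_⟩, rfl, ⟨0, hn, rfl⟩,
    ⟨ilo, lo2, lo3⟩, ?_⟩
  · rcases Nat.eq_zero_or_pos i with rfl | h1
    · exact le_rfl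
    · simp only [hw]; exact hs 0 hn i hi h1
  · rcases Nat.lt_or_ge i (n - 1) with h1 | h1
    · simp only [hw]; exact hs i hi (n - 1) (by omega) h1
    · rw [show i = n - 1 by omega]
  · rw [← div_le_iff₀ Wpos]
    push_cast
    linarith [Nat.le_ceil (w (n - 1) / w 0), Nat.cast_nonneg (α := ℝ) ⌈hi n / lo n⌉₊]
  · rw [← div_le_iff₀ Hpos]
    push_cast
    linarith [Nat.le_ceil (hi n / lo n), Nat.cast_nonneg (α := ℝ) ⌈w (n - 1) / w 0⌉₊]
  set m₁ := ⌈w (n - 1) / w 0⌉₊ with hm₁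
  set m₂ := ⌈hi n / lo n⌉₊ with hm₂
  refine wp_seq_le 9 (14 * n + 6 * (m₁ + m₂) + 22) (by omega)
    (wp_block (by simp [widthOps, Instr.IsOp]) ?_)
  set s1 := List.foldl (fun c a => Instr.exec c a) st widthOps with hs1
  have f1 : Fixed st s1 := by
    refine ⟨by simp [hs1, widthOps, Instr.exec], fun x a b => ?_, rfl⟩
    simp [hs1, widthOps, Instr.exec, show x ≠ 30 by omega, show x ≠ 31 by omega,
      show x ≠ 32 by omega, show x ≠ 33 by omega]
  have a30 : s1.rreg 30 = w (n - 1) := by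
    simp [hs1, widthOps, Instr.exec, hw, hP.ireg, two_mul]
  have a31 : s1.rreg 31 = w 0 := by simp [hs1, widthOps, Instr.exec, hw]
  have a32 : s1.rreg 32 = h 0 := by simp [hs1, widthOps, Instr.exec, hh]
  have a33 : s1.rreg 33 = h 0 := by simp [hs1, widthOps, Instr.exec, hh]
  have a5 : s1.rreg 5 = 0 := by simp [hs1, widthOps, Instr.exec, hP.rreg 5]
  clear_value s1
  refine wp_seq_le (n * (10 + 4) + 2) (6 * (m₁ + m₂) + 20) (by omega) ?_
  refine wp_for (by omega) (by omega) (by omega) (f1.ireg.trans hP.ireg)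
    (fun j s => Fixed st s ∧ s.rreg 30 = w (n - 1) ∧ s.rreg 31 = w 0 ∧ s.rreg 5 = 0 ∧
      s.rreg 32 = lo j ∧ s.rreg 33 = hi j) ?_ ?_ ?_
  · intro pc
    exact ⟨f1.trans ⟨by simp, fun _ _ _ => rfl, rfl⟩, a30, a31, a5, a32, a33⟩
  · rintro j hj s ⟨g1, g2, g3, g4, g5, g6⟩ h8 hn'
    refine (wp_heightCmd ((g1.rreg 7 (by omega) (by omega)).trans (hP.rreg 7 (by omega)))).mono
      le_rfl ?_
    rintro s' ⟨b1, b2, b3, b4, b5, b6, b7⟩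
    have hj' : s.rmem (2 * s.ireg 8 + 1) = h j := by rw [h8, g1.rmem, hh]
    refine ⟨b2.trans h8, b1.ireg.trans hn', fun pc =>
      ⟨g1.trans (b1.trans ⟨by simp, fun _ _ _ => rfl, rfl⟩), b3.trans g2, b4.trans g3,
        b5.trans g4, ?_, ?_⟩⟩
    · exact b6.trans (by rw [g5, hj'])
    · exact b7.trans (by rw [g6, hj'])
  rintro s2 ⟨g1, g2, g3, g4, g5, g6⟩ -
  refine wp_seq_le 1 (6 * (m₁ + m₂) + 19) (by omega) (wp_block (by simp [Instr.IsOp]) ?_)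
  refine wp_seq_le (m₁ * 6 + 3) (6 * m₂ + 16) (by omega) ?_
  refine (wp_ceilCmd (m := m₁) (by omega) (by omega) (by simpa [Instr.exec, g3] using Wpos)
    (by simp [Instr.exec, g2, g3, hm₁])).mono le_rfl ?_
  rintro s3 ⟨c1, c2, c3, c4⟩
  refine wp_seq_le (m₂ * 6 + 3) 13 (by omega) ?_
  refine (wp_ceilCmd (m := m₂) (by omega) (by omega) (by
    rw [c2 32 (by omega) (by omega)]; simpa [Instr.exec, g5] using Hpos) (by
    rw [c2 32 (by omega) (by omega), c2 33 (by omega) (by omega)]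
    simp [Instr.exec, g5, g6, hm₂])).mono le_rfl ?_
  rintro s4 ⟨d1, d2, d3, d4⟩
  have hf : Fixed st s4 := g1.trans (Fixed.trans
    ⟨c1.ireg.trans (by simp [Instr.exec]), c1.rreg, c1.rmem⟩ d1)
  have e9 : s4.ireg 9 = m₁ + m₂ := by rw [d4, c4]; simp [Instr.exec]
  have e5 : s4.rreg 5 = -(60 * (m₁ + m₂)) := by
    rw [d3, c3]; simp [Instr.exec, g4]; ring
  have e0 : s4.ireg 0 = n := hf.ireg.trans hP.ireg
  refine wp_block (by simp [constOps, Instr.IsOp]) ⟨⟨?_, ?_, ?_, ?_, ?_, ?_, ?_, fun i _ => ?_,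
    fun i _ => ?_⟩, ?_⟩
  · simp [constOps, Instr.exec, e0]
  · simp [constOps, Instr.exec, e0]
  · simp [constOps, Instr.exec, e9]; omega
  · simp [constOps, Instr.exec, e0, e9]; omega
  · simp [constOps, Instr.exec, e5]
  · simp [constOps, Instr.exec]
  · simp [constOps, Instr.exec, hf.rreg 7, hP.rreg 7]
  · simp [constOps, Instr.exec, hf.rmem, hw]
  · simp [constOps, Instr.exec, hf.rmem, hh]
  · simp [constOps, Instr.exec, hf.rreg 4, hP.rreg 4]

end

end LatticePiercing

namespace LatticePiercing

open Quad Function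

/-! ### Correctness and running time -/

section

variable {n : ℕ} {F : RectFamily n}

theorem RectFamily.widthAt_div_le {i j : ℕ} (hi : i < n) (hj : j < n) :
    F.widthAt i / F.widthAt j ≤ F.maxDim := by
  have : Nonempty (Fin n) := ⟨⟨i, hi⟩⟩
  obtain ⟨m, hm⟩ := exists_eq_ciInf_of_finite (f := F.width)
  refine le_trans ?_ (le_max_left _ _)
  rw [RectFamily.widthAt, RectFamily.widthAt, dif_pos hi, dif_pos hj]
  exact div_le_div₀ ((F.width_pos ⟨i, hi⟩).le.trans (le_ciSup (Set.finite_range _).bddAbove _))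
    (le_ciSup (Set.finite_range _).bddAbove _) (hm ▸ F.width_pos m)
    (ciInf_le (Set.finite_range _).bddBelow _)

theorem RectFamily.heightAt_div_le {i j : ℕ} (hi : i < n) (hj : j < n) :
    F.heightAt i / F.heightAt j ≤ F.maxDim := by
  have : Nonempty (Fin n) := ⟨⟨i, hi⟩⟩
  obtain ⟨m, hm⟩ := exists_eq_ciInf_of_finite (f := F.height)
  refine le_trans ?_ (le_max_right _ _)
  rw [RectFamily.heightAt, RectFamily.heightAt, dif_pos hi, dif_pos hj]
  exact div_le_div₀ ((F.height_pos ⟨i, hi⟩).le.trans (le_ciSup (Set.finite_range _).bddAbove _))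
    (le_ciSup (Set.finite_range _).bddAbove _) (hm ▸ F.height_pos m)
    (ciInf_le (Set.finite_range _).bddBelow _)

/-- The number of steps of the program. -/
def stepBound (n κ : ℕ) : ℕ :=
  (n * (n * 21 + 6) + 2) + ((14 * n + 6 * κ + 31) +
    ((2 * (60 * κ) + 1) ^ 2 * (n + 1)) ^ 4 * (25 * (n + 30 * κ) + 168))

theorem stepBound_le {n κ : ℕ} (hn : 1 ≤ n) (hκ : 1 ≤ κ) {k : ℝ} (hk : 1 ≤ k) (hκk : κ ≤ 4 * k) :
    (stepBound n κ : ℝ) ≤ 2 * (3300 * 468512 ^ 4) *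
      (k ^ 8 * (n : ℝ) ^ 4 * (n + k) * Real.log (max k 2)) := by
  have hn' : (1 : ℝ) ≤ n := by exact_mod_cast hn
  have hκ' : (1 : ℝ) ≤ κ := by exact_mod_cast hκ
  set X := k ^ 8 * (n : ℝ) ^ 4 * (n + k) with hX
  have hlog : (1 : ℝ) / 2 ≤ Real.log (max k 2) := by
    refine le_trans ?_ (Real.log_le_log two_pos (le_max_right k 2))
    linarith [Real.log_two_gt_d9]
  have hX0 : 0 ≤ X := by positivity
  have hE : ((2 * (60 * κ) + 1) ^ 2 * (n + 1) : ℝ) ≤ 468512 * (k ^ 2 * n) := by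
    have h1 : (2 * (60 * κ) + 1 : ℝ) ≤ 484 * k := by linarith
    calc ((2 * (60 * κ) + 1) ^ 2 * (n + 1) : ℝ) ≤ (484 * k) ^ 2 * (2 * n) := by
          gcongr; linarith
      _ = _ := by ring
  have hmain : (((2 * (60 * κ) + 1) ^ 2 * (n + 1)) ^ 4 * (25 * (n + 30 * κ) + 168) : ℝ) ≤
      3200 * 468512 ^ 4 * X := by
    calc _ ≤ (468512 * (k ^ 2 * n)) ^ 4 * (3200 * (n + k)) := by
          gcongr; linarith
      _ = _ := by rw [hX]; ring
  have hk8 : (1 : ℝ) ≤ k ^ 8 := one_le_pow₀ hk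
  have hn4 : (n : ℝ) ≤ (n : ℝ) ^ 4 := le_self_pow₀ hn' (by norm_num)
  have hrest : (n : ℝ) ^ 2 + k ≤ X := by
    have h1 : 1 * (n : ℝ) ≤ k ^ 8 * (n : ℝ) ^ 4 := by gcongr
    calc (n : ℝ) ^ 2 + k ≤ 1 * n * (n + k) := by nlinarith
      _ ≤ X := by rw [hX]; gcongr
  have hcast : (stepBound n κ : ℝ) = 21 * (n : ℝ) ^ 2 + 20 * n + 33 + 6 * κ +
      ((2 * (60 * κ) + 1) ^ 2 * (n + 1)) ^ 4 * (25 * (n + 30 * κ) + 168) := by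
    unfold stepBound; push_cast; ring
  rw [hcast]
  have hsmall : 21 * (n : ℝ) ^ 2 + 20 * n + 33 + 6 * κ ≤ 100 * X := by nlinarith
  calc _ ≤ 100 * X + 3200 * 468512 ^ 4 * X := add_le_add hsmall hmain
    _ ≤ 3300 * 468512 ^ 4 * X := by
        rw [← add_mul]
        refine mul_le_mul_of_nonneg_right ?_ hX0
        norm_num
    _ = 2 * (3300 * 468512 ^ 4) * (X * (1 / 2)) := by ring
    _ ≤ _ := by gcongr

theorem Permuted.piercesAll_iff {st : Config} (hP : Permuted F st) (T : Quad) :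
    T.PiercesAll n (fun i => st.rmem (2 * i)) (fun i => st.rmem (2 * i + 1)) ↔
      ∀ i, T.Pierces (F.width i) (F.height i) := by
  obtain ⟨σ, k1, k2⟩ := hP.perm
  constructor
  · intro H i
    have hi : σ.symm i < n := by rw [← k1]; simp
    have := H _ hi
    simp only [k2, Equiv.apply_symm_apply] at this
    simpa [RectFamily.widthAt, RectFamily.heightAt] using this
  · intro H i hi
    have := H ⟨σ i, (k1 i).2 hi⟩
    simpa [k2, RectFamily.widthAt, RectFamily.heightAt, (k1 i).2 hi] using this

/-- The program finds an optimal piercing lattice. -/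
theorem wp_mainCmd (hn : 0 < n) : ∃ κ : ℕ, 1 ≤ κ ∧ κ ≤ 4 * F.maxDim ∧ 1 ≤ F.maxDim ∧
    wp mainCmd F.input (stepBound n κ) fun st => LinearIndependent ℝ ![st.outU, st.outV] ∧
      IsOptimalPiercingLattice F (Submodule.span ℤ {st.outU, st.outV}) := by
  obtain ⟨s1, hr1, hP, hs⟩ := wp_sortCmd (permuted_input F)
  obtain ⟨M, N, W, H, κ, D, hκ, ⟨iW, hiW, rfl⟩, ⟨iH, hiH, rfl⟩, s2, hr2, hctx, h4⟩ :=
    wp_constCmd hn hP hs rfl rfl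
  obtain ⟨s3, hr3, -, hbest, -, hall⟩ := spec_enumCmd s2 hctx (.inl h4)
  have hdim : 1 ≤ F.maxDim := by
    have := RectFamily.widthAt_div_le (F := F) hn hn
    rwa [div_self (RectFamily.widthAt_pos hn).ne'] at this
  refine ⟨κ, D.one_le, ?_, hdim, s3, ?_, ?_⟩
  · obtain ⟨σ, k1, k2⟩ := hP.perm
    obtain ⟨iM, hiM, hM⟩ := D.M_mem
    obtain ⟨iN, hiN, hN⟩ := D.N_mem
    simp only [k2] at hκ hM hN
    have e1 := RectFamily.widthAt_div_le (F := F) ((k1 _).2 hiM) ((k1 _).2 hiW)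
    have e2 := RectFamily.heightAt_div_le (F := F) ((k1 _).2 hiN) ((k1 _).2 hiH)
    rw [hM] at e1
    rw [hN] at e2
    have c1 := Nat.ceil_lt_add_one (a := M / F.widthAt (σ iW))
      (div_nonneg D.M_pos.le (RectFamily.widthAt_pos ((k1 _).2 hiW)).le)
    have c2 := Nat.ceil_lt_add_one (a := N / F.heightAt (σ iH))
      (div_nonneg D.N_pos.le (RectFamily.heightAt_pos ((k1 _).2 hiH)).le)
    rw [hκ]
    push_cast
    linarith
  · have key : wp mainCmd F.input (stepBound n κ) fun s => s = s3 :=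
      wp_seq ⟨s1, hr1, wp_seq ⟨s2, hr2, s3, hr3, rfl⟩⟩
    obtain ⟨s, hs, rfl⟩ := key
    exact hs
  -- every piercing lattice is at most as good as the result
  have hmax : ∀ T' : Quad, T'.Adapted → (∀ i, T'.Pierces (F.width i) (F.height i)) →
      T'.det ≤ s3.rreg 4 := by
    intro T' h1 h2
    obtain ⟨t₁, t₂, t₃, t₄, b₁, b₂, b₃, b₄, hacc, hle⟩ := exists_accepted D
      (fun i j hij hj => hs i (by omega) j hj hij) h1 ((hP.piercesAll_iff T').2 h2)
    exact hle.trans (hall t₁ t₂ t₃ t₄ b₁ b₂ b₃ b₄ hacc)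
  obtain ⟨T₀, h0, h0'⟩ := D.exists_piercing
  have hpos := h0.det_pos.trans_le (hmax T₀ h0 ((hP.piercesAll_iff T₀).1 h0'))
  rcases hbest with hz | ⟨T, hT, hTp, r4, r0, r1, r2, r3⟩
  · exact absurd hz hpos.ne'
  have hU : s3.outU = T.fstVec := by rw [Config.outU, r0, r1]; rfl
  have hV : s3.outV = T.sndVec := by rw [Config.outV, r2, r3]; rfl
  beta_reduce
  rw [hU, hV]
  refine ⟨linearIndependent hT.det_pos.ne', hT.isPlaneLattice,
    (isPiercing_lattice F T).2 ((hP.piercesAll_iff T).1 hTp), fun Λ hΛ hΛp => ?_⟩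
  obtain ⟨T', hT', rfl⟩ := exists_lattice_eq hΛ
  change density T.lattice ≤ _
  rw [hT.density, hT'.density]
  refine inv_anti₀ hT'.det_pos ?_
  rw [← r4]
  exact hmax T' hT' ((isPiercing_lattice F T').1 hΛp)

end

end LatticePiercing

theorem mainTheorem5 :
    ∃ (p : LatticePiercing.Program) (C : ℝ),
      ∀ (n : ℕ), 1 ≤ n → ∀ (F : LatticePiercing.RectFamily n),
        ∃ t : ℕ,
          (t : ℝ) ≤ C * (F.maxDim ^ 8 * (n : ℝ) ^ 4 * ((n : ℝ) + F.maxDim)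
            * Real.log (max F.maxDim 2)) ∧
          p.Halted (p.run t F.input) ∧
          LinearIndependent ℝ ![(p.run t F.input).outU, (p.run t F.input).outV] ∧
          LatticePiercing.IsOptimalPiercingLattice F
            (Submodule.span ℤ {(p.run t F.input).outU, (p.run t F.input).outV}) := by
  refine ⟨LatticePiercing.mainCmd.compile 0, 2 * (3300 * 468512 ^ 4), fun n hn F => ?_⟩
  obtain ⟨κ, hκ, hκk, hk, hwp⟩ := LatticePiercing.wp_mainCmd (F := F) hn
  obtain ⟨t, ht, hhalt, st, pc, ⟨hli, hopt⟩, hrun⟩ := hwp.halts rfl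
  refine ⟨t, ?_, hhalt, ?_, ?_⟩
  · exact le_trans (by exact_mod_cast ht) (LatticePiercing.stepBound_le hn hκ hk hκk)
  · rw [hrun]; exact hli
  · rw [hrun]; exact hopt
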